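/- For a smooth manifold $X$ without boundary let $\Psi_k(X)$ be the set of smooth $k$-dimensional submanifolds $G\subset X$ without boundary that are closed as subsets. For $G\in\Psi_k(X)$, $K\subset X$ compact and $W$ a neighbourhood of the inclusion $G\subset X$ in the space of smooth embeddings $G\to X$ with the (Whitney) $C^\infty$ topology, put $\mathcal V_{K,W}(G)=\{P\in\Psi_k(X) : P\cap K=j(G)\cap K\text{ for some }j\in W\}$; a subset of $\Psi_k(X)$ is open if with each of its elements $G$ it contains some $\mathcal V_{K,W}(G)$. Let $d\ge 2$ and $k\ge 0$, let $M$ be a smooth $d$-manifold whose boundary is $\partial M=N\times\mathbb R$ for a smooth $(d-2)$-manifold $N$ without boundary, and write $\Psi_k(\partial M)=\Psi_k(\partial M\times\mathbb R)$. For $J\subset\mathbb R$ write $G|_J=G\cap(\partial M\times J)$, and for $\alpha\colon J'\to J$ write $\alpha^*G=(\mathrm{id}\times\alpha)^{-1}(G)$. Say that $G$ is orthogonal on $S\subset\mathbb R$ if $G|_{J'}=\alpha^*(G|_J)$ for all open intervals $J,J'\subset S$ and all orientation preserving diffeomorphisms $\alpha\colon J'\to J$. For $a\le b$, call $G\in\Psi_k(\partial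 M)$ a bordism over $[a,b]$ if for some $\epsilon>0$ it is orthogonal on $(-\infty,a+\epsilon)$ and on $(b-\epsilon,\infty)$. Put $t_u(s)=s+u$. A right inverse of $G$ over $[a,b]$ is an $R\in\Psi_k(\partial M)$ such that for some $\epsilon>0$: $R|_{(b-\epsilon,b+\epsilon)}=G|_{(b-\epsilon,b+\epsilon)}$; $(t_{2(b-a)}^*R)|_{(a-\epsilon,a+\epsilon)}=G|_{(a-\epsilon,a+\epsilon)}$; and there is a continuous path $\gamma\colon[0,1]\to\Psi_k(\partial M)$ with $\gamma(0)=G|_{(-\infty,b+\epsilon)}\cup R|_{(b-\epsilon,\infty)}$, with $\gamma(1)$ orthogonal on $(a-\epsilon,2b-a+\epsilon)$, and with $\gamma(t)|_{(-\infty,a+\epsilon)}=G|_{(-\infty,a+\epsilon)}$ and $\gamma(t)|_{(2b-a-\epsilon,\infty)}=R|_{(2b-a-\epsilon,\infty)}$ for all $t$. A left inverse of $G$ over $[a,b]$ is an $L\in\Psi_k(\partial M)$ such that for some $\epsilon>0$: $L|_{(a-\epsilon,a+\epsilon)}=G|_{(a-\epsilon,a+\epsilon)}$; $(t_{-2(b-a)}^*L)|_{(b-\epsilon,b+\epsilon)}=G|_{(b-\epsilon,b+\epsilon)}$;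 and there is a continuous path $\delta\colon[0,1]\to\Psi_k(\partial M)$ with $\delta(0)=L|_{(-\infty,a+\epsilon)}\cup G|_{(a-\epsilon,\infty)}$, with $\delta(1)$ orthogonal on $(2a-b-\epsilon,b+\epsilon)$, and with $\delta(t)|_{(-\infty,2a-b+\epsilon)}=L|_{(-\infty,2a-b+\epsilon)}$ and $\delta(t)|_{(b-\epsilon,\infty)}=G|_{(b-\epsilon,\infty)}$ for all $t$. **Proposition.** $\Psi_k$ is group-like at $M$, that is, every bordism $G\in\Psi_k(\partial M)$ over $[0,1]$ has a right inverse and a left inverse over $[0,1]$. More precisely, for all $a\le b$ and every bordism $G\in\Psi_k(\partial M)$ over $[a,b]$, the flipped submanifold $(2b-\mathrm{id})^*G$ belongs to $\Psi_k(\partial M)$ and is a right inverse of $G$ over $[a,b]$, and $(2a-\mathrm{id})^*G$ belongs to $\Psi_k(\partial M)$ and is a left inverse of $G$ over $[a,b]$. -/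

import Mathlib

open scoped Manifold ContDiff Topology

noncomputable section

namespace SubmanifoldSheaf

section Submanifolds

variable {E : Type*} [NormedAddCommGroup E] [NormedSpace ℝ E] [FiniteDimensional ℝ E]
  {H : Type*} [TopologicalSpace H] (I : ModelWithCorners ℝ E H)
  {X : Type*} [TopologicalSpace X] [ChartedSpace H X]

/-- `e` is a smooth chart of `X` in which the subset `G` is the linear subspace `L`. -/
def IsSliceChart (G : Set X) (e : OpenPartialHomeomorph X H) (L : Submodule ℝ E) : Prop :=
  e ∈ IsManifold.maximalAtlas I ∞ X ∧ ∀ x ∈ e.source, x ∈ G ↔ e.extend I x ∈ L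

/-- `G` is a smooth `k`-dimensional (embedded) submanifold of `X`, without boundary. -/
def IsSubmanifold (k : ℕ) (G : Set X) : Prop :=
  ∀ p ∈ G, ∃ (e : OpenPartialHomeomorph X H) (L : Submodule ℝ E),
    p ∈ e.source ∧ IsSliceChart I G e L ∧ Module.finrank ℝ L = k

variable (X) in
/-- The set `Ψ_k(X)` of smooth `k`-dimensional submanifolds of `X` without boundary that are closed
as subsets of `X`. -/
structure Psi (k : ℕ) where
  /-- the underlying subset -/
  carrier : Set X
  isClosed : IsClosed carrier
  isSubmanifold : IsSubmanifold I k carrier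

/-- `j` restricts to a smooth embedding of the submanifold `G` into `X`, that is, `j` is smooth
on `G` and is a diffeomorphism from `G` onto its image. Only the values of `j` on `G` matter. -/
def IsEmbeddingOn (G : Set X) (j : X → X) : Prop :=
  ContMDiffOn I I ∞ j G ∧
    ∃ i : X → X, ContMDiffOn I I ∞ i (j '' G) ∧ Set.LeftInvOn i j G

/-- The data of a basic neighbourhood of the inclusion `G → X` in the (Whitney) `C^∞` topology:
a locally finite family of compact subsets of `G`, each contained in a slice chart,
an order of differentiation and a tolerance for each member of the family. -/
structure WhitneyDatum (G : Set X) where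
  /-- the index set of the family -/
  idx : Type
  /-- the charts -/
  chart : idx → OpenPartialHomeomorph X H
  /-- the linear subspaces to which the charts map `G` -/
  plane : idx → Submodule ℝ E
  isSliceChart : ∀ a, IsSliceChart I G (chart a) (plane a)
  /-- the compact sets -/
  compact : idx → Set X
  isCompact : ∀ a, IsCompact (compact a)
  compact_subset : ∀ a, compact a ⊆ G ∩ (chart a).source
  locallyFinite : LocallyFinite compact
  /-- the order of differentiation -/
  order : ℕ
  /-- the tolerances -/
  tol : idx → ℝ
  tol_pos : ∀ a, 0 < tol a

variable {I}

/-- The basic neighbourhood of the inclusion `G → X`: on each compact set of the family, `j` stays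
in the chart, and the derivatives of order at most `order` of the difference between `j` and the
inclusion, both read in the chart (as maps from an open subset of the plane to `E`), are smaller
than the tolerance. -/
def WhitneyDatum.nhd {G : Set X} (w : WhitneyDatum I G) : Set (X → X) :=
  {j | ∀ a, (∀ p ∈ w.compact a, j p ∈ (w.chart a).source) ∧
    ∀ y : w.plane a, (y : E) ∈ (w.chart a).extend I '' w.compact a → ∀ m ≤ w.order,
      ‖iteratedFDeriv ℝ m (fun z : w.plane a ↦
        (w.chart a).extend I (j (((w.chart a).extend I).symm z)) - (z : E)) y‖ < w.tol a}

variable {k : ℕ}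

/-- The set `V_{K,W}(G)` of those `P` in `Ψ_k(X)` with `P ∩ K = j(G) ∩ K` for some smooth embedding
`j : G → X` in the neighbourhood `W` of the inclusion, where `W` is the basic neighbourhood given
by `w`. -/
def Psi.basicNhd (G : Psi I X k) (K : Set X) (w : WhitneyDatum I G.carrier) :
    Set (Psi I X k) :=
  {P | ∃ j : X → X, IsEmbeddingOn I G.carrier j ∧ j ∈ w.nhd ∧
    P.carrier ∩ K = j '' G.carrier ∩ K}

/-- The family without members; its neighbourhood consists of all maps. -/
def WhitneyDatum.empty (G : Set X) : WhitneyDatum I G where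
  idx := Empty
  chart := Empty.elim
  plane := Empty.elim
  isSliceChart := fun a ↦ a.elim
  compact := Empty.elim
  isCompact := fun a ↦ a.elim
  compact_subset := fun a ↦ a.elim
  locallyFinite := locallyFinite_of_finite _
  order := 0
  tol := Empty.elim
  tol_pos := fun a ↦ a.elim

/-- The union of two families; its neighbourhood lies in the intersection. -/
def WhitneyDatum.union {G : Set X} (w w' : WhitneyDatum I G) : WhitneyDatum I G where
  idx := w.idx ⊕ w'.idx
  chart := Sum.elim w.chart w'.chart
  plane := Sum.elim w.plane w'.plane
  isSliceChart := by rintro (a | a); exacts [w.isSliceChart a, w'.isSliceChart a]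
  compact := Sum.elim w.compact w'.compact
  isCompact := by rintro (a | a); exacts [w.isCompact a, w'.isCompact a]
  compact_subset := by rintro (a | a); exacts [w.compact_subset a, w'.compact_subset a]
  locallyFinite := w.locallyFinite.sumElim w'.locallyFinite
  order := max w.order w'.order
  tol := Sum.elim w.tol w'.tol
  tol_pos := by rintro (a | a); exacts [w.tol_pos a, w'.tol_pos a]

theorem WhitneyDatum.nhd_union_subset {G : Set X} (w w' : WhitneyDatum I G) :
    (w.union w').nhd ⊆ w.nhd ∩ w'.nhd := fun _ hj ↦
  ⟨fun a ↦ ⟨(hj (Sum.inl a)).1, fun y hy m hm ↦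
      (hj (Sum.inl a)).2 y hy m (hm.trans (le_max_left _ _))⟩,
    fun a ↦ ⟨(hj (Sum.inr a)).1, fun y hy m hm ↦
      (hj (Sum.inr a)).2 y hy m (hm.trans (le_max_right _ _))⟩⟩

theorem Psi.basicNhd_mono {G : Psi I X k} {K K' : Set X} {w w' : WhitneyDatum I G.carrier}
    (hK : K' ⊆ K) (hw : w.nhd ⊆ w'.nhd) : G.basicNhd K w ⊆ G.basicNhd K' w' := by
  rintro P ⟨j, hj, hjw, h⟩
  refine ⟨j, hj, hw hjw, ?_⟩
  have h' := congrArg (fun S ↦ S ∩ K') h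
  simpa only [Set.inter_assoc, Set.inter_eq_self_of_subset_right hK] using h'

/-- The topology of `Ψ_k(X)`: a set is open if with each of its elements `G` it contains
`V_{K,W}(G)` for some compact `K` and some neighbourhood `W` of the inclusion of `G`. -/
instance : TopologicalSpace (Psi I X k) where
  IsOpen U := ∀ G ∈ U, ∃ (K : Set X) (w : WhitneyDatum I G.carrier),
    IsCompact K ∧ G.basicNhd K w ⊆ U
  isOpen_univ := fun G _ ↦ ⟨∅, WhitneyDatum.empty _, isCompact_empty, Set.subset_univ _⟩
  isOpen_inter := by
    rintro U V hU hV G ⟨hGU, hGV⟩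
    obtain ⟨K, w, hK, h⟩ := hU G hGU
    obtain ⟨K', w', hK', h'⟩ := hV G hGV
    have hw := w.nhd_union_subset w'
    exact ⟨K ∪ K', w.union w', hK.union hK', Set.subset_inter
      ((Psi.basicNhd_mono Set.subset_union_left (hw.trans Set.inter_subset_left)).trans h)
      ((Psi.basicNhd_mono Set.subset_union_right (hw.trans Set.inter_subset_right)).trans h')⟩
  isOpen_sUnion := by
    rintro 𝒰 h𝒰 G ⟨U, hU, hG⟩
    obtain ⟨K, w, hK, h⟩ := h𝒰 U hU G hG
    exact ⟨K, w, hK, h.trans (Set.subset_sUnion_of_mem hU)⟩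

end Submanifolds

section Cylinder

variable {B : Type*}

/-- The restriction `G|_J` of a subset of `B × ℝ` to `B × J`. -/
def restr (G : Set (B × ℝ)) (J : Set ℝ) : Set (B × ℝ) := {p | p ∈ G ∧ p.2 ∈ J}

/-- The pullback `α^* G = (id × α)⁻¹ G` of a subset of `B × ℝ`. -/
def pull (α : ℝ → ℝ) (G : Set (B × ℝ)) : Set (B × ℝ) := {p | (p.1, α p.2) ∈ G}

/-- `α` restricts to an orientation preserving diffeomorphism between the open sets `J'` and `J`
of real numbers. -/
def IsOrientedDiffeo (α : ℝ → ℝ) (J' J : Set ℝ) : Prop :=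
  ContDiffOn ℝ ∞ α J' ∧ Set.BijOn α J' J ∧ ∀ s ∈ J', 0 < deriv α s

/-- `G` is orthogonal to `B` on `S`: for all open intervals `J, J' ⊆ S` and every orientation
preserving diffeomorphism `α : J' → J`, the restriction `G|_{J'}` is `α^*(G|_J)`. -/
def IsOrthogonalOn (G : Set (B × ℝ)) (S : Set ℝ) : Prop :=
  ∀ J J' : Set ℝ, IsOpen J → J.OrdConnected → IsOpen J' → J'.OrdConnected → J ⊆ S → J' ⊆ S →
    ∀ α : ℝ → ℝ, IsOrientedDiffeo α J' J → restr G J' = restr (pull α (restr G J)) J'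

variable {E : Type*} [NormedAddCommGroup E] [NormedSpace ℝ E] [FiniteDimensional ℝ E]
  {H : Type*} [TopologicalSpace H] (I : ModelWithCorners ℝ E H)
  [TopologicalSpace B] [ChartedSpace H B]

variable (B) in
/-- The value of `Ψ_k` at a manifold `B` of one dimension less is its value at `B × ℝ`. -/
abbrev PsiCyl (k : ℕ) : Type _ := Psi (I.prod 𝓘(ℝ, ℝ)) (B × ℝ) k

variable {I} {k : ℕ}

/-- `G` is a bordism over `[a, b]`: it is orthogonal on `(-∞, a + ε)` and on `(b - ε, ∞)` for
some `ε > 0`. -/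
def IsBordism (a b : ℝ) (G : PsiCyl B I k) : Prop :=
  ∃ ε : ℝ, 0 < ε ∧ IsOrthogonalOn G.carrier (Set.Iio (a + ε)) ∧
    IsOrthogonalOn G.carrier (Set.Ioi (b - ε))

/-- `R` is a right inverse for `G` over `[a, b]`; the case of a bordism of length one is
`a = 0`, `b = 1`. The path `γ` is a continuous path in the space `Ψ_k(B × ℝ)`. -/
def IsRightInverse (a b : ℝ) (G R : PsiCyl B I k) : Prop :=
  ∃ ε : ℝ, 0 < ε ∧
    restr R.carrier (Set.Ioo (b - ε) (b + ε)) = restr G.carrier (Set.Ioo (b - ε) (b + ε)) ∧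
    restr (pull (fun s ↦ s + 2 * (b - a)) R.carrier) (Set.Ioo (a - ε) (a + ε)) =
      restr G.carrier (Set.Ioo (a - ε) (a + ε)) ∧
    ∃ γ : C(unitInterval, PsiCyl B I k),
      (γ 0).carrier = restr G.carrier (Set.Iio (b + ε)) ∪ restr R.carrier (Set.Ioi (b - ε)) ∧
      IsOrthogonalOn (γ 1).carrier (Set.Ioo (a - ε) (2 * b - a + ε)) ∧
      ∀ t, restr (γ t).carrier (Set.Iio (a + ε)) = restr G.carrier (Set.Iio (a + ε)) ∧
        restr (γ t).carrier (Set.Ioi (2 * b - a - ε)) =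
          restr R.carrier (Set.Ioi (2 * b - a - ε))

/-- `L` is a left inverse for `G` over `[a, b]`; the case of a bordism of length one is
`a = 0`, `b = 1`. -/
def IsLeftInverse (a b : ℝ) (G L : PsiCyl B I k) : Prop :=
  ∃ ε : ℝ, 0 < ε ∧
    restr L.carrier (Set.Ioo (a - ε) (a + ε)) = restr G.carrier (Set.Ioo (a - ε) (a + ε)) ∧
    restr (pull (fun s ↦ s - 2 * (b - a)) L.carrier) (Set.Ioo (b - ε) (b + ε)) =
      restr G.carrier (Set.Ioo (b - ε) (b + ε)) ∧
    ∃ δ : C(unitInterval, PsiCyl B I k),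
      (δ 0).carrier = restr L.carrier (Set.Iio (a + ε)) ∪ restr G.carrier (Set.Ioi (a - ε)) ∧
      IsOrthogonalOn (δ 1).carrier (Set.Ioo (2 * a - b - ε) (b + ε)) ∧
      ∀ t, restr (δ t).carrier (Set.Iio (2 * a - b + ε)) =
          restr L.carrier (Set.Iio (2 * a - b + ε)) ∧
        restr (δ t).carrier (Set.Ioi (b - ε)) = restr G.carrier (Set.Ioi (b - ε))

variable (I) in
/-- An identification of the boundary of the manifold `M` with the manifold `B`, as smooth
manifolds: a smooth embedding of `B` in `M` with image `∂M`. -/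
structure BoundaryIdentification (B : Type*) [TopologicalSpace B] [ChartedSpace H B]
    {E' : Type*} [NormedAddCommGroup E'] [NormedSpace ℝ E'] {H' : Type*} [TopologicalSpace H']
    (I' : ModelWithCorners ℝ E' H') (M : Type*) [TopologicalSpace M] [ChartedSpace H' M] where
  /-- the inclusion of the boundary -/
  toFun : B → M
  isSmoothEmbedding : Manifold.IsSmoothEmbedding I I' ∞ toFun
  range_eq : Set.range toFun = I'.boundary M

/-- The sheaf `Ψ_k` is group-like at the manifold `M` with boundary `∂M = B`: every element of
`Ψ_k(∂M) = Ψ_k(∂M × ℝ)` that is orthogonal on `(-∞, ε)` and on `(1 - ε, ∞)` for some `ε > 0`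
has a right and a left inverse. -/
def IsGroupLikeAt (k : ℕ) {E' : Type*} [NormedAddCommGroup E'] [NormedSpace ℝ E'] {H' : Type*}
    [TopologicalSpace H'] {I' : ModelWithCorners ℝ E' H'} {M : Type*} [TopologicalSpace M]
    [ChartedSpace H' M] (_bM : BoundaryIdentification I B I' M) : Prop :=
  ∀ G : PsiCyl B I k, IsBordism 0 1 G →
    (∃ R : PsiCyl B I k, IsRightInverse 0 1 G R) ∧ ∃ L : PsiCyl B I k, IsLeftInverse 0 1 G L

end Cylinder

end SubmanifoldSheaf

end

/-!
The inverses of a bordism `G` are obtained by folding. Let `f₀` be the map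
`(z, s) ↦ (z, b - |s - b|)` of `∂M × ℝ`, smoothed near `s = b`, where `G` is of product form. The
preimage of `G` under `f₀` is the union of `G` up to `s = b` with its mirror image beyond. Following
the fold by the translation of the last coordinate by `a - b` moves the image into the region where
`G` is of product form, and the preimage becomes orthogonal. The path from the one to the other is
given by the preimages of `G` under a smooth family of maps `f_θ`, once these maps are transverse to
`G`: such preimages form a smooth family of submanifolds (`isSmoothFamily_preimage`), and a smooth
family is a continuous path in `Ψ_k` (`IsSmoothFamily.continuous_slice`).

A smooth family is continuous because over a compact set its members near a given one arise from it
by an ambient isotopy with compact support. Locally the isotopy is a small perturbation of the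
identity (`exists_isIsotopyOn_add`); the local ones are composed by letting the parameter vary from
point to point, so that each of them changes the parameter on a small set only (`IsMovable`).

The translation alone does not give transverse maps, since the crease of the fold sweeps over all
the sections of `G`, also the singular ones. Here it matters that `∂M = N × ℝ` has a coordinate `u`
to spare: before the translation the fold is tilted, so that its crease becomes the graph of
`b - (e u - w x)`, for a nonzero number `e` and a smooth function `w` on `N`. When the tilted fold is
translated, transversality means that the function `s + (e u - w x)` has no critical point on `G`
where `|e u - w x|` is less than the size of the tilt. There are `e` and `w` such that `G` has no
critical point with `e u = w x` (`exists_isRegularAt_of_mem`): locally, the condition excludes the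
pairs of a linear form on `F × ℝ`, with `F` the model space of `N`, and a constant, from a set whose
Hausdorff dimension is at most that of `F × ℝ` (`dense_compl_criticalPairs`), and Baire's theorem
takes care of all the local conditions together. By compactness there is no critical point either
with `|e u - w x| < 1 / m x` for a large smooth function `m` on `N`
(`exists_isRegularAt_of_abs_mul_lt_one`), and the coordinate `e u - w x` is squashed by the maps
`f_θ` into this range (`foldMap`). The transversality is checked in `isSmoothFamily_foldMap`.

For the left inverse the construction is applied to the mirror image of `G`, and the family is
reflected back.
-/

set_option linter.unusedSectionVars false

noncomputable section

namespace SubmanifoldSheaf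

/-! ### Smooth charts with values in the model vector space -/

section Charts

variable {E : Type*} [NormedAddCommGroup E] [NormedSpace ℝ E]
  {H : Type*} [TopologicalSpace H] (I : ModelWithCorners ℝ E H)
  {X : Type*} [TopologicalSpace X] [ChartedSpace H X]

/-- `φ` is a diffeomorphism from an open subset of the manifold `X` onto an open subset of its
model vector space `E`. -/
structure IsSmoothChart (φ : OpenPartialHomeomorph X E) : Prop where
  contMDiffOn : ContMDiffOn I 𝓘(ℝ, E) ∞ φ φ.source
  contMDiffOn_symm : ContMDiffOn 𝓘(ℝ, E) I ∞ φ.symm φ.target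

variable {I}

theorem IsSmoothChart.restrOpen {φ : OpenPartialHomeomorph X E} (hφ : IsSmoothChart I φ)
    {s : Set X} (hs : IsOpen s) : IsSmoothChart I (φ.restrOpen s hs) :=
  ⟨hφ.contMDiffOn.mono fun _ h ↦ by simp at h; exact h.1,
    hφ.contMDiffOn_symm.mono fun _ h ↦ by simp at h; exact h.1⟩

theorem IsSmoothChart.contMDiffAt {φ : OpenPartialHomeomorph X E} (hφ : IsSmoothChart I φ)
    {p : X} (hp : p ∈ φ.source) : ContMDiffAt I 𝓘(ℝ, E) ∞ φ p :=
  hφ.contMDiffOn.contMDiffAt (φ.open_source.mem_nhds hp)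

theorem IsSmoothChart.contMDiffAt_symm {φ : OpenPartialHomeomorph X E} (hφ : IsSmoothChart I φ)
    {z : E} (hz : z ∈ φ.target) : ContMDiffAt 𝓘(ℝ, E) I ∞ φ.symm z :=
  hφ.contMDiffOn_symm.contMDiffAt (φ.open_target.mem_nhds hz)

/-- Change of coordinates by a local diffeomorphism of `E`. -/
theorem IsSmoothChart.trans {φ : OpenPartialHomeomorph X E} (hφ : IsSmoothChart I φ)
    {ψ : OpenPartialHomeomorph E E} (hψ : ContDiffOn ℝ ∞ ψ ψ.source)
    (hψ' : ContDiffOn ℝ ∞ ψ.symm ψ.target) : IsSmoothChart I (φ.trans ψ) := by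
  constructor
  · refine hψ.contMDiffOn.comp (hφ.contMDiffOn.mono ?_) ?_
    · intro p hp; simp at hp; exact hp.1
    · intro p hp; simp at hp; exact hp.2
  · rw [OpenPartialHomeomorph.trans_symm_eq_symm_trans_symm]
    refine hφ.contMDiffOn_symm.comp (hψ'.contMDiffOn.mono ?_) ?_
    · intro p hp; simp at hp; exact hp.1
    · intro p hp; simp at hp; exact hp.2

variable [I.Boundaryless]

variable (I) in
/-- A chart of a manifold without boundary, read in the model vector space. -/
def chartE (e : OpenPartialHomeomorph X H) : OpenPartialHomeomorph X E :=
  e.transHomeomorph I.toHomeomorph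

theorem chartE_target (e : OpenPartialHomeomorph X H) :
    (chartE I e).target = (e.extend I).target := by
  simp [chartE, I.range_eq_univ]; rfl

theorem isSmoothChart_chartE {e : OpenPartialHomeomorph X H}
    (he : e ∈ IsManifold.maximalAtlas I ∞ X) : IsSmoothChart I (chartE I e) := by
  constructor
  · exact OpenPartialHomeomorph.contMDiffOn_extend he
  · have := contMDiffOn_extend_symm he
    refine this.mono ?_
    rw [chartE_target, OpenPartialHomeomorph.extend_target, I.image_eq]

variable (I) in
/-- A chart with values in the model vector space, as a chart with values in the model space. -/
def chartH (φ : OpenPartialHomeomorph X E) : OpenPartialHomeomorph X H :=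
  φ.transHomeomorph I.toHomeomorph.symm

@[simp] theorem chartH_extend_apply (φ : OpenPartialHomeomorph X E) (p : X) :
    (chartH I φ).extend I p = φ p := by
  simp [chartH, I.right_inv (I.range_eq_univ ▸ Set.mem_univ _)]

theorem IsSmoothChart.chartH_mem [IsManifold I ∞ X] {φ : OpenPartialHomeomorph X E}
    (hφ : IsSmoothChart I φ) : chartH I φ ∈ IsManifold.maximalAtlas I ∞ X := by
  apply OpenPartialHomeomorph.mem_maximalAtlas_of_contMDiffOn
  · exact ContMDiffOn.comp (t := Set.univ) (g := I.symm) (f := φ)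
      (by simpa [I.range_eq_univ] using I.contMDiffOn_symm (n := ∞)) hφ.contMDiffOn
      (fun _ _ ↦ Set.mem_univ _)
  · refine hφ.contMDiffOn_symm.comp (I.contMDiff.contMDiffOn) ?_
    intro z hz
    simpa [chartH] using hz

theorem IsSmoothChart.isSliceChart [IsManifold I ∞ X] {φ : OpenPartialHomeomorph X E}
    (hφ : IsSmoothChart I φ) {G : Set X} {L : Submodule ℝ E}
    (h : ∀ p ∈ φ.source, p ∈ G ↔ φ p ∈ L) : IsSliceChart I G (chartH I φ) L :=
  ⟨hφ.chartH_mem, fun p hp ↦ by rw [chartH_extend_apply]; exact h p hp⟩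

/-- Every point lies in a smooth chart. -/
theorem exists_isSmoothChart [IsManifold I ∞ X] (p : X) :
    ∃ φ : OpenPartialHomeomorph X E, IsSmoothChart I φ ∧ p ∈ φ.source :=
  ⟨chartE I (chartAt H p), isSmoothChart_chartE (IsManifold.chart_mem_maximalAtlas p),
    mem_chart_source H p⟩

end Charts

/-! ### Isotopies with compact support -/

section Isotopies

variable {E : Type*} [NormedAddCommGroup E] [NormedSpace ℝ E]
  {H : Type*} [TopologicalSpace H] (I : ModelWithCorners ℝ E H)
  {X : Type*} [TopologicalSpace X] [ChartedSpace H X]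

/-- For `t` in the neighbourhood `O` of `t₀` the maps `J t` are diffeomorphisms of `X` with
inverse `J' t`, equal to the identity outside the compact set `C`, and depend smoothly on `t`;
`J t₀` is the identity. -/
structure IsIsotopyOn (t₀ : ℝ) (O : Set ℝ) (C : Set X) (J J' : ℝ → X → X) : Prop where
  isOpen : IsOpen O
  mem : t₀ ∈ O
  isCompact : IsCompact C
  smooth : ContMDiffOn (𝓘(ℝ, ℝ).prod I) I ∞ (fun q : ℝ × X ↦ J q.1 q.2) (O ×ˢ Set.univ)
  smooth_symm : ContMDiffOn (𝓘(ℝ, ℝ).prod I) I ∞ (fun q : ℝ × X ↦ J' q.1 q.2) (O ×ˢ Set.univ)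
  left_inv : ∀ t ∈ O, ∀ p, J' t (J t p) = p
  right_inv : ∀ t ∈ O, ∀ p, J t (J' t p) = p
  map_base : ∀ p, J t₀ p = p
  map_of_notMem : ∀ t ∈ O, ∀ p, p ∉ C → J t p = p

variable {I} {t₀ : ℝ} {O O₁ : Set ℝ} {C C₁ : Set X} {J J' J₁ J₁' : ℝ → X → X}

theorem IsIsotopyOn.symm (h : IsIsotopyOn I t₀ O C J J') : IsIsotopyOn I t₀ O C J' J where
  isOpen := h.isOpen
  mem := h.mem
  isCompact := h.isCompact
  smooth := h.smooth_symm
  smooth_symm := h.smooth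
  left_inv := h.right_inv
  right_inv := h.left_inv
  map_base p := by simpa only [h.map_base] using h.left_inv t₀ h.mem p
  map_of_notMem t ht p hp := by
    simpa only [h.map_of_notMem t ht p hp] using h.left_inv t ht p

theorem IsIsotopyOn.mono (h : IsIsotopyOn I t₀ O C J J') (hO₁ : IsOpen O₁) (h₁ : t₀ ∈ O₁)
    (hO : O₁ ⊆ O) : IsIsotopyOn I t₀ O₁ C J J' where
  isOpen := hO₁
  mem := h₁
  isCompact := h.isCompact
  smooth := h.smooth.mono (Set.prod_mono hO subset_rfl)
  smooth_symm := h.smooth_symm.mono (Set.prod_mono hO subset_rfl)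
  left_inv t ht := h.left_inv t (hO ht)
  right_inv t ht := h.right_inv t (hO ht)
  map_base := h.map_base
  map_of_notMem t ht := h.map_of_notMem t (hO ht)

theorem contMDiffOn_comp_time {J J₁ : ℝ → X → X}
    (h : ContMDiffOn (𝓘(ℝ, ℝ).prod I) I ∞ (fun q : ℝ × X ↦ J q.1 q.2) (O ×ˢ Set.univ))
    (h₁ : ContMDiffOn (𝓘(ℝ, ℝ).prod I) I ∞ (fun q : ℝ × X ↦ J₁ q.1 q.2) (O ×ˢ Set.univ)) :
    ContMDiffOn (𝓘(ℝ, ℝ).prod I) I ∞ (fun q : ℝ × X ↦ J₁ q.1 (J q.1 q.2)) (O ×ˢ Set.univ) :=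
  h₁.comp (contMDiffOn_fst.prodMk h) fun _ hq ↦ ⟨hq.1, Set.mem_univ _⟩

theorem IsIsotopyOn.trans (h : IsIsotopyOn I t₀ O C J J') (h₁ : IsIsotopyOn I t₀ O C₁ J₁ J₁') :
    IsIsotopyOn I t₀ O (C ∪ C₁) (fun t p ↦ J₁ t (J t p)) (fun t p ↦ J' t (J₁' t p)) where
  isOpen := h.isOpen
  mem := h.mem
  isCompact := h.isCompact.union h₁.isCompact
  smooth := contMDiffOn_comp_time h.smooth h₁.smooth
  smooth_symm := contMDiffOn_comp_time h₁.smooth_symm h.smooth_symm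
  left_inv t ht p := by simp only [h₁.left_inv t ht, h.left_inv t ht]
  right_inv t ht p := by simp only [h₁.right_inv t ht, h.right_inv t ht]
  map_base p := by simp only [h.map_base, h₁.map_base]
  map_of_notMem t ht p hp := by
    rw [Set.mem_union, not_or] at hp
    rw [h.map_of_notMem t ht p hp.1, h₁.map_of_notMem t ht p hp.2]

theorem IsIsotopyOn.refl (t₀ : ℝ) :
    IsIsotopyOn I t₀ Set.univ (∅ : Set X) (fun _ p ↦ p) (fun _ p ↦ p) where
  isOpen := isOpen_univ
  mem := Set.mem_univ _
  isCompact := isCompact_empty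
  smooth := contMDiffOn_snd
  smooth_symm := contMDiffOn_snd
  left_inv _ _ _ := rfl
  right_inv _ _ _ := rfl
  map_base _ := rfl
  map_of_notMem _ _ _ _ := rfl

theorem IsIsotopyOn.mapsTo (h : IsIsotopyOn I t₀ O C J J') {t : ℝ} (ht : t ∈ O) {p : X}
    (hp : p ∈ C) : J t p ∈ C := by
  by_contra hn
  have h1 := h.symm.map_of_notMem t ht _ hn
  rw [h.left_inv t ht] at h1
  exact hn (h1 ▸ hp)

variable {C : Set E} {J J' : ℝ → E → E} {φ : OpenPartialHomeomorph X E}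

open Classical in
/-- A map of `E`, transported to `X` by a chart and extended by the identity. -/
def transport (φ : OpenPartialHomeomorph X E) (j : E → E) (p : X) : X :=
  if p ∈ φ.source then φ.symm (j (φ p)) else p

theorem transport_of_mem {j : E → E} {p : X} (hp : p ∈ φ.source) :
    transport φ j p = φ.symm (j (φ p)) := if_pos hp

theorem transport_of_notMem {j : E → E} {p : X} (hp : p ∉ φ.source) :
    transport φ j p = p := if_neg hp

theorem contMDiffOn_transport [T2Space X] (hφ : IsSmoothChart I φ) (hC : C ⊆ φ.target)
    (h : IsIsotopyOn 𝓘(ℝ, E) t₀ O C J J') :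
    ContMDiffOn (𝓘(ℝ, ℝ).prod I) I ∞ (fun q : ℝ × X ↦ transport φ (J q.1) q.2)
      (O ×ˢ Set.univ) := by
  have hK : IsClosed (φ.symm '' C) :=
    (h.isCompact.image_of_continuousOn (φ.continuousOn_symm.mono hC)).isClosed
  rintro ⟨t, p⟩ ⟨ht, -⟩
  apply ContMDiffAt.contMDiffWithinAt
  by_cases hp : p ∈ φ.source
  · have hmem : J t (φ p) ∈ φ.target := by
      by_cases hc : φ p ∈ C
      · exact hC (h.mapsTo ht hc)
      · rw [h.map_of_notMem t ht _ hc]; exact φ.map_source hp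
    have h1 : ContMDiffAt (𝓘(ℝ, ℝ).prod I) I ∞ (fun q : ℝ × X ↦ φ.symm (J q.1 (φ q.2))) (t, p) := by
      have hJ := h.smooth.contMDiffAt (x := (t, φ p))
        ((h.isOpen.prod isOpen_univ).mem_nhds ⟨ht, Set.mem_univ _⟩)
      have hpair : ContMDiffAt (𝓘(ℝ, ℝ).prod I) (𝓘(ℝ, ℝ).prod 𝓘(ℝ, E)) ∞
          (fun q : ℝ × X ↦ (q.1, φ q.2)) (t, p) :=
        contMDiffAt_fst.prodMk ((hφ.contMDiffAt hp).comp (t, p) contMDiffAt_snd)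
      have h2 := ContMDiffAt.comp (t, p) (f := fun q : ℝ × X ↦ (q.1, φ q.2)) hJ hpair
      exact ContMDiffAt.comp (t, p) (hφ.contMDiffAt_symm hmem) h2
    refine h1.congr_of_eventuallyEq ?_
    have : ∀ᶠ q : ℝ × X in 𝓝 (t, p), q.2 ∈ φ.source :=
      continuousAt_snd.eventually (φ.open_source.mem_nhds hp)
    filter_upwards [this] with q hq using transport_of_mem hq
  · have hp' : p ∉ φ.symm '' C := by
      rintro ⟨z, hz, rfl⟩; exact hp (φ.map_target (hC hz))
    refine contMDiffAt_snd.congr_of_eventuallyEq ?_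
    have h1 : ∀ᶠ q : ℝ × X in 𝓝 (t, p), q.2 ∉ φ.symm '' C :=
      (hK.isOpen_compl.preimage continuous_snd).mem_nhds (x := (t, p)) hp'
    have h2 : ∀ᶠ q : ℝ × X in 𝓝 (t, p), q.1 ∈ O :=
      continuousAt_fst.eventually (h.isOpen.mem_nhds ht)
    filter_upwards [h1, h2] with q hq hq'
    by_cases hs : q.2 ∈ φ.source
    · rw [transport_of_mem hs, h.map_of_notMem _ hq', φ.left_inv hs]
      exact fun hc ↦ hq ⟨_, hc, φ.left_inv hs⟩
    · exact transport_of_notMem hs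

theorem transport_transport (hC : C ⊆ φ.target) (h : IsIsotopyOn 𝓘(ℝ, E) t₀ O C J J') {t : ℝ}
    (ht : t ∈ O) (p : X) : transport φ (J' t) (transport φ (J t) p) = p := by
  by_cases hp : p ∈ φ.source
  · have hmem : J t (φ p) ∈ φ.target := by
      by_cases hc : φ p ∈ C
      · exact hC (h.mapsTo ht hc)
      · rw [h.map_of_notMem t ht _ hc]; exact φ.map_source hp
    rw [transport_of_mem hp, transport_of_mem (φ.map_target hmem), φ.right_inv hmem,
      h.left_inv t ht, φ.left_inv hp]
  · rw [transport_of_notMem hp, transport_of_notMem hp]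

theorem IsIsotopyOn.transport [T2Space X] (hφ : IsSmoothChart I φ) (hC : C ⊆ φ.target)
    (h : IsIsotopyOn 𝓘(ℝ, E) t₀ O C J J') :
    IsIsotopyOn I t₀ O (φ.symm '' C) (fun t ↦ transport φ (J t))
      (fun t ↦ SubmanifoldSheaf.transport φ (J' t)) where
  isOpen := h.isOpen
  mem := h.mem
  isCompact := h.isCompact.image_of_continuousOn (φ.continuousOn_symm.mono hC)
  smooth := contMDiffOn_transport hφ hC h
  smooth_symm := contMDiffOn_transport hφ hC h.symm
  left_inv t ht p := transport_transport hC h ht p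
  right_inv t ht p := transport_transport hC h.symm ht p
  map_base p := by
    by_cases hp : p ∈ φ.source
    · rw [transport_of_mem hp, h.map_base, φ.left_inv hp]
    · exact transport_of_notMem hp
  map_of_notMem t ht p hp := by
    by_cases hs : p ∈ φ.source
    · rw [transport_of_mem hs, h.map_of_notMem t ht, φ.left_inv hs]
      exact fun hc ↦ hp ⟨_, hc, φ.left_inv hs⟩
    · exact transport_of_notMem hs

end Isotopies

/-! ### Perturbations of the identity -/

section Perturbation

variable {V : Type*} [NormedAddCommGroup V] [NormedSpace ℝ V]
  {E : Type*} [NormedAddCommGroup E] [NormedSpace ℝ E]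

/-- The derivatives of a smooth map in the second variable depend smoothly on both variables. -/
theorem contDiffAt_iteratedFDeriv_slice {F : ℝ × V → E} {Ω : Set (ℝ × V)} (hΩ : IsOpen Ω)
    (hF : ContDiffOn ℝ ∞ F Ω) (m : ℕ) : ∀ q ∈ Ω,
      ContDiffAt ℝ ∞ (fun q : ℝ × V ↦ iteratedFDeriv ℝ m (fun z ↦ F (q.1, z)) q.2) q := by
  induction m with
  | zero =>
    intro q hq
    have h := (hF.contDiffAt (hΩ.mem_nhds hq)).continuousLinearMap_comp
      ((continuousMultilinearCurryFin0 ℝ V E).symm.toContinuousLinearEquiv :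
        E →L[ℝ] V [×0]→L[ℝ] E)
    exact h
  | succ m ih =>
    intro q hq
    have h1 : ContDiffAt ℝ ∞ (fun q : ℝ × V ↦
        fderiv ℝ (iteratedFDeriv ℝ m (fun z ↦ F (q.1, z))) q.2) q := by
      refine ContDiffAt.fderiv (n := ∞) (f := fun q : ℝ × V ↦
        iteratedFDeriv ℝ m (fun z ↦ F (q.1, z))) (g := Prod.snd) ?_ contDiffAt_snd (by simp)
      exact ContDiffAt.comp (g := fun q : ℝ × V ↦ iteratedFDeriv ℝ m (fun z ↦ F (q.1, z)) q.2)
        (f := fun r : (ℝ × V) × V ↦ (r.1.1, r.2)) (q, q.2) (ih q hq) (by fun_prop)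
    exact h1.continuousLinearMap_comp
      ((continuousMultilinearCurryLeftEquiv ℝ (fun _ : Fin (m + 1) ↦ V) E).symm
        |>.toContinuousLinearEquiv : (V →L[ℝ] V [×m]→L[ℝ] E) →L[ℝ] V [×(m + 1)]→L[ℝ] E)

theorem eventually_norm_iteratedFDeriv_slice_lt {F : ℝ × V → E} {Ω : Set (ℝ × V)} (hΩ : IsOpen Ω)
    (hF : ContDiffOn ℝ ∞ F Ω) {t₀ : ℝ} (h0 : ∀ z, (t₀, z) ∈ Ω → F (t₀, z) = 0)
    {K : Set V} (hK : IsCompact K) (hKΩ : ∀ z ∈ K, (t₀, z) ∈ Ω) (m : ℕ) {ε : ℝ} (hε : 0 < ε) :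
    ∀ᶠ t in 𝓝 t₀, ∀ z ∈ K, ‖iteratedFDeriv ℝ m (fun z ↦ F (t, z)) z‖ < ε := by
  refine hK.eventually_forall_of_forall_eventually (x₀ := t₀) fun z hz ↦ ?_
  have hc := (contDiffAt_iteratedFDeriv_slice hΩ hF m (t₀, z) (hKΩ z hz)).continuousAt.norm
  refine hc.eventually_lt_const ?_
  have : (fun z ↦ F (t₀, z)) =ᶠ[𝓝 z] fun _ ↦ 0 := by
    have : ∀ᶠ z' in 𝓝 z, (t₀, z') ∈ Ω :=
      (Continuous.prodMk_right t₀).continuousAt.preimage_mem_nhds (hΩ.mem_nhds (hKΩ z hz))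
    filter_upwards [this] with z' hz' using h0 z' hz'
  have h := (this.iteratedFDeriv ℝ m).eq_of_nhds
  simp only at h ⊢
  rw [h]
  simpa using hε

variable [FiniteDimensional ℝ E]

/-- A smooth one-parameter family of compactly supported perturbations of the identity of `E`,
starting at the identity, is an isotopy for small parameters. -/
theorem exists_isIsotopyOn_add {t₀ : ℝ} {O : Set ℝ} (hO : IsOpen O) (ht₀ : t₀ ∈ O)
    {C : Set E} (hC : IsCompact C) {h : ℝ × E → E}
    (hh : ContDiffOn ℝ ∞ h (O ×ˢ Set.univ)) (h0 : ∀ z, h (t₀, z) = 0)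
    (hsupp : ∀ t ∈ O, ∀ z ∉ C, h (t, z) = 0) :
    ∃ O₁ ⊆ O, ∃ J' : ℝ → E → E,
      IsIsotopyOn 𝓘(ℝ, E) t₀ O₁ C (fun t z ↦ z + h (t, z)) J' := by
  have hΩ : IsOpen (O ×ˢ (Set.univ : Set E)) := hO.prod isOpen_univ
  have hsmooth : ∀ t ∈ O, ∀ z, ContDiffAt ℝ ∞ h (t, z) := fun t ht z ↦
    hh.contDiffAt (hΩ.mem_nhds ⟨ht, Set.mem_univ _⟩)
  have hslice : ∀ t ∈ O, Differentiable ℝ (fun z ↦ h (t, z)) := fun t ht z ↦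
    (ContDiffAt.comp z (hsmooth t ht z) (by fun_prop : ContDiffAt ℝ ∞ (fun z ↦ (t, z)) z)
      ).differentiableAt (by simp)
  -- the perturbation becomes a contraction
  have hev : ∀ᶠ t in 𝓝 t₀, ∀ z ∈ C, ‖iteratedFDeriv ℝ 1 (fun z ↦ h (t, z)) z‖ < 1 / 2 :=
    eventually_norm_iteratedFDeriv_slice_lt hΩ hh (fun z _ ↦ h0 z) hC
      (fun z _ ↦ ⟨ht₀, Set.mem_univ _⟩) 1 (by norm_num)
  obtain ⟨O₂, hO₂, hO₂o, hO₂t⟩ := mem_nhds_iff.1 hev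
  have hlip : ∀ t ∈ O ∩ O₂, LipschitzWith (1 / 2) (fun z ↦ h (t, z)) := by
    intro t ht
    refine lipschitzWith_of_nnnorm_fderiv_le (𝕜 := ℝ) (hslice t ht.1) fun z ↦ ?_
    rw [← NNReal.coe_le_coe, coe_nnnorm]
    by_cases hz : z ∈ C
    · have := hO₂ ht.2 z hz
      rw [norm_iteratedFDeriv_one] at this
      simpa using this.le
    · have : (fun z ↦ h (t, z)) =ᶠ[𝓝 z] fun _ ↦ 0 := by
        filter_upwards [hC.isClosed.isOpen_compl.mem_nhds hz] with z' hz' using hsupp t ht.1 z' hz'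
      rw [this.fderiv_eq]
      simp
  have happ : ∀ t ∈ O ∩ O₂, ApproximatesLinearOn (fun z ↦ z + h (t, z))
      ((ContinuousLinearEquiv.refl ℝ E : E ≃L[ℝ] E) : E →L[ℝ] E) Set.univ (1 / 2) := by
    intro t ht x _ y _
    have := (hlip t ht).dist_le_mul x y
    rw [dist_eq_norm, dist_eq_norm] at this
    simp only [ContinuousLinearEquiv.coe_refl, ContinuousLinearMap.coe_id', id]
    rwa [show x + h (t, x) - (y + h (t, y)) - (x - y) = h (t, x) - h (t, y) by abel]
  have hN : Subsingleton E ∨ (1 / 2 : NNReal) <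
      ‖((ContinuousLinearEquiv.refl ℝ E).symm : E →L[ℝ] E)‖₊⁻¹ := by
    rcases subsingleton_or_nontrivial E with hE | hE
    · exact Or.inl hE
    · right
      simp only [ContinuousLinearEquiv.refl_symm, ContinuousLinearEquiv.coe_refl]
      rw [ContinuousLinearMap.nnnorm_id]
      rw [inv_one, ← NNReal.coe_lt_coe]; norm_num
  have hinj : ∀ t ∈ O ∩ O₂, Function.Injective (fun z ↦ z + h (t, z)) := fun t ht ↦
    Set.injOn_univ.1 ((happ t ht).injOn hN)
  have hsurj : ∀ t ∈ O ∩ O₂, Function.Surjective (fun z ↦ z + h (t, z)) := fun t ht ↦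
    (happ t ht).surjective hN
  choose! J' hJ' using hsurj
  have hbase : ∀ t ∈ O ∩ O₂, ∀ z, J' t (z + h (t, z)) = z := fun t ht z ↦
    hinj t ht (hJ' t ht _)
  have hop : IsOpen (O ∩ O₂) := hO.inter hO₂o
  refine ⟨O ∩ O₂, Set.inter_subset_left, J', hop, ⟨ht₀, hO₂t⟩, hC, ?_, ?_, hbase, hJ', ?_, ?_⟩
  · rw [← modelWithCornersSelf_prod, chartedSpaceSelf_prod, contMDiffOn_iff_contDiffOn]
    exact contDiffOn_snd.add (hh.mono (Set.prod_mono Set.inter_subset_left subset_rfl))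
  · rw [← modelWithCornersSelf_prod, chartedSpaceSelf_prod, contMDiffOn_iff_contDiffOn]
    -- the inverse function theorem for `(t, z) ↦ (t, z + h (t, z))`
    rintro ⟨t, y⟩ ⟨ht, -⟩
    apply ContDiffAt.contDiffWithinAt
    obtain ⟨z, rfl⟩ : ∃ z, z + h (t, z) = y := ⟨_, hJ' t ht y⟩
    set T : ℝ × E → ℝ × E := fun q ↦ (q.1, q.2 + h q) with hT
    have hTs : ContDiffAt ℝ ∞ T (t, z) :=
      contDiffAt_fst.prodMk (contDiffAt_snd.add (hsmooth t ht.1 z))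
    have hd := (hsmooth t ht.1 z).differentiableAt (by simp)
    have hTd : HasFDerivAt T ((ContinuousLinearMap.fst ℝ ℝ E).prod
        (ContinuousLinearMap.snd ℝ ℝ E + fderiv ℝ h (t, z))) (t, z) :=
      hasFDerivAt_fst.prodMk (hasFDerivAt_snd.add hd.hasFDerivAt)
    set D := (ContinuousLinearMap.fst ℝ ℝ E).prod
        (ContinuousLinearMap.snd ℝ ℝ E + fderiv ℝ h (t, z)) with hD
    have hDinj : Function.Injective D := by
      rw [injective_iff_map_eq_zero]
      rintro ⟨a, v⟩ hav
      simp only [hD, ContinuousLinearMap.prod_apply, Prod.mk_eq_zero] at hav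
      obtain ⟨h1, h2⟩ := hav
      simp only [ContinuousLinearMap.coe_fst'] at h1
      subst h1
      simp only [add_apply, ContinuousLinearMap.coe_snd'] at h2
      have h3 : fderiv ℝ h (t, z) (0, v) = fderiv ℝ (fun z ↦ h (t, z)) z v := by
        have := (hd.hasFDerivAt.comp z (hasFDerivAt_prodMk_right t z)).fderiv
        have h4 : fderiv ℝ (fun z ↦ h (t, z)) z = _ := this
        rw [h4]; simp
      have h4 : ‖fderiv ℝ (fun z ↦ h (t, z)) z v‖ ≤ 1 / 2 * ‖v‖ := by
        refine (ContinuousLinearMap.le_opNorm _ _).trans ?_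
        gcongr
        simpa using norm_fderiv_le_of_lipschitz ℝ (hlip t ht) (x₀ := z)
      rw [← h3, show fderiv ℝ h (t, z) (0, v) = -v from
        (eq_neg_of_add_eq_zero_right h2), norm_neg] at h4
      have : v = 0 := by
        rw [← norm_le_zero_iff]; linarith
      simp [this]
    set D' : (ℝ × E) ≃L[ℝ] (ℝ × E) :=
      (LinearEquiv.ofInjectiveEndo (D : (ℝ × E) →ₗ[ℝ] ℝ × E) hDinj).toContinuousLinearEquiv
    have hD' : (D' : (ℝ × E) →L[ℝ] ℝ × E) = D := by ext x <;> rfl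
    have hTd' : HasFDerivAt T (D' : (ℝ × E) →L[ℝ] ℝ × E) (t, z) := by rw [hD']; exact hTd
    have hn : (∞ : WithTop ℕ∞) ≠ 0 := by simp
    have hloc := hTs.to_localInverse hTd' hn
    have hri := (hTs.hasStrictFDerivAt' hTd' hn).eventually_right_inverse
    have hTtz : T (t, z) = (t, z + h (t, z)) := rfl
    rw [hTtz] at hloc hri
    refine (contDiffAt_snd.comp _ hloc).congr_of_eventuallyEq ?_
    have hO' : ∀ᶠ q : ℝ × E in 𝓝 (t, z + h (t, z)), q.1 ∈ O ∩ O₂ :=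
      continuousAt_fst.eventually (hop.mem_nhds ht)
    filter_upwards [hri, hO'] with q hq hqO
    have hq' : T (hTs.localInverse hTd' hn q) = q := hq
    simp only [Function.comp]
    generalize hTs.localInverse hTd' hn q = r at hq' ⊢
    have h1 : r.1 = q.1 := (Prod.ext_iff.1 hq').1
    have h2 : r.2 + h r = q.2 := (Prod.ext_iff.1 hq').2
    apply hinj q.1 hqO
    refine (hJ' q.1 hqO q.2).trans ?_
    simp only
    rw [← h2, ← h1]
  · intro z; simp [h0]
  · intro t ht z hz
    simp [hsupp t ht.1 z hz]

end Perturbation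

/-! ### Smooth families of submanifolds -/

section Families

variable {E : Type*} [NormedAddCommGroup E] [NormedSpace ℝ E] [FiniteDimensional ℝ E]
  {H : Type*} [TopologicalSpace H] (I : ModelWithCorners ℝ E H)
  {X : Type*} [TopologicalSpace X] [ChartedSpace H X]

/-- The family of the sets `{p | (t, p) ∈ 𝒢}` is, for `t` near `t₀` and in the chart `φ`, the family
of preimages of the fixed set `L` under a smooth family of maps `Θ (t, ·)` that starts at `t₀` with
the identity. -/
structure IsFlatChart (𝒢 : Set (ℝ × X)) (t₀ : ℝ) (φ : OpenPartialHomeomorph X E) (L : Set E)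
    (O : Set ℝ) (Θ : ℝ × E → E) : Prop where
  chart : IsSmoothChart I φ
  isOpen : IsOpen O
  mem : t₀ ∈ O
  smooth : ContDiffOn ℝ ∞ Θ (O ×ˢ φ.target)
  base : ∀ z ∈ φ.target, Θ (t₀, z) = z
  mem_iff : ∀ t ∈ O, ∀ p ∈ φ.source, (t, p) ∈ 𝒢 ↔ Θ (t, φ p) ∈ L

/-- `𝒢 ⊆ ℝ × X` is a smooth family of `k`-dimensional closed submanifolds of `X`, parametrized by
the real line. -/
structure IsSmoothFamily (k : ℕ) (𝒢 : Set (ℝ × X)) : Prop where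
  isClosed : IsClosed 𝒢
  exists_flat : ∀ t p, (t, p) ∈ 𝒢 → ∃ (φ : OpenPartialHomeomorph X E) (L : Submodule ℝ E)
    (O : Set ℝ) (Θ : ℝ × E → E), p ∈ φ.source ∧ Module.finrank ℝ L = k ∧
      IsFlatChart I 𝒢 t φ (L : Set E) O Θ

variable {I} {𝒢 : Set (ℝ × X)} {t₀ : ℝ} {φ : OpenPartialHomeomorph X E} {L : Set E} {O : Set ℝ}
  {Θ : ℝ × E → E}

open Classical in
/-- A function on `E`, transported to `X` by a chart and extended by zero. -/
def extendZero (φ : OpenPartialHomeomorph X E) (f : E → ℝ) (p : X) : ℝ :=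
  if p ∈ φ.source then f (φ p) else 0

theorem contMDiff_extendZero [T2Space X] (hφ : IsSmoothChart I φ) {f : E → ℝ}
    (hf : ContDiff ℝ ∞ f) {C : Set E} (hC : IsCompact C) (hCφ : C ⊆ φ.target)
    (h0 : ∀ z ∉ C, f z = 0) : ContMDiff I 𝓘(ℝ, ℝ) ∞ (extendZero φ f) := by
  have hK : IsClosed (φ.symm '' C) :=
    (hC.image_of_continuousOn (φ.continuousOn_symm.mono hCφ)).isClosed
  intro p
  by_cases hp : p ∈ φ.source
  · have h1 : ContMDiffAt I 𝓘(ℝ, ℝ) ∞ (fun p ↦ f (φ p)) p :=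
      hf.contMDiff.contMDiffAt.comp p (hφ.contMDiffAt hp)
    refine h1.congr_of_eventuallyEq ?_
    filter_upwards [φ.open_source.mem_nhds hp] with q hq using if_pos hq
  · have hp' : p ∉ φ.symm '' C := by
      rintro ⟨z, hz, rfl⟩; exact hp (φ.map_target (hCφ hz))
    refine (contMDiffAt_const (c := (0 : ℝ))).congr_of_eventuallyEq ?_
    filter_upwards [hK.isOpen_compl.mem_nhds hp'] with q hq
    by_cases hs : q ∈ φ.source
    · rw [extendZero, if_pos hs]
      exact h0 _ fun hc ↦ hq ⟨_, hc, φ.left_inv hs⟩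
    · exact if_neg hs

/-- In a flat chart, `z ↦ Θ (t₀ + (t - t₀) χ z, z)`, cut off by `η`, is an isotopy. -/
theorem IsFlatChart.exists_isIsotopyOn (h : IsFlatChart I 𝒢 t₀ φ L O Θ) {z₀ : E}
    (η : ContDiffBump z₀) (hη : Metric.closedBall z₀ η.rOut ⊆ φ.target) {χ : E → ℝ}
    (hχ : ContDiffOn ℝ ∞ χ φ.target) :
    ∃ (O₁ : Set ℝ) (J' : ℝ → E → E),
      IsIsotopyOn 𝓘(ℝ, E) t₀ O₁ (Metric.closedBall z₀ η.rOut)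
        (fun t z ↦ z + η z • (Θ (t₀ + (t - t₀) * χ z, z) - z)) J' ∧
      ∀ t ∈ O₁, ∀ z ∈ Metric.closedBall z₀ η.rOut, t₀ + (t - t₀) * χ z ∈ O := by
  have := FiniteDimensional.proper_real E
  have hC : IsCompact (Metric.closedBall z₀ η.rOut) := isCompact_closedBall _ _
  have hev : ∀ᶠ t in 𝓝 t₀, ∀ z ∈ Metric.closedBall z₀ η.rOut, t₀ + (t - t₀) * χ z ∈ O := by
    refine hC.eventually_forall_of_forall_eventually fun z hz ↦ ?_
    have h1 : ContinuousAt (fun q : ℝ × E ↦ t₀ + (q.1 - t₀) * χ q.2) (t₀, z) := by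
      have : ContinuousAt χ z := (hχ.continuousOn).continuousAt (φ.open_target.mem_nhds (hη hz))
      have h2 : ContinuousAt (fun q : ℝ × E ↦ χ q.2) (t₀, z) :=
        ContinuousAt.comp (f := Prod.snd) (g := χ) this continuousAt_snd
      fun_prop
    refine h1.preimage_mem_nhds (h.isOpen.mem_nhds ?_)
    simpa using h.mem
  obtain ⟨O₂, hO₂, hO₂o, hO₂t⟩ := mem_nhds_iff.1 hev
  suffices ∃ O₁ ⊆ O₂, ∃ J' : ℝ → E → E, IsIsotopyOn 𝓘(ℝ, E) t₀ O₁ (Metric.closedBall z₀ η.rOut)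
      (fun t z ↦ z + η z • (Θ (t₀ + (t - t₀) * χ z, z) - z)) J' by
    obtain ⟨O₁, hO₁, J', hJ⟩ := this
    exact ⟨O₁, J', hJ, fun t ht ↦ hO₂ (hO₁ ht)⟩
  refine exists_isIsotopyOn_add hO₂o hO₂t hC
    (h := fun q : ℝ × E ↦ η q.2 • (Θ (t₀ + (q.1 - t₀) * χ q.2, q.2) - q.2)) ?_ ?_ ?_
  · rintro ⟨t, z⟩ ⟨ht, -⟩
    apply ContDiffAt.contDiffWithinAt
    by_cases hz : z ∈ Metric.closedBall z₀ η.rOut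
    · have hχz : ContDiffAt ℝ ∞ (fun q : ℝ × E ↦ χ q.2) (t, z) :=
        ContDiffAt.comp (f := Prod.snd) (g := χ) (t, z)
          (hχ.contDiffAt (φ.open_target.mem_nhds (hη hz))) contDiffAt_snd
      have hin : ContDiffAt ℝ ∞ (fun q : ℝ × E ↦ (t₀ + (q.1 - t₀) * χ q.2, q.2)) (t, z) :=
        (contDiffAt_const.add ((contDiffAt_fst.sub contDiffAt_const).mul hχz)).prodMk
          contDiffAt_snd
      have hΘ : ContDiffAt ℝ ∞ Θ (t₀ + (t - t₀) * χ z, z) :=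
        h.smooth.contDiffAt ((h.isOpen.prod φ.open_target).mem_nhds ⟨hO₂ ht z hz, hη hz⟩)
      have hcomp := ContDiffAt.comp (f := fun q : ℝ × E ↦ (t₀ + (q.1 - t₀) * χ q.2, q.2))
        (t, z) hΘ hin
      have hηz : ContDiffAt ℝ ∞ (fun q : ℝ × E ↦ η q.2) (t, z) :=
        ContDiffAt.comp (f := Prod.snd) (g := η) (t, z) η.contDiffAt contDiffAt_snd
      exact hηz.smul (hcomp.sub contDiffAt_snd)
    · refine (contDiffAt_const (c := (0 : E))).congr_of_eventuallyEq ?_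
      have h1 : ∀ᶠ q : ℝ × E in 𝓝 (t, z), q.2 ∉ Metric.closedBall z₀ η.rOut :=
        (Metric.isClosed_closedBall.isOpen_compl.preimage continuous_snd).mem_nhds
          (x := (t, z)) hz
      filter_upwards [h1] with q hq
      rw [η.zero_of_le_dist (le_of_lt (not_le.1 hq)), zero_smul]
  · intro z
    by_cases hz : z ∈ Metric.closedBall z₀ η.rOut
    · simp [h.base z (hη hz)]
    · simp [η.zero_of_le_dist (le_of_lt (not_le.1 hz))]
  · intro t _ z hz
    simp [η.zero_of_le_dist (le_of_lt (not_le.1 hz))]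

/-- A subset `s` on which the parameter of a family can be changed by an ambient isotopy: for every
smooth `χ₀` there is a smooth `χ₁` equal to `1` on `s` and wherever `χ₀` is, such that an ambient
isotopy moves the set of the `p` with `(t₀ + (t - t₀) χ₀ p, p) ∈ 𝒢` to the analogous set for `χ₁`.
From `χ₀ = 0` to `χ₁ = 1` this is a move from the member at `t₀` to the member at `t`. -/
def IsMovable (I : ModelWithCorners ℝ E H) (𝒢 : Set (ℝ × X)) (t₀ : ℝ) (s : Set X) : Prop :=
  ∀ χ₀ : X → ℝ, ContMDiff I 𝓘(ℝ, ℝ) ∞ χ₀ → ∃ χ₁ : X → ℝ, ContMDiff I 𝓘(ℝ, ℝ) ∞ χ₁ ∧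
    (∀ p ∈ s, χ₁ p = 1) ∧ (∀ p, χ₀ p = 1 → χ₁ p = 1) ∧
    ∃ (O : Set ℝ) (C : Set X) (J J' : ℝ → X → X), IsIsotopyOn I t₀ O C J J' ∧
      ∀ t ∈ O, ∀ p, (t₀ + (t - t₀) * χ₀ p, p) ∈ 𝒢 ↔
        (t₀ + (t - t₀) * χ₁ (J t p), J t p) ∈ 𝒢

theorem IsMovable.mono {s s' : Set X} (hs : s ⊆ s') (h : IsMovable I 𝒢 t₀ s') :
    IsMovable I 𝒢 t₀ s := fun χ₀ hχ₀ ↦ by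
  obtain ⟨χ₁, h1, h2, h3⟩ := h χ₀ hχ₀
  exact ⟨χ₁, h1, fun p hp ↦ h2 p (hs hp), h3⟩

theorem isMovable_empty : IsMovable I 𝒢 t₀ ∅ := fun χ₀ hχ₀ ↦
  ⟨χ₀, hχ₀, fun _ h ↦ h.elim, fun _ h ↦ h, _, _, _, _, IsIsotopyOn.refl t₀, fun _ _ _ ↦ Iff.rfl⟩

theorem IsMovable.union {s s' : Set X} (h : IsMovable I 𝒢 t₀ s) (h' : IsMovable I 𝒢 t₀ s') :
    IsMovable I 𝒢 t₀ (s ∪ s') := fun χ₀ hχ₀ ↦ by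
  obtain ⟨χ₁, h1, h2, h3, O, C, J, J', hJ, h4⟩ := h χ₀ hχ₀
  obtain ⟨χ₂, h1', h2', h3', O', C', J₁, J₁', hJ', h4'⟩ := h' χ₁ h1
  have hO := hJ.isOpen.inter hJ'.isOpen
  refine ⟨χ₂, h1', ?_, fun p hp ↦ h3' p (h3 p hp), _, _, _, _,
    (hJ.mono hO ⟨hJ.mem, hJ'.mem⟩ Set.inter_subset_left).trans
      (hJ'.mono hO ⟨hJ.mem, hJ'.mem⟩ Set.inter_subset_right), fun t ht p ↦ ?_⟩
  · rintro p (hp | hp)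
    · exact h3' p (h2 p hp)
    · exact h2' p hp
  · rw [h4 t ht.1, h4' t ht.2]

/-- The isotopy is `Ψ₁⁻¹ ∘ Ψ₀`, where `Ψᵢ` straightens the sets belonging to `χᵢ` inside the chart; in
particular it is the identity where `χ₀ = χ₁`. -/
theorem IsFlatChart.exists_isMovable [T2Space X] (h : IsFlatChart I 𝒢 t₀ φ L O Θ) {p₀ : X}
    (hp₀ : p₀ ∈ φ.source) : ∃ s ∈ 𝓝 p₀, IsMovable I 𝒢 t₀ s := by
  have := FiniteDimensional.proper_real E
  obtain ⟨R, hR, hball⟩ := Metric.nhds_basis_closedBall.mem_iff.1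
    (φ.open_target.mem_nhds (φ.map_source hp₀))
  let ρ : ContDiffBump (φ p₀) := ⟨R / 4, R / 2, by positivity, by linarith⟩
  let η : ContDiffBump (φ p₀) := ⟨3 * R / 4, R, by positivity, by linarith⟩
  have hη : Metric.closedBall (φ p₀) η.rOut ⊆ φ.target := hball
  have hhalf : Metric.closedBall (φ p₀) (R / 2) ⊆ φ.target :=
    (Metric.closedBall_subset_closedBall (by linarith)).trans hball
  have hρ0 : ∀ z ∉ Metric.closedBall (φ p₀) (R / 2), ρ z = 0 := fun z hz ↦
    ρ.zero_of_le_dist (le_of_lt (not_le.1 hz))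
  have hη1 : ∀ z ∈ Metric.closedBall (φ p₀) (3 * R / 4), η z = 1 := fun z hz ↦
    η.one_of_mem_closedBall hz
  refine ⟨φ.source ∩ φ ⁻¹' Metric.ball (φ p₀) (R / 4),
    (φ.isOpen_inter_preimage Metric.isOpen_ball).mem_nhds
      ⟨hp₀, Metric.mem_ball_self (by positivity)⟩, fun χ₀ hχ₀ ↦ ?_⟩
  set ρX : X → ℝ := extendZero φ ρ with hρX
  have hρs : ContMDiff I 𝓘(ℝ, ℝ) ∞ ρX :=
    contMDiff_extendZero h.chart ρ.contDiff (isCompact_closedBall (φ p₀) (R / 2)) hhalf hρ0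
  set χ₁ : X → ℝ := fun p ↦ χ₀ p + ρX p * (1 - χ₀ p) with hχ₁
  have hχ₁s : ContMDiff I 𝓘(ℝ, ℝ) ∞ χ₁ := hχ₀.add (hρs.mul (contMDiff_const.sub hχ₀))
  have hread : ∀ χ : X → ℝ, ContMDiff I 𝓘(ℝ, ℝ) ∞ χ →
      ContDiffOn ℝ ∞ (fun z ↦ χ (φ.symm z)) φ.target := fun χ hχ ↦
    contMDiffOn_iff_contDiffOn.1 (hχ.comp_contMDiffOn h.chart.contMDiffOn_symm)
  obtain ⟨O₀, J₀', hJ₀, hO₀⟩ := h.exists_isIsotopyOn η hη (hread χ₀ hχ₀)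
  obtain ⟨O₁, J₁', hJ₁, hO₁⟩ := h.exists_isIsotopyOn η hη (hread χ₁ hχ₁s)
  set Ψ₀ : ℝ → E → E := fun t z ↦ z + η z • (Θ (t₀ + (t - t₀) * χ₀ (φ.symm z), z) - z) with hΨ₀
  set Ψ₁ : ℝ → E → E := fun t z ↦ z + η z • (Θ (t₀ + (t - t₀) * χ₁ (φ.symm z), z) - z) with hΨ₁
  have hO := hJ₀.isOpen.inter hJ₁.isOpen
  have hJ := (hJ₀.mono hO ⟨hJ₀.mem, hJ₁.mem⟩ Set.inter_subset_left).trans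
    (hJ₁.mono hO ⟨hJ₀.mem, hJ₁.mem⟩ Set.inter_subset_right).symm
  rw [Set.union_self] at hJ
  -- points of the support of `ρ` stay where `η = 1`
  have hev : ∀ᶠ t in 𝓝 t₀, ∀ z ∈ Metric.closedBall (φ p₀) (R / 2),
      J₁' t (Ψ₀ t z) ∈ Metric.ball (φ p₀) (3 * R / 4) := by
    refine (isCompact_closedBall _ _).eventually_forall_of_forall_eventually fun z hz ↦ ?_
    have hc := (hJ.smooth.contMDiffAt (x := (t₀, z))
      ((hO.prod isOpen_univ).mem_nhds ⟨hJ.mem, Set.mem_univ _⟩)).continuousAt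
    refine hc.preimage_mem_nhds (Metric.isOpen_ball.mem_nhds ?_)
    have := hJ.map_base z
    simp only at this ⊢
    rw [this]
    exact Metric.closedBall_subset_ball (by linarith) hz
  obtain ⟨O₂, hO₂, hO₂o, hO₂t⟩ := mem_nhds_iff.1 hev
  have hO₃ := hO.inter hO₂o
  have hJX := (hJ.mono hO₃ ⟨hJ.mem, hO₂t⟩ Set.inter_subset_left).transport h.chart hη
  refine ⟨χ₁, hχ₁s, ?_, ?_, _, _, _, _, hJX, ?_⟩
  · intro p hp
    have : ρX p = 1 := by
      rw [hρX, extendZero, if_pos hp.1]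
      exact ρ.one_of_mem_closedBall (Metric.ball_subset_closedBall hp.2)
    simp [hχ₁, this]
  · intro p hp
    simp [hχ₁, hp]
  · rintro t ⟨⟨ht₀, ht₁⟩, ht₂⟩ p
    by_cases hp : p ∈ φ.source
    · rw [transport_of_mem hp]
      set z := φ p with hz
      by_cases hzρ : z ∈ Metric.closedBall (φ p₀) (R / 2)
      · set y := J₁' t (Ψ₀ t z) with hy
        have hyb : y ∈ Metric.ball (φ p₀) (3 * R / 4) := hO₂ ht₂ z hzρ
        have hyR : y ∈ Metric.closedBall (φ p₀) R := Metric.closedBall_subset_closedBall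
          (by linarith) (Metric.ball_subset_closedBall hyb)
        have hzR : z ∈ Metric.closedBall (φ p₀) R := Metric.closedBall_subset_closedBall
          (by linarith) hzρ
        have hyt : y ∈ φ.target := hball hyR
        have h1 : Ψ₁ t y = Ψ₀ t z := hJ₁.right_inv t ht₁ _
        rw [hΨ₁, hΨ₀] at h1
        simp only at h1
        rw [hη1 y (Metric.ball_subset_closedBall hyb), hη1 z
          (Metric.closedBall_subset_closedBall (by linarith) hzρ), one_smul, one_smul,
          add_sub_cancel, add_sub_cancel, hz, φ.left_inv hp] at h1
        rw [h.mem_iff _ (hO₁ t ht₁ y hyR) _ (φ.map_target hyt), φ.right_inv hyt, h1,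
          h.mem_iff _ _ p hp]
        simpa only [hz, φ.left_inv hp] using hO₀ t ht₀ z hzR
      · have hρp : ρX p = 0 := by
          rw [hρX, extendZero, if_pos hp]; exact hρ0 _ hzρ
        have hχp : χ₁ p = χ₀ p := by simp [hχ₁, hρp]
        have h1 : Ψ₀ t z = Ψ₁ t z := by
          simp only [hΨ₀, hΨ₁, hz, φ.left_inv hp, hχp]
        have h2 : J₁' t (Ψ₀ t z) = z := by rw [h1]; exact hJ₁.left_inv t ht₁ z
        rw [h2, hz, φ.left_inv hp, hχp]
    · have hρp : ρX p = 0 := by rw [hρX, extendZero, if_neg hp]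
      have hχp : χ₁ p = χ₀ p := by simp [hχ₁, hρp]
      rw [transport_of_notMem hp, hχp]

theorem IsSmoothFamily.isMovable [T2Space X] [IsManifold I ∞ X] [I.Boundaryless] {k : ℕ}
    (h : IsSmoothFamily I k 𝒢) (t₀ : ℝ) {K : Set X} (hK : IsCompact K) :
    IsMovable I 𝒢 t₀ K := by
  refine hK.induction_on isMovable_empty (fun _ _ hs h ↦ h.mono hs) (fun _ _ h h' ↦ h.union h') ?_
  intro p _
  suffices ∃ s ∈ 𝓝 p, IsMovable I 𝒢 t₀ s by
    obtain ⟨s, hs, hs'⟩ := this; exact ⟨s, mem_nhdsWithin_of_mem_nhds hs, hs'⟩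
  by_cases hp : (t₀, p) ∈ 𝒢
  · obtain ⟨φ, L, O, Θ, hφ, -, hflat⟩ := h.exists_flat t₀ p hp
    exact hflat.exists_isMovable hφ
  · -- away from the family, the empty set serves as `L`
    obtain ⟨O, V, hO, hV, htO, hpV, hsub⟩ := isOpen_prod_iff.1 h.isClosed.isOpen_compl t₀ p hp
    obtain ⟨φ, hφ, hpφ⟩ := exists_isSmoothChart (I := I) p
    have hflat : IsFlatChart I 𝒢 t₀ (φ.restrOpen V hV) ∅ O Prod.snd :=
      { chart := hφ.restrOpen hV
        isOpen := hO
        mem := htO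
        smooth := contDiffOn_snd
        base := fun _ _ ↦ rfl
        mem_iff := fun t ht q hq ↦ by
          have : (t, q) ∉ 𝒢 := hsub ⟨ht, by simp at hq; exact hq.2⟩
          simp [this] }
    exact hflat.exists_isMovable (p₀ := p) (by simp [hpφ, hpV])

end Families

/-! ### Smooth families are continuous paths -/

section Slices

variable {E : Type*} [NormedAddCommGroup E] [NormedSpace ℝ E] [FiniteDimensional ℝ E]
  {H : Type*} [TopologicalSpace H] {I : ModelWithCorners ℝ E H}
  {X : Type*} [TopologicalSpace X] [ChartedSpace H X] [IsManifold I ∞ X] [I.Boundaryless]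
  {k : ℕ} {𝒢 : Set (ℝ × X)}

/-- The member of a smooth family at the parameter `t`. -/
def IsSmoothFamily.slice (h : IsSmoothFamily I k 𝒢) (t : ℝ) : Psi I X k where
  carrier := {p | (t, p) ∈ 𝒢}
  isClosed := h.isClosed.preimage (Continuous.prodMk_right t)
  isSubmanifold := fun p hp ↦ by
    obtain ⟨φ, L, O, Θ, hpφ, hL, hflat⟩ := h.exists_flat t p hp
    refine ⟨chartH I φ, L, hpφ, hflat.chart.isSliceChart fun q hq ↦ ?_, hL⟩
    have h1 := hflat.mem_iff t hflat.mem q hq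
    rw [hflat.base _ (φ.map_source hq)] at h1
    exact h1

/-- An isotopy with compact support is close to the identity in the Whitney topology for
parameters close to `t₀`. -/
theorem IsIsotopyOn.eventually_mem_nhd [T2Space X] {t₀ : ℝ} {O : Set ℝ} {C : Set X}
    {J J' : ℝ → X → X} (h : IsIsotopyOn I t₀ O C J J') {G : Set X} (w : WhitneyDatum I G) :
    ∀ᶠ t in 𝓝 t₀, J t ∈ w.nhd := by
  have hfin : {a | (w.compact a ∩ C).Nonempty}.Finite :=
    w.locallyFinite.finite_nonempty_inter_compact h.isCompact
  have hO : ∀ᶠ t in 𝓝 t₀, t ∈ O := h.isOpen.mem_nhds h.mem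
  have hsmooth : ∀ t ∈ O, ∀ p, ContMDiffAt (𝓘(ℝ, ℝ).prod I) I ∞ (fun q : ℝ × X ↦ J q.1 q.2)
      (t, p) := fun t ht p ↦
    h.smooth.contMDiffAt ((h.isOpen.prod isOpen_univ).mem_nhds ⟨ht, Set.mem_univ _⟩)
  have hsrc : ∀ a, ∀ᶠ t in 𝓝 t₀, ∀ p ∈ w.compact a, J t p ∈ (w.chart a).source := by
    intro a
    refine (w.isCompact a).eventually_forall_of_forall_eventually fun p hp ↦ ?_
    refine (hsmooth t₀ h.mem p).continuousAt.preimage_mem_nhds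
      ((w.chart a).open_source.mem_nhds ?_)
    simpa only [h.map_base] using (w.compact_subset a hp).2
  have hder : ∀ a, ∀ m ≤ w.order, ∀ᶠ t in 𝓝 t₀, ∀ y : w.plane a,
      (y : E) ∈ (w.chart a).extend I '' w.compact a →
      ‖iteratedFDeriv ℝ m (fun z : w.plane a ↦
        (w.chart a).extend I (J t (((w.chart a).extend I).symm z)) - (z : E)) y‖ < w.tol a := by
    intro a m _
    set e := chartE I (w.chart a) with he
    have hes : IsSmoothChart I e := isSmoothChart_chartE (w.isSliceChart a).1
    have hKs : w.compact a ⊆ e.source := fun p hp ↦ (w.compact_subset a hp).2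
    have hKc : IsCompact (e '' w.compact a) :=
      (w.isCompact a).image_of_continuousOn (e.continuousOn.mono hKs)
    have hK : IsCompact {y : w.plane a | (y : E) ∈ e '' w.compact a} :=
      ((w.plane a).closed_of_finiteDimensional.isClosedEmbedding_subtypeVal).isCompact_preimage hKc
    -- the domain on which the isotopy can be read in the chart
    set A : Set (ℝ × X) := (O ×ˢ Set.univ) ∩ (fun q : ℝ × X ↦ J q.1 q.2) ⁻¹' e.source with hA
    have hAo : IsOpen A :=
      h.smooth.continuousOn.isOpen_inter_preimage (h.isOpen.prod isOpen_univ) e.open_source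
    set B : Set (ℝ × E) := (Set.univ ×ˢ e.target) ∩ (fun q : ℝ × E ↦ (q.1, e.symm q.2)) ⁻¹' A
      with hB
    have hBo : IsOpen B := by
      refine ContinuousOn.isOpen_inter_preimage ?_ (isOpen_univ.prod e.open_target) hAo
      exact continuousOn_fst.prodMk (e.continuousOn_symm.comp continuousOn_snd fun q hq ↦ hq.2)
    set Ω : Set (ℝ × w.plane a) := (fun q : ℝ × w.plane a ↦ (q.1, (q.2 : E))) ⁻¹' B with hΩ
    have hΩo : IsOpen Ω := hBo.preimage (by fun_prop)
    have hF : ContDiffOn ℝ ∞ (fun q : ℝ × w.plane a ↦ e (J q.1 (e.symm q.2)) - (q.2 : E)) Ω := by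
      have h1 : ContDiffOn ℝ ∞ (fun q : ℝ × E ↦ e (J q.1 (e.symm q.2))) B := by
        suffices h' : ContMDiffOn (𝓘(ℝ, ℝ).prod 𝓘(ℝ, E)) 𝓘(ℝ, E) ∞
            (fun q : ℝ × E ↦ e (J q.1 (e.symm q.2))) B by
          rwa [← modelWithCornersSelf_prod, chartedSpaceSelf_prod, contMDiffOn_iff_contDiffOn]
            at h'
        rintro ⟨t, z⟩ ⟨⟨-, hz⟩, ⟨⟨ht, -⟩, hJz⟩⟩
        apply ContMDiffAt.contMDiffWithinAt
        have h2 : ContMDiffAt (𝓘(ℝ, ℝ).prod 𝓘(ℝ, E)) (𝓘(ℝ, ℝ).prod I) ∞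
            (fun q : ℝ × E ↦ (q.1, e.symm q.2)) (t, z) :=
          contMDiffAt_fst.prodMk ((hes.contMDiffAt_symm hz).comp (t, z) contMDiffAt_snd)
        have h3 := ContMDiffAt.comp (f := fun q : ℝ × E ↦ (q.1, e.symm q.2)) (t, z)
          (hsmooth t ht (e.symm z)) h2
        exact ContMDiffAt.comp (t, z) (hes.contMDiffAt hJz) h3
      have h2 : ContDiff ℝ ∞ (fun q : ℝ × w.plane a ↦ (q.1, (q.2 : E))) :=
        contDiff_fst.prodMk ((w.plane a).subtypeL.contDiff.comp contDiff_snd)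
      exact (h1.comp h2.contDiffOn fun q hq ↦ hq).sub
        ((w.plane a).subtypeL.contDiff.comp contDiff_snd).contDiffOn
    have := eventually_norm_iteratedFDeriv_slice_lt hΩo hF (t₀ := t₀) ?_ hK ?_ m (w.tol_pos a)
    · exact this
    · rintro z ⟨⟨-, hz⟩, -⟩
      have hz : (z : E) ∈ e.target := hz
      simp only [h.map_base, e.right_inv hz, sub_self]
    · rintro z ⟨p, hp, hpz⟩
      have h1 : e.symm z = p := by rw [← hpz, e.left_inv (hKs hp)]
      have h2 : (z : E) ∈ e.target := by rw [← hpz]; exact e.map_source (hKs hp)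
      refine ⟨⟨Set.mem_univ _, h2⟩, ⟨h.mem, Set.mem_univ _⟩, ?_⟩
      simp only [Set.mem_preimage, h.map_base, h1, hKs hp]
  have hall : ∀ᶠ t in 𝓝 t₀, ∀ a ∈ {a | (w.compact a ∩ C).Nonempty},
      (∀ p ∈ w.compact a, J t p ∈ (w.chart a).source) ∧ ∀ m ∈ Set.Iic w.order, ∀ y : w.plane a,
      (y : E) ∈ (w.chart a).extend I '' w.compact a →
      ‖iteratedFDeriv ℝ m (fun z : w.plane a ↦
        (w.chart a).extend I (J t (((w.chart a).extend I).symm z)) - (z : E)) y‖ < w.tol a :=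
    (Filter.eventually_all_finite hfin).2 fun a _ ↦ (hsrc a).and
      ((Filter.eventually_all_finite (Set.finite_Iic _)).2 fun m hm ↦ hder a m hm)
  filter_upwards [hall, hO] with t ht htO a
  by_cases ha : (w.compact a ∩ C).Nonempty
  · exact ⟨(ht a ha).1, fun y hy m hm ↦ (ht a ha).2 m hm y hy⟩
  · -- the isotopy is constant near the members of the family that do not meet its support
    have hnot : ∀ p ∈ w.compact a, p ∉ C := fun p hp hc ↦ ha ⟨p, hp, hc⟩
    refine ⟨fun p hp ↦ ?_, fun y hy m _ ↦ ?_⟩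
    · rw [h.map_of_notMem t htO p (hnot p hp)]; exact (w.compact_subset a hp).2
    · set e := chartE I (w.chart a) with he
      obtain ⟨p, hp, hpy⟩ := hy
      have hpy : e p = y := hpy
      have hps : p ∈ e.source := (w.compact_subset a hp).2
      have hyt : (y : E) ∈ e.target := hpy ▸ e.map_source hps
      have h1 : ∀ᶠ z : E in 𝓝 (y : E), z ∈ e.target ∧ e.symm z ∉ C := by
        refine Filter.Eventually.and (e.open_target.mem_nhds hyt) ?_
        refine (e.continuousAt_symm hyt).preimage_mem_nhds
          (h.isCompact.isClosed.isOpen_compl.mem_nhds ?_)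
        rw [← hpy, e.left_inv hps]; exact hnot p hp
      have h2 : (fun z : w.plane a ↦ (w.chart a).extend I (J t (((w.chart a).extend I).symm z))
          - (z : E)) =ᶠ[𝓝 y] fun _ ↦ 0 := by
        have h3 := continuous_subtype_val.continuousAt (x := y) |>.eventually h1
        filter_upwards [h3] with z hz
        change e (J t (e.symm z)) - (z : E) = 0
        rw [h.map_of_notMem t htO _ hz.2, e.right_inv hz.1, sub_self]
      rw [(h2.iteratedFDeriv ℝ m).eq_of_nhds]
      simpa using w.tol_pos a

/-- By `IsSmoothFamily.isMovable`, the members near a given one agree on a compact set with its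
images under an ambient isotopy, which is close to the identity in the Whitney topology. -/
theorem IsSmoothFamily.continuous_slice [T2Space X] (h : IsSmoothFamily I k 𝒢) :
    Continuous h.slice := by
  rw [continuous_def]
  intro U hU
  rw [isOpen_iff_mem_nhds]
  intro t₀ ht₀
  obtain ⟨K, w, hK, hsub⟩ := hU (h.slice t₀) ht₀
  obtain ⟨χ, -, hχ, -, O, C, J, J', hJ, hmove⟩ :=
    h.isMovable t₀ hK (fun _ ↦ 0) contMDiff_const
  filter_upwards [hJ.isOpen.mem_nhds hJ.mem, hJ.eventually_mem_nhd w] with t ht htw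
  apply hsub
  have hsm : ContMDiff I I ∞ (J t) := fun p ↦
    ContMDiffAt.comp (f := fun p ↦ (t, p)) p
      (hJ.smooth.contMDiffAt ((hJ.isOpen.prod isOpen_univ).mem_nhds ⟨ht, Set.mem_univ _⟩))
      (contMDiffAt_const.prodMk contMDiffAt_id)
  have hsm' : ContMDiff I I ∞ (J' t) := fun p ↦
    ContMDiffAt.comp (f := fun p ↦ (t, p)) p
      (hJ.smooth_symm.contMDiffAt ((hJ.isOpen.prod isOpen_univ).mem_nhds ⟨ht, Set.mem_univ _⟩))
      (contMDiffAt_const.prodMk contMDiffAt_id)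
  refine ⟨J t, ⟨hsm.contMDiffOn, J' t, hsm'.contMDiffOn, fun p _ ↦ hJ.left_inv t ht p⟩, htw, ?_⟩
  have hm : ∀ p, (t₀, p) ∈ 𝒢 ↔ (t₀ + (t - t₀) * χ (J t p), J t p) ∈ 𝒢 := fun p ↦ by
    simpa using hmove t ht p
  ext p
  refine and_congr_left fun hp ↦ ?_
  have h1 : t₀ + (t - t₀) * χ p = t := by rw [hχ p hp]; ring
  constructor
  · intro hpt
    refine ⟨J' t p, ?_, hJ.right_inv t ht p⟩
    refine (hm _).2 ?_
    rw [hJ.right_inv t ht, h1]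
    exact hpt
  · rintro ⟨q, hq, rfl⟩
    have := (hm q).1 hq
    rwa [h1] at this

/-- The path in `Ψ_k(X)` given by a smooth family. -/
def IsSmoothFamily.path [T2Space X] (h : IsSmoothFamily I k 𝒢) : C(unitInterval, Psi I X k) :=
  ⟨fun t ↦ h.slice t, h.continuous_slice.comp continuous_subtype_val⟩

end Slices

/-! ### Preimages under transverse maps -/

section Transverse

variable {E : Type*} [NormedAddCommGroup E] [NormedSpace ℝ E] [FiniteDimensional ℝ E]
  {H : Type*} [TopologicalSpace H] {I : ModelWithCorners ℝ E H}
  {X : Type*} [TopologicalSpace X] [ChartedSpace H X]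

variable (I) in
/-- The differential at `p` of a map from the manifold `X` to a vector space, as a linear map on the
model space `E`, which is the type of tangent vectors in Mathlib. -/
def dAt {F : Type*} [NormedAddCommGroup F] [NormedSpace ℝ F] (g : X → F) (p : X) : E →L[ℝ] F :=
  mfderiv I 𝓘(ℝ, F) g p

theorem IsSmoothChart.dAt_eq_fderiv_comp {F : Type*} [NormedAddCommGroup F] [NormedSpace ℝ F]
    {φ : OpenPartialHomeomorph X E} (hφ : IsSmoothChart I φ) {p : X} (hp : p ∈ φ.source)
    {g : X → F} (hg : DifferentiableAt ℝ (fun y ↦ g (φ.symm y)) (φ p)) :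
    dAt I g p = (fderiv ℝ (fun y ↦ g (φ.symm y)) (φ p)).comp (dAt I φ p) := by
  have h2 : g =ᶠ[𝓝 p] (fun y ↦ g (φ.symm y)) ∘ φ := by
    filter_upwards [φ.open_source.mem_nhds hp] with q hq
    simp [φ.left_inv hq]
  rw [dAt, h2.mfderiv_eq, mfderiv_comp (I' := 𝓘(ℝ, E)) p hg.mdifferentiableAt
    ((hφ.contMDiffAt hp).mdifferentiableAt (by simp)), mfderiv_eq_fderiv]
  rfl

/-- The inverse function theorem, for a smooth map on an open set. -/
theorem exists_openPartialHomeomorph_of_hasFDerivAt {f : E → E} {U : Set E} (hU : IsOpen U)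
    (hf : ContDiffOn ℝ ∞ f U) {y₀ : E} (hy₀ : y₀ ∈ U) {f' : E ≃L[ℝ] E}
    (hd : HasFDerivAt f (f' : E →L[ℝ] E) y₀) :
    ∃ ψ : OpenPartialHomeomorph E E, (ψ : E → E) = f ∧ y₀ ∈ ψ.source ∧ ψ.source ⊆ U ∧
      ContDiffOn ℝ ∞ ψ.symm ψ.target := by
  have hn : (∞ : WithTop ℕ∞) ≠ 0 := by simp
  have hfy := hf.contDiffAt (hU.mem_nhds hy₀)
  set ψ₀ := hfy.toOpenPartialHomeomorph f hd hn with hψ₀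
  have hcont : ContinuousOn (fderiv ℝ f) U := hf.continuousOn_fderiv_of_isOpen hU (by simp)
  have hV := hcont.isOpen_inter_preimage hU
    (ContinuousLinearEquiv.isOpen (𝕜 := ℝ) (E := E) (F := E))
  set V := U ∩ fderiv ℝ f ⁻¹' Set.range ((↑) : (E ≃L[ℝ] E) → E →L[ℝ] E) with hVdef
  refine ⟨ψ₀.restrOpen V hV, rfl, ?_, ?_, ?_⟩
  · rw [OpenPartialHomeomorph.restrOpen_source]
    exact ⟨hfy.mem_toOpenPartialHomeomorph_source hd hn, hy₀, f', hd.fderiv.symm⟩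
  · rw [OpenPartialHomeomorph.restrOpen_source]
    exact fun y hy ↦ hy.2.1
  · intro z hz
    apply ContDiffAt.contDiffWithinAt
    have hmem := (ψ₀.restrOpen V hV).map_target hz
    rw [OpenPartialHomeomorph.restrOpen_source] at hmem
    obtain ⟨-, hyU, g', hg'⟩ := hmem
    have hfz := hf.contDiffAt (hU.mem_nhds hyU)
    refine (ψ₀.restrOpen V hV).contDiffAt_symm hz (f₀' := g') ?_ hfz
    rw [hg']
    exact (hfz.differentiableAt hn).hasFDerivAt

/-- The preimages of a submanifold under a smooth family of maps transverse to it are a smooth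
family of submanifolds. If `g = 0` are local equations of the submanifold, pulled back to a chart,
`D` is the derivative of `g` at the base point and `S` is a right inverse of `D`, then
`y ↦ S (g (t, y)) + (y - S (D y))` straightens the member at `t` to the kernel of `D`. -/
theorem isSmoothFamily_preimage [IsManifold I ∞ X] [I.Boundaryless] {k : ℕ} {G : Psi I X k}
    {f : ℝ × X → X} (hf : ContMDiff (𝓘(ℝ, ℝ).prod I) I ∞ f)
    (htrans : ∀ t p, f (t, p) ∈ G.carrier → ∃ (e : OpenPartialHomeomorph X H) (L : Submodule ℝ E),
      f (t, p) ∈ e.source ∧ IsSliceChart I G.carrier e L ∧ Module.finrank ℝ L = k ∧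
      ∀ y : E, ∃ ξ : E, dAt I (fun p ↦ e.extend I (f (t, p))) p ξ - y ∈ L) :
    IsSmoothFamily I k (f ⁻¹' G.carrier) := by
  refine ⟨G.isClosed.preimage hf.continuous, fun t p hp ↦ ?_⟩
  obtain ⟨e', L, hes, hsl, hL, hsurj⟩ := htrans t p hp
  set e := chartE I e' with he
  have hesm : IsSmoothChart I e := isSmoothChart_chartE hsl.1
  have hmem : ∀ x ∈ e.source, x ∈ G.carrier ↔ e x ∈ L := hsl.2
  obtain ⟨φ₀, hφ₀, hpφ₀⟩ := exists_isSmoothChart (I := I) p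
  -- a box on which everything can be read in the charts
  set Ω : Set (ℝ × E) := (Set.univ ×ˢ φ₀.target) ∩
    (fun q : ℝ × E ↦ f (q.1, φ₀.symm q.2)) ⁻¹' e.source with hΩ
  have hΩo : IsOpen Ω := by
    refine ContinuousOn.isOpen_inter_preimage ?_ (isOpen_univ.prod φ₀.open_target) e.open_source
    exact hf.continuous.comp_continuousOn (continuousOn_fst.prodMk
      (φ₀.continuousOn_symm.comp continuousOn_snd fun q hq ↦ hq.2))
  obtain ⟨O, U, hO, hU, htO, hyU, hOU⟩ := isOpen_prod_iff.1 hΩo t (φ₀ p)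
    ⟨⟨Set.mem_univ _, φ₀.map_source hpφ₀⟩, by rw [Set.mem_preimage, φ₀.left_inv hpφ₀]; exact hes⟩
  have hUt : U ⊆ φ₀.target := fun y hy ↦ (hOU (Set.mk_mem_prod htO hy)).1.2
  have hr : ContDiffOn ℝ ∞ (fun q : ℝ × E ↦ e (f (q.1, φ₀.symm q.2))) (O ×ˢ U) := by
    suffices h' : ContMDiffOn (𝓘(ℝ, ℝ).prod 𝓘(ℝ, E)) 𝓘(ℝ, E) ∞
        (fun q : ℝ × E ↦ e (f (q.1, φ₀.symm q.2))) (O ×ˢ U) by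
      rwa [← modelWithCornersSelf_prod, chartedSpaceSelf_prod, contMDiffOn_iff_contDiffOn] at h'
    rintro ⟨s, y⟩ hq
    apply ContMDiffAt.contMDiffWithinAt
    have h2 : ContMDiffAt (𝓘(ℝ, ℝ).prod 𝓘(ℝ, E)) (𝓘(ℝ, ℝ).prod I) ∞
        (fun q : ℝ × E ↦ (q.1, φ₀.symm q.2)) (s, y) :=
      contMDiffAt_fst.prodMk ((hφ₀.contMDiffAt_symm (hUt hq.2)).comp (s, y) contMDiffAt_snd)
    have h3 := ContMDiffAt.comp (f := fun q : ℝ × E ↦ (q.1, φ₀.symm q.2)) (s, y)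
      (hf.contMDiffAt (x := (s, φ₀.symm y))) h2
    exact ContMDiffAt.comp (s, y) (hesm.contMDiffAt (hOU hq).2) h3
  obtain ⟨C, hC⟩ := L.exists_isCompl
  let π : E →L[ℝ] C := (C.projectionOnto L hC.symm).toContinuousLinearMap
  have hπ : ∀ y, π y = 0 ↔ y ∈ L := fun y ↦ Submodule.projectionOnto_apply_eq_zero_iff hC.symm
  have hπC : ∀ c : C, π c = c := fun c ↦ Submodule.projectionOnto_apply_left hC.symm c
  set g : ℝ × E → C := fun q ↦ π (e (f (q.1, φ₀.symm q.2))) with hg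
  have hgs : ContDiffOn ℝ ∞ g (O ×ˢ U) := π.contDiff.comp_contDiffOn hr
  have hrt : DifferentiableAt ℝ (fun y ↦ e (f (t, φ₀.symm y))) (φ₀ p) :=
    ((hr.comp (f := fun y ↦ (t, y)) (s := U) (by fun_prop) fun y hy ↦ ⟨htO, hy⟩).contDiffAt
      (hU.mem_nhds hyU)).differentiableAt (by simp)
  set D : E →L[ℝ] C := π.comp (fderiv ℝ (fun y ↦ e (f (t, φ₀.symm y))) (φ₀ p)) with hD
  have hgD : HasFDerivAt (fun y ↦ g (t, y)) D (φ₀ p) :=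
    π.hasFDerivAt.comp (φ₀ p) hrt.hasFDerivAt
  have hDsurj : Function.Surjective D := by
    intro c
    obtain ⟨ξ, hξ⟩ := hsurj c
    refine ⟨dAt I φ₀ p ξ, ?_⟩
    have h1 := hφ₀.dAt_eq_fderiv_comp hpφ₀ (g := fun p ↦ e (f (t, p))) hrt
    have h3 : dAt I (fun p ↦ e (f (t, p))) p ξ - (c : E) ∈ L := hξ
    rw [h1, ← hπ, map_sub, hπC, sub_eq_zero] at h3
    exact h3
  obtain ⟨S', hS'⟩ := LinearMap.exists_rightInverse_of_surjective (D : E →ₗ[ℝ] C)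
    (LinearMap.range_eq_top.2 hDsurj)
  let S : C →L[ℝ] E := S'.toContinuousLinearMap
  have hS : ∀ c, D (S c) = c := fun c ↦ LinearMap.congr_fun hS' c
  set Ψ : ℝ × E → E := fun q ↦ S (g q) + (q.2 - S (D q.2)) with hΨ
  have hΨs : ContDiffOn ℝ ∞ Ψ (O ×ˢ U) :=
    (S.contDiff.comp_contDiffOn hgs).add (contDiff_snd.sub
      ((S.comp D).contDiff.comp contDiff_snd)).contDiffOn
  have hΨker : ∀ q, D (Ψ q) = g q := fun q ↦ by
    simp only [hΨ, map_add, map_sub, hS, sub_self, add_zero]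
  have hΨt : ContDiffOn ℝ ∞ (fun y ↦ Ψ (t, y)) U :=
    hΨs.comp (f := fun y ↦ (t, y)) (s := U) (by fun_prop) fun y hy ↦ ⟨htO, hy⟩
  have hΨd : HasFDerivAt (fun y ↦ Ψ (t, y))
      ((ContinuousLinearEquiv.refl ℝ E : E ≃L[ℝ] E) : E →L[ℝ] E) (φ₀ p) := by
    have h1 := (S.hasFDerivAt.comp (φ₀ p) hgD).add
      ((hasFDerivAt_id (𝕜 := ℝ) (φ₀ p)).sub ((S.comp D).hasFDerivAt))
    refine h1.congr_fderiv ?_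
    ext v; simp
  obtain ⟨ψ, hψ, hyψ, hψU, hψs⟩ := exists_openPartialHomeomorph_of_hasFDerivAt hU hΨt hyU hΨd
  refine ⟨φ₀.trans ψ, LinearMap.ker (D : E →ₗ[ℝ] C), O, fun q ↦ Ψ (q.1, ψ.symm q.2), ?_, ?_, ?_⟩
  · rw [OpenPartialHomeomorph.trans_source]; exact ⟨hpφ₀, hyψ⟩
  · have h1 := LinearMap.finrank_range_add_finrank_ker (D : E →ₗ[ℝ] C)
    rw [LinearMap.range_eq_top.2 hDsurj, finrank_top] at h1
    have h2 := Submodule.finrank_add_eq_of_isCompl hC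
    omega
  · have htar : ∀ z ∈ (φ₀.trans ψ).target, z ∈ ψ.target := fun z hz ↦ by
      rw [OpenPartialHomeomorph.trans_target] at hz; exact hz.1
    refine ⟨hφ₀.trans ?_ hψs, hO, htO, ?_, ?_, ?_⟩
    · rw [hψ]; exact hΨt.mono hψU
    · refine hΨs.comp (contDiffOn_fst.prodMk ((hψs.mono htar).comp contDiffOn_snd fun q hq ↦ hq.2))
        fun q hq ↦ ⟨hq.1, hψU (ψ.map_target (htar _ hq.2))⟩
    · intro z hz
      have := ψ.right_inv (htar z hz)
      rwa [hψ] at this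
    · intro s hs q hq
      rw [OpenPartialHomeomorph.trans_source] at hq
      have hqU : φ₀ q ∈ U := hψU hq.2
      have h1 : f (s, q) ∈ e.source := by
        have := (hOU (Set.mk_mem_prod hs hqU)).2
        simpa only [Set.mem_preimage, φ₀.left_inv hq.1] using this
      simp only [OpenPartialHomeomorph.coe_trans, Function.comp, ψ.left_inv hq.2, SetLike.mem_coe,
        LinearMap.mem_ker, ContinuousLinearMap.coe_coe, hΨker]
      rw [Set.mem_preimage, hmem _ h1, ← hπ]
      simp only [hg, φ₀.left_inv hq.1]

end Transverse

/-! ### Pulling back along a diffeomorphism -/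

section Comap

variable {E : Type*} [NormedAddCommGroup E] [NormedSpace ℝ E] [FiniteDimensional ℝ E]
  {H : Type*} [TopologicalSpace H] {I : ModelWithCorners ℝ E H}
  {X : Type*} [TopologicalSpace X] [ChartedSpace H X] {k : ℕ}

theorem IsSmoothChart.dAt_surjective {φ : OpenPartialHomeomorph X E} (hφ : IsSmoothChart I φ)
    {p : X} (hp : p ∈ φ.source) : Function.Surjective (dAt I φ p) := by
  intro y
  have hs : MDifferentiableAt 𝓘(ℝ, E) I φ.symm (φ p) :=
    (hφ.contMDiffAt_symm (φ.map_source hp)).mdifferentiableAt (by simp)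
  have hd : MDifferentiableAt I 𝓘(ℝ, E) φ (φ.symm (φ p)) := by
    rw [φ.left_inv hp]; exact (hφ.contMDiffAt hp).mdifferentiableAt (by simp)
  have h1 : mfderiv 𝓘(ℝ, E) 𝓘(ℝ, E) (φ ∘ φ.symm) (φ p) = ContinuousLinearMap.id ℝ E := by
    have : φ ∘ φ.symm =ᶠ[𝓝 (φ p)] id := by
      filter_upwards [φ.open_target.mem_nhds (φ.map_source hp)] with z hz using φ.right_inv hz
    rw [this.mfderiv_eq]; exact mfderiv_id
  rw [mfderiv_comp (I' := I) (φ p) hd hs] at h1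
  refine ⟨mfderiv 𝓘(ℝ, E) I φ.symm (φ p) y, ?_⟩
  have h2 := DFunLike.congr_fun h1 y
  have h3 : dAt I φ (φ.symm (φ p)) (mfderiv 𝓘(ℝ, E) I φ.symm (φ p) y) = y := h2
  rwa [φ.left_inv hp] at h3

variable [IsManifold I ∞ X] [I.Boundaryless]

theorem isSmoothFamily_const (G : Psi I X k) : IsSmoothFamily I k (Prod.snd ⁻¹' G.carrier) := by
  refine isSmoothFamily_preimage contMDiff_snd fun t p hp ↦ ?_
  obtain ⟨e, L, hpe, he, hL⟩ := G.isSubmanifold p hp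
  refine ⟨e, L, hpe, he, hL, fun y ↦ ?_⟩
  obtain ⟨ξ, hξ⟩ := (isSmoothChart_chartE he.1).dAt_surjective (p := p) hpe y
  have hξ : dAt I (fun p ↦ e.extend I p) p ξ = y := hξ
  exact ⟨ξ, by simp only [hξ, sub_self, L.zero_mem]⟩

theorem IsSmoothFamily.comap {𝒢 : Set (ℝ × X)} (h : IsSmoothFamily I k 𝒢) (Φ : X ≃ₘ⟮I, I⟯ X) :
    IsSmoothFamily I k ((fun q : ℝ × X ↦ (q.1, Φ q.2)) ⁻¹' 𝒢) := by
  refine ⟨h.isClosed.preimage (continuous_fst.prodMk (Φ.continuous.comp continuous_snd)),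
    fun t p hp ↦ ?_⟩
  obtain ⟨φ, L, O, Θ, hpφ, hL, hflat⟩ := h.exists_flat t _ hp
  have hsrc : ∀ q, q ∈ (Φ.toHomeomorph.transOpenPartialHomeomorph φ).source ↔ Φ q ∈ φ.source :=
    fun q ↦ by simp [Homeomorph.transOpenPartialHomeomorph_source]
  refine ⟨Φ.toHomeomorph.transOpenPartialHomeomorph φ, L, O, Θ, (hsrc p).2 hpφ, hL,
    ⟨?_, ?_⟩, hflat.isOpen, hflat.mem, hflat.smooth, hflat.base, fun s hs q hq ↦ ?_⟩
  · exact hflat.chart.contMDiffOn.comp Φ.contMDiff.contMDiffOn fun q hq ↦ (hsrc q).1 hq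
  · exact Φ.symm.contMDiff.comp_contMDiffOn hflat.chart.contMDiffOn_symm
  · exact hflat.mem_iff s hs (Φ q) ((hsrc q).1 hq)

/-- The preimage of a closed submanifold under a diffeomorphism. -/
def Psi.comap (G : Psi I X k) (Φ : X ≃ₘ⟮I, I⟯ X) : Psi I X k :=
  ((isSmoothFamily_const G).comap Φ).slice 0

end Comap

/-! ### A generic linear form -/

section Generic

variable {V M : Type*} [NormedAddCommGroup V] [NormedSpace ℝ V] [FiniteDimensional ℝ V]
  [NormedAddCommGroup M] [NormedSpace ℝ M] [FiniteDimensional ℝ M]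

theorem finrank_continuousLinearMap_real :
    Module.finrank ℝ (M →L[ℝ] ℝ) = Module.finrank ℝ M := by
  rw [← (LinearMap.toContinuousLinearMap (𝕜 := ℝ) (E := M) (F' := ℝ)).finrank_eq,
    Module.finrank_linearMap, Module.finrank_self, mul_one]

/-- The pairs `(α, c)` for which `α ∘ ψ - h` has a critical point `y` in `s` with
`α (ψ y) - τ y = c`, and `ψ` is an immersion at `y`. -/
def criticalPairs (ψ : V → M) (h τ : V → ℝ) (s : Set V) : Set ((M →L[ℝ] ℝ) × ℝ) :=
  {a | ∃ y ∈ s, Function.Injective (fderiv ℝ ψ y) ∧ a.1.comp (fderiv ℝ ψ y) = fderiv ℝ h y ∧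
    a.1 (ψ y) - τ y = a.2}

variable {ψ : V → M} {h τ : V → ℝ} {O : Set V}

/-- Near `y₀` the equation `α ∘ Dψ = Dh` for `α` has as many unknowns as `M` has dimensions, and it
determines the part of `α` that factors through a fixed left inverse `π` of `Dψ (y₀)`. Hence the
pair `(α, c)` depends smoothly on `y` and on the component of `α` in a complement of these. -/
theorem exists_dimH_criticalPairs_le (hO : IsOpen O) (hψ : ContDiffOn ℝ ∞ ψ O)
    (hh : ContDiffOn ℝ ∞ h O) (hτ : ContDiffOn ℝ ∞ τ O) {y₀ : V} (hy₀ : y₀ ∈ O)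
    (hinj : Function.Injective (fderiv ℝ ψ y₀)) :
    ∃ N ∈ 𝓝 y₀, dimH (criticalPairs ψ h τ N) ≤ Module.finrank ℝ M := by
  obtain ⟨π', hπ'⟩ := LinearMap.exists_leftInverse_of_injective (fderiv ℝ ψ y₀ : V →ₗ[ℝ] M)
    (LinearMap.ker_eq_bot.2 hinj)
  let π : M →L[ℝ] V := π'.toContinuousLinearMap
  have hπ : π.comp (fderiv ℝ ψ y₀) = ContinuousLinearMap.id ℝ V := by
    ext v; exact LinearMap.congr_fun hπ' v
  have hDψ : ContDiffOn ℝ ∞ (fderiv ℝ ψ) O := hψ.fderiv_of_isOpen hO (by simp)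
  have hDh : ContDiffOn ℝ ∞ (fderiv ℝ h) O := hh.fderiv_of_isOpen hO (by simp)
  set A : V → V →L[ℝ] V := fun y ↦ π.comp (fderiv ℝ ψ y) with hA
  have hAs : ContDiffOn ℝ ∞ A O := contDiffOn_const.clm_comp hDψ
  have hU := hAs.continuousOn.isOpen_inter_preimage hO
    (ContinuousLinearEquiv.isOpen (𝕜 := ℝ) (E := V) (F := V))
  have hyU : y₀ ∈ O ∩ A ⁻¹' Set.range ((↑) : (V ≃L[ℝ] V) → V →L[ℝ] V) :=
    ⟨hy₀, ContinuousLinearEquiv.refl ℝ V, by rw [hA]; exact hπ.symm⟩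
  obtain ⟨r, hr, hball⟩ := Metric.isOpen_iff.1 hU y₀ hyU
  have hinvs : ContDiffOn ℝ ∞ (fun y ↦ ContinuousLinearMap.inverse (A y)) (Metric.ball y₀ r) := by
    intro y hy
    obtain ⟨hyO, e, he⟩ := hball hy
    have h1 : ContDiffAt ℝ ∞ ContinuousLinearMap.inverse (A y) := he ▸ contDiffAt_map_inverse e
    exact (h1.comp y (hAs.contDiffAt (hO.mem_nhds hyO))).contDiffWithinAt
  have hinv : ∀ y ∈ Metric.ball y₀ r,
      (A y).comp (ContinuousLinearMap.inverse (A y)) = ContinuousLinearMap.id ℝ V := by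
    intro y hy
    obtain ⟨-, e, he⟩ := hball hy
    rw [← he, ContinuousLinearMap.inverse_equiv]
    ext v; simp
  -- the forms that factor through `π`, and a complement
  let R : (V →L[ℝ] ℝ) →ₗ[ℝ] (M →L[ℝ] ℝ) :=
    { toFun := fun ξ ↦ ξ.comp π
      map_add' := fun _ _ ↦ rfl
      map_smul' := fun _ _ ↦ rfl }
  have hRinj : Function.Injective R := by
    intro ξ ξ' hξ
    have h1 : ξ.comp π = ξ'.comp π := hξ
    have h2 := congrArg (fun η : M →L[ℝ] ℝ ↦ η.comp (fderiv ℝ ψ y₀)) h1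
    simpa only [ContinuousLinearMap.comp_assoc, hπ, ContinuousLinearMap.comp_id] using h2
  obtain ⟨W', hW⟩ := (LinearMap.range R).exists_isCompl
  have : Module.Free ℝ W' := Module.Free.of_divisionRing ℝ W'
  let W := EuclideanSpace ℝ (Fin (Module.finrank ℝ W'))
  have hfr : Module.finrank ℝ W = Module.finrank ℝ W' := finrank_euclideanSpace_fin
  let ι : W →L[ℝ] (M →L[ℝ] ℝ) := (W'.subtype ∘ₗ
    (LinearEquiv.ofFinrankEq W W' hfr : W →ₗ[ℝ] W')).toContinuousLinearMap
  have hι : ∀ w ∈ W', ∃ w', ι w' = w := fun w hw ↦ by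
    refine ⟨(LinearEquiv.ofFinrankEq W W' hfr).symm ⟨w, hw⟩, ?_⟩
    simp [ι]
  have hdim : Module.finrank ℝ (V × W) = Module.finrank ℝ M := by
    have h1 := Submodule.finrank_add_eq_of_isCompl hW
    rw [LinearMap.finrank_range_of_inj hRinj, finrank_continuousLinearMap_real] at h1
    rw [Module.finrank_prod, hfr, h1, finrank_continuousLinearMap_real]
  set P : V × W → M →L[ℝ] ℝ := fun q ↦ ι q.2 +
    ((fderiv ℝ h q.1 - (ι q.2).comp (fderiv ℝ ψ q.1)).comp
      (ContinuousLinearMap.inverse (A q.1))).comp π with hP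
  set s : Set (V × W) := Metric.ball y₀ r ×ˢ Set.univ with hs
  have hsO : ∀ q ∈ s, q.1 ∈ O := fun q hq ↦ (hball hq.1).1
  have hW' : ContDiff ℝ ∞ (fun q : V × W ↦ ι q.2) := ι.contDiff.comp contDiff_snd
  have hPs : ContDiffOn ℝ ∞ P s :=
    hW'.contDiffOn.add ((((hDh.comp contDiffOn_fst hsO).sub (hW'.contDiffOn.clm_comp
      (hDψ.comp contDiffOn_fst hsO))).clm_comp
        (hinvs.comp contDiffOn_fst fun q hq ↦ hq.1)).clm_comp contDiffOn_const)
  have hΞ : ContDiffOn ℝ ∞ (fun q ↦ (P q, P q (ψ q.1) - τ q.1)) s :=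
    hPs.prodMk ((hPs.clm_apply (hψ.comp contDiffOn_fst hsO)).sub (hτ.comp contDiffOn_fst hsO))
  have hsub : criticalPairs ψ h τ (Metric.ball y₀ r) ⊆
      (fun q ↦ (P q, P q (ψ q.1) - τ q.1)) '' s := by
    rintro ⟨α, c⟩ ⟨y, hy, -, h1, h2⟩
    obtain ⟨_, ⟨ξ, rfl⟩, w, hw, hα⟩ := Submodule.mem_sup.1
      (hW.sup_eq_top ▸ Submodule.mem_top : α ∈ LinearMap.range R ⊔ W')
    obtain ⟨w', hw'⟩ := hι w hw
    have hα' : α = w + ξ.comp π := by rw [← hα, add_comm]; rfl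
    have hPα : P (y, w') = α := by
      have h3 : fderiv ℝ h y - w.comp (fderiv ℝ ψ y) = ξ.comp (A y) := by
        rw [← h1]
        simp only at h1 ⊢
        rw [hα', ContinuousLinearMap.add_comp, add_sub_cancel_left, ContinuousLinearMap.comp_assoc]
      simp only [hP]
      rw [hw', h3, ContinuousLinearMap.comp_assoc ξ, hinv y hy, ContinuousLinearMap.comp_id, hα']
    exact ⟨(y, w'), ⟨hy, Set.mem_univ _⟩, by simp only [hPα]; rw [h2]⟩
  refine ⟨Metric.ball y₀ r, Metric.ball_mem_nhds _ hr, (dimH_mono hsub).trans ?_⟩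
  refine ((hΞ.of_le (m := 1) (by simp)).dimH_image_le
    ((convex_ball y₀ r).prod convex_univ) subset_rfl).trans ?_
  refine (dimH_mono (Set.subset_univ s)).trans ?_
  rw [Real.dimH_univ_eq_finrank, hdim]

/-- The space of all pairs has dimension `dim M + 1`, more than the Hausdorff dimension of the
set of critical pairs. -/
theorem dense_compl_criticalPairs (hO : IsOpen O) (hψ : ContDiffOn ℝ ∞ ψ O)
    (hh : ContDiffOn ℝ ∞ h O) (hτ : ContDiffOn ℝ ∞ τ O) :
    Dense (criticalPairs ψ h τ O)ᶜ := by
  apply dense_compl_of_dimH_lt_finrank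
  have hloc : ∀ y ∈ {y ∈ O | Function.Injective (fderiv ℝ ψ y)}, ∃ N ∈ 𝓝 y,
      dimH (criticalPairs ψ h τ N) ≤ Module.finrank ℝ M := fun y hy ↦
    exists_dimH_criticalPairs_le hO hψ hh hτ hy.1 hy.2
  choose! N hN hdim using hloc
  obtain ⟨t, ht, htc, hcov⟩ := TopologicalSpace.countable_cover_nhdsWithin
    (fun y hy ↦ mem_nhdsWithin_of_mem_nhds (hN y hy))
  have hsub : criticalPairs ψ h τ O ⊆ ⋃ y ∈ t, criticalPairs ψ h τ (N y) := by
    rintro a ⟨y, hy, hyi, h1, h2⟩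
    obtain ⟨z, hz, hyz⟩ := Set.mem_iUnion₂.1 (hcov ⟨hy, hyi⟩)
    exact Set.mem_iUnion₂.2 ⟨z, hz, y, hyz, hyi, h1, h2⟩
  have h1 : dimH (criticalPairs ψ h τ O) ≤ Module.finrank ℝ M := by
    refine (dimH_mono hsub).trans ?_
    rw [dimH_bUnion htc]
    exact iSup₂_le fun y hy ↦ hdim y (ht hy)
  refine h1.trans_lt ?_
  rw [Module.finrank_prod, Module.finrank_self, finrank_continuousLinearMap_real]
  exact_mod_cast Nat.lt_succ_self _

end Generic

/-! ### A generic hypersurface `e u = w x` in `(N × ℝ) × ℝ` -/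

theorem _root_.ContDiffOn.hasFDerivAt_fderiv {V Z : Type*} [NormedAddCommGroup V] [NormedSpace ℝ V]
    [NormedAddCommGroup Z] [NormedSpace ℝ Z] {g : V → Z} {s : Set V} {z : V}
    (hg : ContDiffOn ℝ ∞ g s) (hs : IsOpen s) (hz : z ∈ s) : HasFDerivAt g (fderiv ℝ g z) z :=
  ((hg.contDiffAt (hs.mem_nhds hz)).differentiableAt (by simp)).hasFDerivAt

section Charts

variable {E : Type*} [NormedAddCommGroup E] [NormedSpace ℝ E] {H : Type*} [TopologicalSpace H]
  {I : ModelWithCorners ℝ E H} {X : Type*} [TopologicalSpace X] [ChartedSpace H X]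
  {φ : OpenPartialHomeomorph X E}

theorem IsSmoothChart.contDiffOn_comp_symm {Z : Type*} [NormedAddCommGroup Z] [NormedSpace ℝ Z]
    {g : X → Z} (hφ : IsSmoothChart I φ) (hg : ContMDiff I 𝓘(ℝ, Z) ∞ g) :
    ContDiffOn ℝ ∞ (fun z ↦ g (φ.symm z)) φ.target :=
  contMDiffOn_iff_contDiffOn.1 (hg.comp_contMDiffOn hφ.contMDiffOn_symm)

theorem _root_.ContDiffOn.continuousAt_fderiv_chart {A Z : Type*} [TopologicalSpace A]
    [NormedAddCommGroup Z] [NormedSpace ℝ Z] {g : E → Z} (hg : ContDiffOn ℝ ∞ g φ.target)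
    {q₀ : X} (hq₀ : q₀ ∈ φ.source) (a₀ : A) (l : E) :
    ContinuousAt (fun r : A × X ↦ fderiv ℝ g (φ r.2) l) (a₀, q₀) := by
  have h1 : ContinuousAt (fderiv ℝ g) (φ q₀) :=
    (hg.continuousOn_fderiv_of_isOpen φ.open_target (by simp)).continuousAt
      (φ.open_target.mem_nhds (φ.map_source hq₀))
  have h2 : ContinuousAt (fun q ↦ fderiv ℝ g (φ q)) q₀ :=
    ContinuousAt.comp (f := φ) h1 (φ.continuousAt hq₀)
  have h3 : ContinuousAt (fun r : A × X ↦ fderiv ℝ g (φ r.2)) (a₀, q₀) :=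
    ContinuousAt.comp (f := Prod.snd) (g := fun q ↦ fderiv ℝ g (φ q)) h2 continuousAt_snd
  exact h3.clm_apply continuousAt_const

end Charts

section Regular

variable {F : Type*} [NormedAddCommGroup F] [NormedSpace ℝ F] [FiniteDimensional ℝ F]
  {HN : Type*} [TopologicalSpace HN] (J : ModelWithCorners ℝ F HN)
  {N : Type*} [TopologicalSpace N] [ChartedSpace HN N] {ι : Type*}

/-- The function `s + (e u - w x)` of `((x, u), s)`. -/
def level (e : ℝ) (w : N → ℝ) (q : (N × ℝ) × ℝ) : ℝ := q.2 + (e * q.1.2 - w q.1.1)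

/-- The differential of `ℓ` at the point `q` of the `k`-dimensional submanifold `G` does not vanish
on the tangent space of `G`. -/
def IsRegularAt (k : ℕ) (G : Set ((N × ℝ) × ℝ)) (ℓ : (N × ℝ) × ℝ → ℝ) (q : (N × ℝ) × ℝ) : Prop :=
  ∃ (e : OpenPartialHomeomorph ((N × ℝ) × ℝ) (ModelProd (ModelProd HN ℝ) ℝ))
    (L : Submodule ℝ ((F × ℝ) × ℝ)), q ∈ e.source ∧
    IsSliceChart ((J.prod 𝓘(ℝ, ℝ)).prod 𝓘(ℝ, ℝ)) G e L ∧ Module.finrank ℝ L = k ∧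
    ∃ ξ, dAt ((J.prod 𝓘(ℝ, ℝ)).prod 𝓘(ℝ, ℝ))
        (e.extend ((J.prod 𝓘(ℝ, ℝ)).prod 𝓘(ℝ, ℝ))) q ξ ∈ L ∧
      dAt ((J.prod 𝓘(ℝ, ℝ)).prod 𝓘(ℝ, ℝ)) ℓ q ξ ≠ 0

variable {J}

theorem contMDiff_level {e : ℝ} {w : N → ℝ} (hw : ContMDiff J 𝓘(ℝ, ℝ) ∞ w) :
    ContMDiff ((J.prod 𝓘(ℝ, ℝ)).prod 𝓘(ℝ, ℝ)) 𝓘(ℝ, ℝ) ∞ (level e w) :=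
  contMDiff_snd.add ((contMDiff_const.mul (contMDiff_snd.comp contMDiff_fst)).sub
    (hw.comp (contMDiff_fst.comp contMDiff_fst)))

/-- The functions on `N` among which a generic one is found: locally finite sums of affine functions
of local coordinates, cut off by bump functions. -/
def bumpSum (fs : SmoothBumpCovering ι J N Set.univ) (b : ι → ℝ × (F →L[ℝ] ℝ)) (x : N) : ℝ :=
  ∑ᶠ i, (fs i x * (b i).1 + (b i).2 (fs i x • extChartAt J (fs.c i) x))

variable {fs : SmoothBumpCovering ι J N Set.univ}

theorem support_bumpSum_summand_subset (b : ι → ℝ × (F →L[ℝ] ℝ)) (i : ι) :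
    (Function.support fun x ↦ fs i x * (b i).1 + (b i).2 (fs i x • extChartAt J (fs.c i) x)) ⊆
      Function.support (fs i) := fun x hx h0 ↦ hx (by simp [h0])

theorem contMDiff_smul_extChartAt [T2Space N] [IsManifold J ∞ N] (i : ι) :
    ContMDiff J 𝓘(ℝ, F) ∞ fun x ↦ fs i x • extChartAt J (fs.c i) x :=
  (fs i).contMDiff_smul contMDiffOn_extChartAt

theorem contMDiff_bumpSum [T2Space N] [IsManifold J ∞ N] (b : ι → ℝ × (F →L[ℝ] ℝ)) :
    ContMDiff J 𝓘(ℝ, ℝ) ∞ (bumpSum fs b) :=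
  contMDiff_finsum (fun i ↦ ((fs i).contMDiff.mul contMDiff_const).add
    ((b i).2.contMDiff.comp (contMDiff_smul_extChartAt i)))
    (fs.locallyFinite.subset (support_bumpSum_summand_subset b))

theorem exists_bumpSum_eq_sum (x₀ : N) : ∃ U ∈ 𝓝 x₀, ∃ I₀ : Finset ι,
    ∀ (b : ι → ℝ × (F →L[ℝ] ℝ)), ∀ x ∈ U, bumpSum fs b x =
      ∑ i ∈ I₀, (fs i x * (b i).1 + (b i).2 (fs i x • extChartAt J (fs.c i) x)) := by
  obtain ⟨U, hU, hfin⟩ := fs.locallyFinite x₀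
  refine ⟨U, hU, hfin.toFinset, fun b x hx ↦ finsum_eq_sum_of_support_subset _ fun i hi ↦ ?_⟩
  simp only [Set.Finite.coe_toFinset, Set.mem_ofPred_eq]
  exact ⟨x, support_bumpSum_summand_subset b i hi, hx⟩

open Classical in
theorem bumpSum_update {i : ι} (b : ι → ℝ × (F →L[ℝ] ℝ)) (d : ℝ × (F →L[ℝ] ℝ)) {x : N}
    (hx : fs i x = 1) : bumpSum fs (Function.update b i d) x =
      bumpSum fs b x - ((b i).1 + (b i).2 (extChartAt J (fs.c i) x)) +
        (d.1 + d.2 (extChartAt J (fs.c i) x)) := by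
  have hfin : ∀ b : ι → ℝ × (F →L[ℝ] ℝ), (Function.support fun i ↦
      fs i x * (b i).1 + (b i).2 (fs i x • extChartAt J (fs.c i) x)).Finite := fun b ↦
    (fs.point_finite x).subset fun j hj h0 ↦ hj (by simp [h0])
  have h1 : bumpSum fs (Function.update b i d) x - bumpSum fs b x =
      (d.1 + d.2 (extChartAt J (fs.c i) x)) - ((b i).1 + (b i).2 (extChartAt J (fs.c i) x)) := by
    rw [bumpSum, bumpSum, ← finsum_sub_distrib (hfin _) (hfin _), finsum_eq_single _ i]
    · simp [hx]
    · intro j hj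
      simp [Function.update_of_ne hj]
  linarith

/-- The point `q` lies on the hypersurface `e u = w x` and the level function is critical there on
the submanifold which the chart `φ` maps to `L`; here `a = (e, b)` and `w` is the sum with
coefficients `b`. -/
def IsBadAt (fs : SmoothBumpCovering ι J N Set.univ)
    (φ : OpenPartialHomeomorph ((N × ℝ) × ℝ) ((F × ℝ) × ℝ)) (L : Submodule ℝ ((F × ℝ) × ℝ))
    (a : ℝ × (ι → ℝ × (F →L[ℝ] ℝ))) (q : (N × ℝ) × ℝ) : Prop :=
  a.1 * q.1.2 = bumpSum fs a.2 q.1.1 ∧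
    ∀ l ∈ L, fderiv ℝ (fun z ↦ level a.1 (bumpSum fs a.2) (φ.symm z)) (φ q) l = 0

variable [T2Space N] [IsManifold J ∞ N]
  {φ : OpenPartialHomeomorph ((N × ℝ) × ℝ) ((F × ℝ) × ℝ)} {L : Submodule ℝ ((F × ℝ) × ℝ)}

theorem isOpen_setOf_not_isBadAt (hφ : IsSmoothChart ((J.prod 𝓘(ℝ, ℝ)).prod 𝓘(ℝ, ℝ)) φ)
    {K : Set ((N × ℝ) × ℝ)} (hK : IsCompact K) (hKφ : K ⊆ φ.source) :
    IsOpen {a | ∀ q ∈ K, ¬ IsBadAt fs φ L a q} := by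
  rw [isOpen_iff_mem_nhds]
  intro a₀ ha₀
  refine hK.eventually_forall_of_forall_eventually fun q₀ hq₀ ↦ ?_
  obtain ⟨U', hU', I₀, hsum'⟩ := exists_bumpSum_eq_sum (fs := fs) q₀.1.1
  obtain ⟨U, hUU, hU, hq₀U⟩ := mem_nhds_iff.1 hU'
  have hsum := fun b x (hx : x ∈ U) ↦ hsum' b x (hUU hx)
  have hfst : Continuous fun q : (N × ℝ) × ℝ ↦ q.1.1 := by fun_prop
  have hbad := ha₀ q₀ hq₀
  rw [IsBadAt, not_and_or] at hbad
  rcases hbad with hne | hcrit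
  · -- off the hypersurface
    have hc : ContinuousAt (fun r : (ℝ × (ι → ℝ × (F →L[ℝ] ℝ))) × ((N × ℝ) × ℝ) ↦
        r.1.1 * r.2.1.2 - ∑ i ∈ I₀, (fs i r.2.1.1 * (r.1.2 i).1 +
          (r.1.2 i).2 (fs i r.2.1.1 • extChartAt J (fs.c i) r.2.1.1))) (a₀, q₀) := by
      apply Continuous.continuousAt
      refine (by fun_prop : Continuous fun r : (ℝ × (ι → ℝ × (F →L[ℝ] ℝ))) × ((N × ℝ) × ℝ) ↦
        r.1.1 * r.2.1.2).sub (continuous_finsetSum _ fun i _ ↦ ?_)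
      have h1 : Continuous fun r : (ℝ × (ι → ℝ × (F →L[ℝ] ℝ))) × ((N × ℝ) × ℝ) ↦ fs i r.2.1.1 :=
        (fs i).continuous.comp (by fun_prop)
      have h2 : Continuous fun r : (ℝ × (ι → ℝ × (F →L[ℝ] ℝ))) × ((N × ℝ) × ℝ) ↦
          fs i r.2.1.1 • extChartAt J (fs.c i) r.2.1.1 :=
        (contMDiff_smul_extChartAt (fs := fs) i).continuous.comp
          (f := fun r : (ℝ × (ι → ℝ × (F →L[ℝ] ℝ))) × ((N × ℝ) × ℝ) ↦ r.2.1.1) (by fun_prop)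
      have h3 : Continuous fun r : (ℝ × (ι → ℝ × (F →L[ℝ] ℝ))) × ((N × ℝ) × ℝ) ↦ r.1.2 i :=
        (continuous_apply i).comp (by fun_prop)
      exact (h1.mul h3.fst).add (h3.snd.clm_apply h2)
    have hev := hc.eventually_ne (y := 0)
      (by simp only; rw [← hsum a₀.2 q₀.1.1 hq₀U]; exact sub_ne_zero.2 hne)
    have hevU : ∀ᶠ r : (ℝ × (ι → ℝ × (F →L[ℝ] ℝ))) × ((N × ℝ) × ℝ) in 𝓝 (a₀, q₀), r.2.1.1 ∈ U :=
      (hU.preimage (hfst.comp continuous_snd)).mem_nhds (x := (a₀, q₀)) hq₀U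
    filter_upwards [hev, hevU] with r hr hrU hb
    apply hr
    rw [← hsum r.1.2 r.2.1.1 hrU]
    exact sub_eq_zero.2 hb.1
  · -- off the critical points
    push Not at hcrit
    obtain ⟨l, hl, hne⟩ := hcrit
    have hsrc : φ.source ∩ {q | q.1.1 ∈ U} ∈ 𝓝 q₀ :=
      (φ.open_source.inter (hU.preimage hfst)).mem_nhds ⟨hKφ hq₀, hq₀U⟩
    -- the ingredients of the level function in the chart
    have hs := hφ.contDiffOn_comp_symm (g := fun q ↦ q.2) contMDiff_snd
    have hu := hφ.contDiffOn_comp_symm (g := fun q ↦ q.1.2) (contMDiff_snd.comp contMDiff_fst)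
    have hf : ∀ i, ContDiffOn ℝ ∞ (fun z ↦ fs i (φ.symm z).1.1) φ.target := fun i ↦
      hφ.contDiffOn_comp_symm (g := fun q ↦ fs i q.1.1)
        ((fs i).contMDiff.comp (contMDiff_fst.comp contMDiff_fst))
    have hm : ∀ i, ContDiffOn ℝ ∞ (fun z ↦ fs i (φ.symm z).1.1 •
        extChartAt J (fs.c i) (φ.symm z).1.1) φ.target := fun i ↦
      hφ.contDiffOn_comp_symm (g := fun q : (N × ℝ) × ℝ ↦ fs i q.1.1 • extChartAt J (fs.c i) q.1.1)
        ((contMDiff_smul_extChartAt i).comp (contMDiff_fst.comp contMDiff_fst))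
    -- the differential of the level function, an expression continuous in the coefficients
    set D : (ℝ × (ι → ℝ × (F →L[ℝ] ℝ))) → (F × ℝ) × ℝ → (F × ℝ) × ℝ →L[ℝ] ℝ := fun a z ↦
      fderiv ℝ (fun z ↦ (φ.symm z).2) z + (a.1 • fderiv ℝ (fun z ↦ (φ.symm z).1.2) z -
        ∑ i ∈ I₀, ((a.2 i).1 • fderiv ℝ (fun z ↦ fs i (φ.symm z).1.1) z +
          (a.2 i).2.comp (fderiv ℝ (fun z ↦ fs i (φ.symm z).1.1 •
            extChartAt J (fs.c i) (φ.symm z).1.1) z))) with hD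
    have hform : ∀ a, ∀ q ∈ φ.source ∩ {q | q.1.1 ∈ U},
        fderiv ℝ (fun z ↦ level a.1 (bumpSum fs a.2) (φ.symm z)) (φ q) = D a (φ q) := by
      rintro a q ⟨hq, hqU⟩
      have hz := φ.map_source hq
      have h1 : HasFDerivAt (fun z ↦ (φ.symm z).2 + (a.1 * (φ.symm z).1.2 -
          ∑ i ∈ I₀, (fs i (φ.symm z).1.1 * (a.2 i).1 + (a.2 i).2 (fs i (φ.symm z).1.1 •
            extChartAt J (fs.c i) (φ.symm z).1.1)))) (D a (φ q)) (φ q) :=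
        (hs.hasFDerivAt_fderiv φ.open_target hz).add
          (((hu.hasFDerivAt_fderiv φ.open_target hz).const_mul a.1).sub
          (HasFDerivAt.fun_sum fun i _ ↦
            (((hf i).hasFDerivAt_fderiv φ.open_target hz).mul_const (a.2 i).1).add
            ((a.2 i).2.hasFDerivAt.comp _ ((hm i).hasFDerivAt_fderiv φ.open_target hz))))
      refine (h1.congr_of_eventuallyEq ?_).fderiv
      have h2 : ∀ᶠ z in 𝓝 (φ q), (φ.symm z).1.1 ∈ U := by
        refine (φ.continuousAt_symm hz).preimage_mem_nhds
          ((hU.preimage hfst).mem_nhds ?_)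
        rw [φ.left_inv hq]; exact hqU
      filter_upwards [h2] with z hz
      rw [level, hsum a.2 _ hz]
    have hc : ContinuousAt (fun r : (ℝ × (ι → ℝ × (F →L[ℝ] ℝ))) × ((N × ℝ) × ℝ) ↦
        D r.1 (φ r.2) l) (a₀, q₀) := by
      simp only [hD, add_apply, sub_apply, smul_apply, smul_eq_mul, sum_apply,
        ContinuousLinearMap.comp_apply]
      refine (hs.continuousAt_fderiv_chart (hKφ hq₀) a₀ l).add
        (((by fun_prop : Continuous fun r : (ℝ × (ι → ℝ × (F →L[ℝ] ℝ))) × ((N × ℝ) × ℝ) ↦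
          r.1.1).continuousAt.mul (hu.continuousAt_fderiv_chart (hKφ hq₀) a₀ l)).sub
          (tendsto_finsetSum _ fun i _ ↦ ?_))
      have h3 : Continuous fun r : (ℝ × (ι → ℝ × (F →L[ℝ] ℝ))) × ((N × ℝ) × ℝ) ↦ r.1.2 i :=
        (continuous_apply i).comp (by fun_prop)
      exact (h3.fst.continuousAt.mul ((hf i).continuousAt_fderiv_chart (hKφ hq₀) a₀ l)).add
        (h3.snd.continuousAt.clm_apply ((hm i).continuousAt_fderiv_chart (hKφ hq₀) a₀ l))
    have hev := hc.eventually_ne (y := 0)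
      (by simp only; rw [← hform a₀ q₀ ⟨hKφ hq₀, hq₀U⟩]; exact hne)
    have hev' : ∀ᶠ r : (ℝ × (ι → ℝ × (F →L[ℝ] ℝ))) × ((N × ℝ) × ℝ) in 𝓝 (a₀, q₀),
        r.2 ∈ φ.source ∩ {q | q.1.1 ∈ U} := continuous_snd.continuousAt.preimage_mem_nhds hsrc
    filter_upwards [hev, hev'] with r hr hr' hb
    apply hr
    rw [← hform r.1 r.2 hr']
    exact hb.2 l hl

end Regular

/-! ### Differentials of functions on `(N × ℝ) × ℝ` -/

section Differential

variable {E : Type*} [NormedAddCommGroup E] [NormedSpace ℝ E] [FiniteDimensional ℝ E]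
  {H : Type*} [TopologicalSpace H] {I : ModelWithCorners ℝ E H}
  {X : Type*} [TopologicalSpace X] [ChartedSpace H X]

theorem IsSmoothChart.dAt_injective {φ : OpenPartialHomeomorph X E} (hφ : IsSmoothChart I φ)
    {p : X} (hp : p ∈ φ.source) : Function.Injective (dAt I φ p) :=
  (LinearMap.injective_iff_surjective (f := (dAt I φ p : E →ₗ[ℝ] E))).2 (hφ.dAt_surjective hp)

theorem dAt_congr {Z : Type*} [NormedAddCommGroup Z] [NormedSpace ℝ Z] {g h : X → Z} {p : X}
    (hgh : g =ᶠ[𝓝 p] h) : dAt I g p = dAt I h p := hgh.mfderiv_eq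

variable {F : Type*} [NormedAddCommGroup F] [NormedSpace ℝ F]
  {HN : Type*} [TopologicalSpace HN] {J : ModelWithCorners ℝ F HN}
  {N : Type*} [TopologicalSpace N] [ChartedSpace HN N]

theorem dAt_comp_fst_fst {Z : Type*} [NormedAddCommGroup Z] [NormedSpace ℝ Z] {g : N → Z}
    {q : (N × ℝ) × ℝ} (hg : MDifferentiableAt J 𝓘(ℝ, Z) g q.1.1) (η : (F × ℝ) × ℝ) :
    dAt ((J.prod 𝓘(ℝ, ℝ)).prod 𝓘(ℝ, ℝ)) (fun q : (N × ℝ) × ℝ ↦ g q.1.1) q η =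
      dAt J g q.1.1 η.1.1 := by
  have h1 : HasMFDerivAt ((J.prod 𝓘(ℝ, ℝ)).prod 𝓘(ℝ, ℝ)) J (fun q : (N × ℝ) × ℝ ↦ q.1.1) q _ :=
    (hasMFDerivAt_fst q.1).comp q (hasMFDerivAt_fst q)
  have h2 := (hg.hasMFDerivAt.comp q h1).mfderiv
  exact DFunLike.congr_fun h2 η

theorem dAt_fst_snd (q : (N × ℝ) × ℝ) (η : (F × ℝ) × ℝ) :
    dAt ((J.prod 𝓘(ℝ, ℝ)).prod 𝓘(ℝ, ℝ)) (fun q : (N × ℝ) × ℝ ↦ q.1.2) q η = η.1.2 := by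
  have h1 : HasMFDerivAt ((J.prod 𝓘(ℝ, ℝ)).prod 𝓘(ℝ, ℝ)) 𝓘(ℝ, ℝ)
      (fun q : (N × ℝ) × ℝ ↦ q.1.2) q _ :=
    (hasMFDerivAt_snd q.1).comp q (hasMFDerivAt_fst q)
  exact DFunLike.congr_fun h1.mfderiv η

theorem dAt_snd (q : (N × ℝ) × ℝ) (η : (F × ℝ) × ℝ) :
    dAt ((J.prod 𝓘(ℝ, ℝ)).prod 𝓘(ℝ, ℝ)) (fun q : (N × ℝ) × ℝ ↦ q.2) q η = η.2 :=
  DFunLike.congr_fun (hasMFDerivAt_snd q).mfderiv η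

theorem fderiv_comp_coe {V Z : Type*} [NormedAddCommGroup V] [NormedSpace ℝ V]
    [NormedAddCommGroup Z] [NormedSpace ℝ Z] {L : Submodule ℝ V} {g : V → Z} {y : L}
    (hg : DifferentiableAt ℝ g y) (v : L) :
    fderiv ℝ (fun y : L ↦ g y) y v = fderiv ℝ g y v := by
  have h := (hg.hasFDerivAt.comp (f := fun y : L ↦ (y : V)) y L.subtypeL.hasFDerivAt).fderiv
  exact DFunLike.congr_fun h v

end Differential

/-! ### Genericity of the hypersurface -/

section Generic

variable {F : Type*} [NormedAddCommGroup F] [NormedSpace ℝ F] [FiniteDimensional ℝ F]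
  {HN : Type*} [TopologicalSpace HN] {J : ModelWithCorners ℝ F HN} [J.Boundaryless]
  {N : Type*} [TopologicalSpace N] [ChartedSpace HN N] {ι : Type*}
  [T2Space N] [IsManifold J ∞ N] {fs : SmoothBumpCovering ι J N Set.univ}
  {φ : OpenPartialHomeomorph ((N × ℝ) × ℝ) ((F × ℝ) × ℝ)} {L : Submodule ℝ ((F × ℝ) × ℝ)}

open Classical in
/-- Only the affine function belonging to one index `i` is varied. With `ψ = (x, u)` in local
coordinates of `N`, the bad points are critical points of `α ∘ ψ - h` on `L`. At such a point `ψ`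
is an immersion: if `dx` and `du` vanish on a vector, then so does `ds`. -/
theorem dense_setOf_not_isBadAt (hφ : IsSmoothChart ((J.prod 𝓘(ℝ, ℝ)).prod 𝓘(ℝ, ℝ)) φ)
    {K : Set ((N × ℝ) × ℝ)} (hKφ : K ⊆ φ.source) (hKL : ∀ q ∈ K, φ q ∈ L) (i : ι)
    (hKi : ∀ q ∈ K, fs i =ᶠ[𝓝 q.1.1] 1) :
    Dense {a | ∀ q ∈ K, ¬ IsBadAt fs φ L a q} := by
  intro a₀
  -- the local coordinates, and the part of `bumpSum` that is kept fixed
  set X' : N → F := fun x ↦ fs i x • extChartAt J (fs.c i) x with hX'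
  have hX's : ContMDiff J 𝓘(ℝ, F) ∞ X' := contMDiff_smul_extChartAt i
  set T : N → ℝ := fun x ↦ bumpSum fs a₀.2 x - ((a₀.2 i).1 + (a₀.2 i).2 (X' x)) with hT
  have hTs : ContMDiff J 𝓘(ℝ, ℝ) ∞ T := (contMDiff_bumpSum a₀.2).sub
    (contMDiff_const.add ((a₀.2 i).2.contMDiff.comp hX's))
  have hX'c : ContMDiff ((J.prod 𝓘(ℝ, ℝ)).prod 𝓘(ℝ, ℝ)) 𝓘(ℝ, F) ∞
      fun q : (N × ℝ) × ℝ ↦ X' q.1.1 := hX's.comp (contMDiff_fst.comp contMDiff_fst)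
  have hTc : ContMDiff ((J.prod 𝓘(ℝ, ℝ)).prod 𝓘(ℝ, ℝ)) 𝓘(ℝ, ℝ) ∞
      fun q : (N × ℝ) × ℝ ↦ T q.1.1 := hTs.comp (contMDiff_fst.comp contMDiff_fst)
  have huc : ContMDiff ((J.prod 𝓘(ℝ, ℝ)).prod 𝓘(ℝ, ℝ)) 𝓘(ℝ, ℝ) ∞
      fun q : (N × ℝ) × ℝ ↦ q.1.2 := contMDiff_snd.comp contMDiff_fst
  have hsc : ContMDiff ((J.prod 𝓘(ℝ, ℝ)).prod 𝓘(ℝ, ℝ)) 𝓘(ℝ, ℝ) ∞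
      fun q : (N × ℝ) × ℝ ↦ q.2 := contMDiff_snd
  have hX'd := hφ.contDiffOn_comp_symm hX'c
  have hTd := hφ.contDiffOn_comp_symm hTc
  have hud := hφ.contDiffOn_comp_symm huc
  have hsd := hφ.contDiffOn_comp_symm hsc
  set O : Set L := {y | (y : (F × ℝ) × ℝ) ∈ φ.target} with hO
  have hOo : IsOpen O := φ.open_target.preimage continuous_subtype_val
  have hcoe : ContDiffOn ℝ ∞ (fun y : L ↦ (y : (F × ℝ) × ℝ)) O := L.subtypeL.contDiff.contDiffOn
  have hdense := dense_compl_criticalPairs (ψ := fun y : L ↦ (X' (φ.symm y).1.1, (φ.symm y).1.2))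
    (h := fun y : L ↦ T (φ.symm y).1.1 - (φ.symm y).2) (τ := fun y : L ↦ T (φ.symm y).1.1) hOo
    ((hX'd.comp hcoe fun y hy ↦ hy).prodMk (hud.comp hcoe fun y hy ↦ hy))
    ((hTd.sub hsd).comp hcoe fun y hy ↦ hy) (hTd.comp hcoe fun y hy ↦ hy)
  -- the coefficients for which the level function is `s + (α ∘ ψ - τ - c)` near the bad point
  set Γ : (F × ℝ →L[ℝ] ℝ) × ℝ → ℝ × (ι → ℝ × (F →L[ℝ] ℝ)) := fun r ↦
    (r.1 (0, 1), Function.update a₀.2 i (r.2, -r.1.comp (ContinuousLinearMap.inl ℝ F ℝ))) with hΓ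
  have hΓc : Continuous Γ := by
    refine (by fun_prop : Continuous fun r : (F × ℝ →L[ℝ] ℝ) × ℝ ↦ r.1 (0, 1)).prodMk ?_
    exact continuous_const.update i (continuous_snd.prodMk
      (continuous_fst.clm_comp continuous_const).neg)
  set α₀ : F × ℝ →L[ℝ] ℝ := (-(a₀.2 i).2).coprod (a₀.1 • ContinuousLinearMap.id ℝ ℝ) with hα₀
  have hΓ₀ : Γ (α₀, (a₀.2 i).1) = a₀ := by
    refine Prod.ext (by simp [hΓ, hα₀]) ?_
    simp only [hΓ, hα₀, ContinuousLinearMap.coprod_comp_inl, neg_neg, Prod.mk.eta,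
      Function.update_eq_self]
  rw [← hΓ₀]
  refine map_mem_closure hΓc (hdense _) ?_
  rintro ⟨α, c⟩ hr q hq ⟨hq0, hcrit⟩
  apply hr
  have hqs := hKφ hq
  have hqt := φ.map_source hqs
  have hqi := (hKi q hq).self_of_nhds
  -- the level function near `q`
  have hval : ∀ x, fs i x = 1 → bumpSum fs (Γ (α, c)).2 x = T x + c - α (X' x, 0) := by
    intro x hx
    simp only [hΓ, bumpSum_update _ _ hx, hT, hX', hx, one_smul, neg_apply,
      ContinuousLinearMap.comp_apply, ContinuousLinearMap.inl_apply]
    ring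
  have hαu : ∀ z u, α (z, u) = α (z, 0) + α (0, 1) * u := by
    intro z u
    have : (z, u) = (z, (0 : ℝ)) + u • ((0 : F), (1 : ℝ)) := by simp
    rw [this, map_add, map_smul, smul_eq_mul, mul_comm u]
  have hlev : ∀ᶠ z in 𝓝 (φ q), level (Γ (α, c)).1 (bumpSum fs (Γ (α, c)).2) (φ.symm z) =
      (φ.symm z).2 + (α (X' (φ.symm z).1.1, (φ.symm z).1.2) - T (φ.symm z).1.1 - c) := by
    have h1 : ∀ᶠ z in 𝓝 (φ q), fs i (φ.symm z).1.1 = 1 := by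
      have h2 : Filter.Tendsto (fun z ↦ (φ.symm z).1.1) (𝓝 (φ q)) (𝓝 q.1.1) := by
        have h3 := φ.continuousAt_symm hqt
        rw [ContinuousAt, φ.left_inv hqs] at h3
        exact ((continuous_fst.comp continuous_fst).tendsto q).comp h3
      exact h2.eventually (hKi q hq)
    filter_upwards [h1] with z hz
    rw [level, hval _ hz, hαu (X' _) (φ.symm z).1.2]
    simp only [hΓ]
    ring
  have dX := hX'd.hasFDerivAt_fderiv φ.open_target hqt
  have dT := hTd.hasFDerivAt_fderiv φ.open_target hqt
  have du := hud.hasFDerivAt_fderiv φ.open_target hqt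
  have ds := hsd.hasFDerivAt_fderiv φ.open_target hqt
  have hcrit' : ∀ l ∈ L, fderiv ℝ (fun z ↦ (φ.symm z).2) (φ q) l +
      (α (fderiv ℝ (fun z ↦ X' (φ.symm z).1.1) (φ q) l, fderiv ℝ (fun z ↦ (φ.symm z).1.2) (φ q) l) -
        fderiv ℝ (fun z ↦ T (φ.symm z).1.1) (φ q) l) = 0 := by
    intro l hl
    have h1 := ((ds.add (((α.hasFDerivAt.comp _ (dX.prodMk du)).sub dT).sub_const
      c)).congr_of_eventuallyEq hlev).fderiv
    rw [← hcrit l hl, h1]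
    rfl
  let y : L := ⟨φ q, hKL q hq⟩
  have dψ : ∀ v : L, fderiv ℝ (fun y : L ↦ (X' (φ.symm y).1.1, (φ.symm y).1.2)) y v =
      (fderiv ℝ (fun z ↦ X' (φ.symm z).1.1) (φ q) v,
        fderiv ℝ (fun z ↦ (φ.symm z).1.2) (φ q) v) := fun v ↦ by
    rw [fderiv_comp_coe (y := y) (g := fun z ↦ (X' (φ.symm z).1.1, (φ.symm z).1.2))
      (dX.prodMk du).differentiableAt v, (dX.prodMk du).fderiv]
    rfl
  have dh : ∀ v : L, fderiv ℝ (fun y : L ↦ T (φ.symm y).1.1 - (φ.symm y).2) y v =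
      fderiv ℝ (fun z ↦ T (φ.symm z).1.1) (φ q) v -
        fderiv ℝ (fun z ↦ (φ.symm z).2) (φ q) v := fun v ↦ by
    rw [fderiv_comp_coe (y := y) (g := fun z ↦ T (φ.symm z).1.1 - (φ.symm z).2)
      (dT.fun_sub ds).differentiableAt v, (dT.fun_sub ds).fderiv]
    rfl
  have hcomp : α.comp (fderiv ℝ (fun y : L ↦ (X' (φ.symm y).1.1, (φ.symm y).1.2)) y) =
      fderiv ℝ (fun y : L ↦ T (φ.symm y).1.1 - (φ.symm y).2) y := by
    ext v
    rw [ContinuousLinearMap.comp_apply, dψ, dh]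
    linarith [hcrit' v v.2]
  refine ⟨y, hqt, ?_, hcomp, ?_⟩
  · rw [injective_iff_map_eq_zero]
    intro v hv
    have hhv : fderiv ℝ (fun y : L ↦ T (φ.symm y).1.1 - (φ.symm y).2) y v = 0 := by
      rw [← hcomp, ContinuousLinearMap.comp_apply, hv, map_zero]
    rw [dh] at hhv
    rw [dψ] at hv
    obtain ⟨η, hη⟩ := hφ.dAt_surjective hqs (v : (F × ℝ) × ℝ)
    rw [← hη] at hhv hv
    have eX : dAt J X' q.1.1 η.1.1 = 0 := by
      rw [← dAt_comp_fst_fst (hX's.mdifferentiable (by simp) _),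
        hφ.dAt_eq_fderiv_comp hqs dX.differentiableAt]
      exact (Prod.ext_iff.1 hv).1
    have eu : η.1.2 = 0 := by
      rw [← dAt_fst_snd (J := J) q, hφ.dAt_eq_fderiv_comp hqs du.differentiableAt]
      exact (Prod.ext_iff.1 hv).2
    have ex : η.1.1 = 0 := by
      have hc := isSmoothChart_chartE (I := J)
        (IsManifold.chart_mem_maximalAtlas (n := ∞) (fs.c i))
      have hx : q.1.1 ∈ (chartAt HN (fs.c i)).source := fs.mem_chartAt_source_of_eq_one hqi
      refine (injective_iff_map_eq_zero _).1 (hc.dAt_injective hx) _ ?_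
      rw [← eX]
      congr 1
      refine dAt_congr ?_
      filter_upwards [hKi q hq] with x hx
      simp only [hX', hx, Pi.one_apply, one_smul]
      rfl
    have es : η.2 = 0 := by
      have h1 : dAt ((J.prod 𝓘(ℝ, ℝ)).prod 𝓘(ℝ, ℝ)) (fun q : (N × ℝ) × ℝ ↦ T q.1.1) q η = 0 := by
        rw [dAt_comp_fst_fst (hTs.mdifferentiable (by simp) _), ex, map_zero]
      have h2 := dAt_snd (J := J) q η
      rw [hφ.dAt_eq_fderiv_comp hqs dT.differentiableAt] at h1
      rw [hφ.dAt_eq_fderiv_comp hqs ds.differentiableAt] at h2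
      simp only [ContinuousLinearMap.comp_apply] at h1 h2
      linarith
    have : η = 0 := Prod.ext (Prod.ext ex eu) es
    apply Subtype.ext
    rw [← hη, this, map_zero]; rfl
  · simp only [y, φ.left_inv hqs]
    rw [hval _ hqi] at hq0
    simp only [hΓ] at hq0
    linarith [hαu (X' q.1.1) q.1.2]

/-- By Baire's theorem there is a hypersurface `e u = w x` such that the level function is regular
on `G` at all points of the hypersurface. -/
theorem exists_isRegularAt_of_mem [SecondCountableTopology N] [SigmaCompactSpace N]
    [LocallyCompactSpace N] {k : ℕ} (G : Psi ((J.prod 𝓘(ℝ, ℝ)).prod 𝓘(ℝ, ℝ)) ((N × ℝ) × ℝ) k) :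
    ∃ (e : ℝ) (w : N → ℝ), e ≠ 0 ∧ ContMDiff J 𝓘(ℝ, ℝ) ∞ w ∧ ∀ q ∈ G.carrier, e * q.1.2 = w q.1.1 →
      IsRegularAt J k G.carrier (level e w) q := by
  obtain ⟨ι, fs, -⟩ := SmoothBumpCovering.exists_isSubordinate J (s := (Set.univ : Set N))
    isClosed_univ (U := fun _ ↦ Set.univ) fun _ _ ↦ Filter.univ_mem
  have hι : Countable ι := by
    have := fs.locallyFinite.countable_univ fun i ↦ (fs i).nonempty_support
    exact Set.countable_univ_iff.1 this
  -- each point has a compact neighbourhood on which the condition is open and dense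
  have hpiece : ∀ q ∈ G.carrier, ∃ C ∈ 𝓝 q, ∃ D : Set (ℝ × (ι → ℝ × (F →L[ℝ] ℝ))),
      IsOpen D ∧ Dense D ∧ ∀ a ∈ D, ∀ p ∈ C ∩ G.carrier, a.1 * p.1.2 = bumpSum fs a.2 p.1.1 →
        IsRegularAt J k G.carrier (level a.1 (bumpSum fs a.2)) p := by
    intro q hq
    obtain ⟨c, L, hqc, hcL, hLk⟩ := G.isSubmanifold q hq
    have hev := (fs.eventuallyEq_one q.1.1 trivial).eventually_nhds
    have hev' : ∀ᶠ p : (N × ℝ) × ℝ in 𝓝 q, fs (fs.ind q.1.1 trivial) =ᶠ[𝓝 p.1.1] 1 :=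
      ((continuous_fst.comp continuous_fst).tendsto q).eventually hev
    obtain ⟨C, hC, hCs, hCc⟩ := local_compact_nhds
      (Filter.inter_mem (c.open_source.mem_nhds hqc) hev')
    have hφ := isSmoothChart_chartE hcL.1
    refine ⟨C, hC, {a | ∀ p ∈ C ∩ G.carrier, ¬ IsBadAt fs (chartE _ c) L a p},
      isOpen_setOf_not_isBadAt hφ (hCc.inter_right G.isClosed) fun p hp ↦ (hCs hp.1).1,
      dense_setOf_not_isBadAt hφ (fun p hp ↦ (hCs hp.1).1)
        (fun p hp ↦ (hcL.2 p (hCs hp.1).1).1 hp.2) _ fun p hp ↦ (hCs hp.1).2,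
      fun a ha p hp hpw ↦ ?_⟩
    have hb := ha p hp
    simp only [IsBadAt, not_and, not_forall] at hb
    obtain ⟨l, hl, hne⟩ := hb hpw
    have hps : p ∈ (chartE ((J.prod 𝓘(ℝ, ℝ)).prod 𝓘(ℝ, ℝ)) c).source := (hCs hp.1).1
    obtain ⟨ξ, hξ⟩ := hφ.dAt_surjective hps l
    refine ⟨c, L, hps, hcL, hLk, ξ, ?_, ?_⟩
    · have : dAt ((J.prod 𝓘(ℝ, ℝ)).prod 𝓘(ℝ, ℝ)) (c.extend ((J.prod 𝓘(ℝ, ℝ)).prod 𝓘(ℝ, ℝ))) p ξ =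
          l := hξ
      rwa [this]
    · rw [hφ.dAt_eq_fderiv_comp hps
        ((hφ.contDiffOn_comp_symm (contMDiff_level (contMDiff_bumpSum a.2))).hasFDerivAt_fderiv
          (chartE _ c).open_target ((chartE _ c).map_source hps)).differentiableAt,
        ContinuousLinearMap.comp_apply, hξ]
      exact hne
  choose! C hC D hDo hDd hD using hpiece
  obtain ⟨t, htG, htc, hcov⟩ := TopologicalSpace.countable_cover_nhdsWithin
    fun q hq ↦ mem_nhdsWithin_of_mem_nhds (hC q hq)
  have hgood := dense_biInter_of_isOpen (fun q hq ↦ hDo q (htG hq)) htc fun q hq ↦ hDd q (htG hq)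
  have hne : IsOpen {a : ℝ × (ι → ℝ × (F →L[ℝ] ℝ)) | a.1 ≠ 0} :=
    isOpen_ne.preimage continuous_fst
  obtain ⟨a, ha0, ha⟩ := hgood.inter_open_nonempty _ hne ⟨(1, 0), one_ne_zero⟩
  refine ⟨a.1, bumpSum fs a.2, ha0, contMDiff_bumpSum a.2, fun p hp hpw ↦ ?_⟩
  obtain ⟨q, hq, hpC⟩ := Set.mem_iUnion₂.1 (hcov hp)
  exact hD q (htG hq) a (Set.mem_iInter₂.1 ha q hq) p ⟨hpC, hp⟩ hpw

end Generic

/-! ### A neighbourhood of the hypersurface -/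

section RegularOpen

variable {F : Type*} [NormedAddCommGroup F] [NormedSpace ℝ F] [FiniteDimensional ℝ F]
  {HN : Type*} [TopologicalSpace HN] {J : ModelWithCorners ℝ F HN} [J.Boundaryless]
  {N : Type*} [TopologicalSpace N] [ChartedSpace HN N] [IsManifold J ∞ N] {k : ℕ}

theorem IsRegularAt.eventually {G : Set ((N × ℝ) × ℝ)} {ℓ : (N × ℝ) × ℝ → ℝ}
    {q : (N × ℝ) × ℝ} (h : IsRegularAt J k G ℓ q)
    (hℓ : ContMDiff ((J.prod 𝓘(ℝ, ℝ)).prod 𝓘(ℝ, ℝ)) 𝓘(ℝ, ℝ) ∞ ℓ) :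
    ∀ᶠ p in 𝓝 q, IsRegularAt J k G ℓ p := by
  obtain ⟨c, L, hqc, hcL, hLk, ξ, hξL, hξ⟩ := h
  set φ := chartE ((J.prod 𝓘(ℝ, ℝ)).prod 𝓘(ℝ, ℝ)) c
  have hφ : IsSmoothChart ((J.prod 𝓘(ℝ, ℝ)).prod 𝓘(ℝ, ℝ)) φ := isSmoothChart_chartE hcL.1
  have hd := hφ.contDiffOn_comp_symm hℓ
  have hread : ∀ p ∈ c.source, ∀ η, dAt ((J.prod 𝓘(ℝ, ℝ)).prod 𝓘(ℝ, ℝ)) ℓ p η =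
      fderiv ℝ (fun z ↦ ℓ (φ.symm z)) (φ p)
        (dAt ((J.prod 𝓘(ℝ, ℝ)).prod 𝓘(ℝ, ℝ)) φ p η) := fun p hp η ↦ by
    rw [hφ.dAt_eq_fderiv_comp (p := p) hp (hd.hasFDerivAt_fderiv φ.open_target
      (φ.map_source hp)).differentiableAt, ContinuousLinearMap.comp_apply]
  set l := dAt ((J.prod 𝓘(ℝ, ℝ)).prod 𝓘(ℝ, ℝ)) φ q ξ with hl
  have hc := (hd.continuousAt_fderiv_chart (q₀ := q) hqc () l).comp
    (f := fun p ↦ ((), p)) (x := q) (by fun_prop)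
  rw [hread q hqc] at hξ
  filter_upwards [hc.eventually_ne (y := 0) hξ, c.open_source.mem_nhds hqc] with p hp hps
  obtain ⟨η, hη⟩ := hφ.dAt_surjective (p := p) hps l
  refine ⟨c, L, hps, hcL, hLk, η, ?_, ?_⟩
  · have : dAt ((J.prod 𝓘(ℝ, ℝ)).prod 𝓘(ℝ, ℝ))
        (c.extend ((J.prod 𝓘(ℝ, ℝ)).prod 𝓘(ℝ, ℝ))) p η = l := hη
    rw [this]; exact hξL
  · rw [hread p hps, hη]; exact hp

/-- As the level function is regular on `G` at the points of the hypersurface `e u = w x`, it is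
also regular at the points close to it, the meaning of close depending on `x`. -/
theorem exists_isRegularAt_of_abs_mul_lt_one [T2Space N] [SigmaCompactSpace N]
    [LocallyCompactSpace N] (G : Psi ((J.prod 𝓘(ℝ, ℝ)).prod 𝓘(ℝ, ℝ)) ((N × ℝ) × ℝ) k)
    {e : ℝ} {w : N → ℝ} (he : e ≠ 0) (hw : ContMDiff J 𝓘(ℝ, ℝ) ∞ w)
    (hreg : ∀ q ∈ G.carrier, e * q.1.2 = w q.1.1 → IsRegularAt J k G.carrier (level e w) q)
    (a b c : ℝ) :
    ∃ m : N → ℝ, ContMDiff J 𝓘(ℝ, ℝ) ∞ m ∧ (∀ x, c ≤ m x) ∧ ∀ q ∈ G.carrier, q.2 ∈ Set.Icc a b →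
      |e * q.1.2 - w q.1.1| * m q.1.1 < 1 → IsRegularAt J k G.carrier (level e w) q := by
  set t : N → Set ℝ := fun x ↦ {r | c ≤ r ∧ ∀ q ∈ G.carrier, q.1.1 = x → q.2 ∈ Set.Icc a b →
    |e * q.1.2 - w q.1.1| * r < 1 → IsRegularAt J k G.carrier (level e w) q} with ht
  -- the condition on `m` is convex in the value of `m`, and locally it is met by constants
  have hconv : ∀ x, Convex ℝ (t x) := fun x ↦ by
    refine Set.OrdConnected.convex ⟨fun r hr r' _ r'' hr'' ↦ ⟨hr.1.trans hr''.1, ?_⟩⟩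
    intro q hq hqx hqs hlt
    exact hr.2 q hq hqx hqs ((mul_le_mul_of_nonneg_left hr''.1 (abs_nonneg _)).trans_lt hlt)
  have hρ : Continuous fun q : (N × ℝ) × ℝ ↦ |e * q.1.2 - w q.1.1| :=
    ((by fun_prop : Continuous fun q : (N × ℝ) × ℝ ↦ e * q.1.2).sub
      (hw.continuous.comp (continuous_fst.comp continuous_fst))).abs
  have hloc : ∀ x : N, ∃ r : ℝ, ∀ᶠ y in 𝓝 x, r ∈ t y := by
    intro x
    obtain ⟨K, hK, hxK⟩ := exists_compact_mem_nhds x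
    obtain ⟨B, hB⟩ := hK.exists_bound_of_continuousOn hw.continuous.continuousOn
    set S : Set ((N × ℝ) × ℝ) := ((K ×ˢ Set.Icc (-((1 + B) / |e|)) ((1 + B) / |e|)) ×ˢ
      Set.Icc a b) ∩ (G.carrier ∩ {q | IsRegularAt J k G.carrier (level e w) q}ᶜ) with hS
    have hSc : IsCompact S := by
      refine ((hK.prod isCompact_Icc).prod isCompact_Icc).inter_right (G.isClosed.inter ?_)
      exact (isOpen_iff_mem_nhds.2 fun q hq ↦ IsRegularAt.eventually hq
        (contMDiff_level hw)).isClosed_compl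
    obtain ⟨δ, hδ, hδS⟩ := hSc.exists_forall_le' (a := 0) hρ.continuousOn fun q hq ↦ by
      rw [abs_pos, sub_ne_zero]
      exact fun h ↦ hq.2.2 (hreg q hq.2.1 h)
    refine ⟨max c (max 1 δ⁻¹), Filter.mem_of_superset hxK fun y hy ↦ ⟨le_max_left _ _, ?_⟩⟩
    rintro q hq rfl hqs hlt
    by_contra hnr
    have h1 : |e * q.1.2 - w q.1.1| < 1 := by
      refine lt_of_le_of_lt ?_ hlt
      exact le_mul_of_one_le_right (abs_nonneg _) ((le_max_left _ _).trans (le_max_right _ _))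
    have h2 : |q.1.2| ≤ (1 + B) / |e| := by
      rw [le_div_iff₀ (abs_pos.2 he), ← abs_mul, mul_comm]
      have h3 := abs_add_le (e * q.1.2 - w q.1.1) (w q.1.1)
      rw [sub_add_cancel] at h3
      have h4 := hB _ hy
      rw [Real.norm_eq_abs] at h4
      linarith
    have h5 := hδS q ⟨⟨⟨hy, abs_le.1 h2⟩, hqs⟩, hq, hnr⟩
    have h6 : (1 : ℝ) ≤ |e * q.1.2 - w q.1.1| * max c (max 1 δ⁻¹) := by
      calc (1 : ℝ) = δ * δ⁻¹ := (mul_inv_cancel₀ hδ.ne').symm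
        _ ≤ _ := mul_le_mul h5 ((le_max_right _ _).trans (le_max_right _ _))
          (inv_nonneg.2 hδ.le) (abs_nonneg _)
    linarith
  obtain ⟨m, hm⟩ := exists_contMDiffMap_forall_mem_convex_of_local_const (n := (⊤ : ℕ∞)) (I := J)
    hconv hloc
  exact ⟨m, m.contMDiff, fun x ↦ (hm x).1, fun q hq ↦ (hm q.1.1).2 q hq rfl⟩

end RegularOpen

/-! ### Submanifolds of product form -/

section Product

variable {B : Type*}

/-- To be orthogonal on an open set means to be of product form there. -/
theorem isOrthogonalOn_iff {G : Set (B × ℝ)} {S : Set ℝ} (hS : IsOpen S) :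
    IsOrthogonalOn G S ↔ ∀ z, ∀ s ∈ S, ∀ s' ∈ S, (z, s) ∈ G → (z, s') ∈ G := by
  constructor
  · intro h z s hs s' hs' hG
    obtain ⟨r, hr, hrS⟩ := Metric.isOpen_iff.1 hS s hs
    obtain ⟨r', hr', hrS'⟩ := Metric.isOpen_iff.1 hS s' hs'
    set δ := min r r' with hδ
    have hδ0 : 0 < δ := lt_min hr hr'
    have h1 := h (Metric.ball s δ) (Metric.ball s' δ) Metric.isOpen_ball
      (convex_ball s δ).ordConnected Metric.isOpen_ball (convex_ball s' δ).ordConnected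
      ((Metric.ball_subset_ball (min_le_left _ _)).trans hrS)
      ((Metric.ball_subset_ball (min_le_right _ _)).trans hrS') (fun x ↦ x + (s - s'))
      ⟨by fun_prop, ⟨fun x hx ↦ ?_, fun x _ y _ hxy ↦ by simpa using hxy, fun x hx ↦
        ⟨x - (s - s'), ?_, by simp⟩⟩, fun x _ ↦ by simp⟩
    · have h2 : ((z, s') : B × ℝ) ∈ restr (pull (fun x ↦ x + (s - s'))
          (restr G (Metric.ball s δ))) (Metric.ball s' δ) := by
        refine ⟨⟨?_, ?_⟩, Metric.mem_ball_self hδ0⟩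
        · simpa using hG
        · simp [hδ0]
      rw [← h1] at h2
      exact h2.1
    · rw [Metric.mem_ball, Real.dist_eq] at hx ⊢
      rwa [show x + (s - s') - s = x - s' by ring]
    · rw [Metric.mem_ball, Real.dist_eq] at hx ⊢
      rwa [show x - (s - s') - s' = x - s by ring]
  · intro h Y Y' _ _ _ _ hYS hY'S α hα
    ext ⟨z, s⟩
    simp only [restr, pull, Set.mem_ofPred_eq]
    constructor
    · rintro ⟨hG, hs⟩
      have := hα.2.1.mapsTo hs
      exact ⟨⟨h z s (hY'S hs) _ (hYS this) hG, this⟩, hs⟩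
    · rintro ⟨⟨hG, h1⟩, hs⟩
      exact ⟨h z _ (hYS h1) s (hY'S hs) hG, hs⟩

variable {E : Type*} [NormedAddCommGroup E] [NormedSpace ℝ E] [FiniteDimensional ℝ E]
  {H : Type*} [TopologicalSpace H] {I : ModelWithCorners ℝ E H}
  [I.Boundaryless] [TopologicalSpace B] [ChartedSpace H B]

/-- Where `G` is of product form, the direction of `ℝ` is tangent to `G`. -/
theorem dAt_extend_mem_of_eventually {G : Set (B × ℝ)}
    {c : OpenPartialHomeomorph (B × ℝ) (ModelProd H ℝ)}
    {L : Submodule ℝ (E × ℝ)} (hc : IsSliceChart (I.prod 𝓘(ℝ, ℝ)) G c L) {z : B} {s : ℝ}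
    (hzs : (z, s) ∈ c.source) (hG : ∀ᶠ s' in 𝓝 s, (z, s') ∈ G) :
    dAt (I.prod 𝓘(ℝ, ℝ)) (c.extend (I.prod 𝓘(ℝ, ℝ))) (z, s) (0, 1) ∈ L := by
  have h1 : HasMFDerivAt 𝓘(ℝ, ℝ) (I.prod 𝓘(ℝ, ℝ)) (fun s' : ℝ ↦ (z, s')) s _ :=
    (hasMFDerivAt_const z s).prodMk (hasMFDerivAt_id s)
  have h2 : HasMFDerivAt (I.prod 𝓘(ℝ, ℝ)) 𝓘(ℝ, E × ℝ) (c.extend (I.prod 𝓘(ℝ, ℝ))) (z, s) _ :=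
    (((isSmoothChart_chartE hc.1).contMDiffAt (p := (z, s)) hzs).mdifferentiableAt
      (by simp)).hasMFDerivAt
  have h3 : HasFDerivAt (c.extend (I.prod 𝓘(ℝ, ℝ)) ∘ fun s' : ℝ ↦ (z, s'))
      ((dAt (I.prod 𝓘(ℝ, ℝ)) (c.extend (I.prod 𝓘(ℝ, ℝ))) (z, s)).comp
        (ContinuousLinearMap.inr ℝ E ℝ)) s := (h2.comp s h1).hasFDerivAt
  have hLc : IsClosed (L : Set (E × ℝ)) := L.closed_of_finiteDimensional
  have h4 : ∀ᶠ s' in 𝓝 s,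
      (c.extend (I.prod 𝓘(ℝ, ℝ)) ∘ fun s' : ℝ ↦ (z, s')) s' ∈ (L : Set (E × ℝ)) := by
    have h5 : ∀ᶠ s' in 𝓝 s, ((z, s') : B × ℝ) ∈ c.source :=
      (by fun_prop : Continuous fun s' : ℝ ↦ (z, s')).continuousAt.preimage_mem_nhds
        (c.open_source.mem_nhds hzs)
    filter_upwards [hG, h5] with s' hs' hs'c using (hc.2 _ hs'c).1 hs'
  have h6 := hLc.mem_of_tendsto (hasDerivAt_iff_tendsto_slope.1 h3.hasDerivAt) ?_
  · exact h6
  · filter_upwards [mem_nhdsWithin_of_mem_nhds h4] with s' hs'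
    rw [slope_def_module]
    exact L.smul_mem _ (L.sub_mem hs' h4.self_of_nhds)

end Product

/-! ### Auxiliary functions of real variables -/

/-- The function `ρ ↦ ρ / √(1 + r² ρ²)`, which embeds `ℝ` onto the interval `|r ρ| < 1`. -/
def squash (r ρ : ℝ) : ℝ := ρ / √(1 + (r * ρ) ^ 2)

theorem contDiff_squash : ContDiff ℝ ∞ fun p : ℝ × ℝ ↦ squash p.1 p.2 := by
  have h : ∀ p : ℝ × ℝ, 1 + (p.1 * p.2) ^ 2 ≠ 0 := fun p ↦ by positivity
  refine contDiff_snd.div (ContDiff.sqrt (by fun_prop) h) fun p ↦ ?_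
  positivity

theorem squash_zero (ρ : ℝ) : squash 0 ρ = ρ := by simp [squash]

theorem abs_mul_squash_lt_one (r ρ : ℝ) : |r * squash r ρ| < 1 := by
  have h : 0 < √(1 + (r * ρ) ^ 2) := by positivity
  rw [squash, ← mul_div_assoc, abs_div, abs_of_pos h, div_lt_one h]
  exact Real.lt_sqrt_of_sq_lt (by rw [sq_abs]; linarith)

theorem exists_hasDerivAt_squash (r ρ : ℝ) : ∃ d, d ≠ 0 ∧ HasDerivAt (squash r) d ρ := by
  have h0 : 0 < 1 + (r * ρ) ^ 2 := by positivity
  have h1 : HasDerivAt (fun ρ ↦ 1 + (r * ρ) ^ 2) (2 * (r * ρ) * r) ρ := by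
    simpa using (((hasDerivAt_id ρ).const_mul r).pow 2).const_add 1
  have h2 := (hasDerivAt_id ρ).div (h1.sqrt h0.ne') (Real.sqrt_pos.2 h0).ne'
  refine ⟨_, ?_, h2⟩
  refine div_ne_zero (fun h ↦ ?_) (by positivity)
  have h3 : √(1 + (r * ρ) ^ 2) ≠ 0 := (Real.sqrt_pos.2 h0).ne'
  have h4 := Real.sq_sqrt h0.le
  simp only [id] at h
  -- the numerator, times the square root, is `1`
  field_simp at h
  rw [mul_pow] at h4
  linarith

/-- A smooth function which agrees with the absolute value for `ε ≤ 2 |y|`. -/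
def smoothAbs (ε y : ℝ) : ℝ := y * (2 * Real.smoothTransition (y / ε + 1 / 2) - 1)

theorem contDiff_smoothAbs (ε : ℝ) : ContDiff ℝ ∞ (smoothAbs ε) := by
  have : ContDiff ℝ ∞ fun y : ℝ ↦ Real.smoothTransition (y / ε + 1 / 2) :=
    Real.smoothTransition.contDiff.comp (by fun_prop)
  unfold smoothAbs
  fun_prop

theorem smoothAbs_of_le {ε y : ℝ} (hε : 0 < ε) (hy : ε / 2 ≤ y) : smoothAbs ε y = y := by
  rw [smoothAbs, Real.smoothTransition.one_of_one_le]
  · ring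
  · have : 1 / 2 ≤ y / ε := by rw [le_div_iff₀ hε]; linarith
    linarith

theorem smoothAbs_of_le_neg {ε y : ℝ} (hε : 0 < ε) (hy : y ≤ -(ε / 2)) : smoothAbs ε y = -y := by
  rw [smoothAbs, Real.smoothTransition.zero_of_nonpos]
  · ring
  · have : y / ε ≤ -(1 / 2) := by rw [div_le_iff₀ hε]; linarith
    linarith

theorem abs_smoothAbs_le (ε y : ℝ) : |smoothAbs ε y| ≤ |y| := by
  rw [smoothAbs, abs_mul]
  refine mul_le_of_le_one_right (abs_nonneg _) (abs_le.2 ⟨?_, ?_⟩)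
  · linarith [Real.smoothTransition.nonneg (y / ε + 1 / 2)]
  · linarith [Real.smoothTransition.le_one (y / ε + 1 / 2)]

theorem abs_deriv_smoothAbs {ε y : ℝ} (hε : 0 < ε) (hy : ε / 2 < |y|) :
    |deriv (smoothAbs ε) y| = 1 := by
  rcases lt_abs.1 hy with h | h
  · have : smoothAbs ε =ᶠ[𝓝 y] id := by
      filter_upwards [lt_mem_nhds h] with x hx using smoothAbs_of_le hε hx.le
    rw [this.deriv_eq, deriv_id, abs_one]
  · have : smoothAbs ε =ᶠ[𝓝 y] fun x ↦ -x := by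
      filter_upwards [gt_mem_nhds (show y < -(ε / 2) by linarith)] with x hx using
        smoothAbs_of_le_neg hε hx.le
    rw [this.deriv_eq, deriv_neg, abs_neg, abs_one]

/-- Rises from `0` to `1` on `[0, 1/3]`, and falls back to `0` on `[2/3, 1]`. -/
def tiltTime (θ : ℝ) : ℝ := Real.smoothTransition (3 * θ) * Real.smoothTransition (3 - 3 * θ)

/-- Rises from `0` to `1` on `[1/3, 2/3]`. -/
def shiftTime (θ : ℝ) : ℝ := Real.smoothTransition (3 * θ - 1)

theorem contDiff_tiltTime : ContDiff ℝ ∞ tiltTime :=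
  (Real.smoothTransition.contDiff.comp (by fun_prop)).mul
    (Real.smoothTransition.contDiff.comp (by fun_prop))

theorem contDiff_shiftTime : ContDiff ℝ ∞ shiftTime :=
  Real.smoothTransition.contDiff.comp (by fun_prop)

theorem tiltTime_zero : tiltTime 0 = 0 := by simp [tiltTime]

theorem tiltTime_one : tiltTime 1 = 0 := by simp [tiltTime]

theorem shiftTime_zero : shiftTime 0 = 0 := Real.smoothTransition.zero_of_nonpos (by norm_num)

theorem shiftTime_one : shiftTime 1 = 1 := Real.smoothTransition.one_of_one_le (by norm_num)

theorem shiftTime_nonneg (θ : ℝ) : 0 ≤ shiftTime θ := Real.smoothTransition.nonneg _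

/-- The shift only takes place while the tilt is complete. -/
theorem shiftTime_or_tiltTime (θ : ℝ) : shiftTime θ = 0 ∨ shiftTime θ = 1 ∨ tiltTime θ = 1 := by
  by_cases h1 : 3 * θ ≤ 1
  · exact .inl (Real.smoothTransition.zero_of_nonpos (by linarith))
  by_cases h2 : 2 ≤ 3 * θ
  · exact .inr (.inl (Real.smoothTransition.one_of_one_le (by linarith)))
  refine .inr (.inr ?_)
  rw [tiltTime, Real.smoothTransition.one_of_one_le (by linarith),
    Real.smoothTransition.one_of_one_le (by linarith), one_mul]

/-- A smooth cut-off function with bounded derivative. -/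
theorem exists_cutoff (b : ℝ) {ε : ℝ} (hε : 0 < ε) :
    ∃ (β : ℝ → ℝ) (C : ℝ), ContDiff ℝ ∞ β ∧ (∀ s, |s - b| ≤ ε → β s = 1) ∧
      (∀ s, 2 * ε ≤ |s - b| → β s = 0) ∧ ∀ s, |deriv β s| ≤ C := by
  let β : ContDiffBump b := ⟨ε, 2 * ε, hε, by linarith⟩
  have hβ : ContDiff ℝ ∞ β := β.contDiff
  obtain ⟨C, hC⟩ := (hβ.continuous_deriv (by simp)).bounded_above_of_compact_support
    β.hasCompactSupport.deriv
  refine ⟨β, C, hβ, fun s hs ↦ β.one_of_mem_closedBall ?_, fun s hs ↦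
    β.zero_of_le_dist ?_, hC⟩
  · rwa [Metric.mem_closedBall, Real.dist_eq]
  · rwa [Real.dist_eq]

/-! ### The folding map -/

section Fold

/-- The value of `e u - w` after squashing, as a function of the parameter `θ` and of the values
`(m, w, u, s)`. -/
def foldRho (e : ℝ) (β : ℝ → ℝ) (r : ℝ × ℝ × ℝ × ℝ × ℝ) : ℝ :=
  squash (tiltTime r.1 * r.2.1 * β r.2.2.2.2) (e * r.2.2.2.1 - r.2.2.1)

/-- The last coordinate of the folding map, as a function of the parameter `θ` and of the values
`(m, w, u, s)`. -/
def foldHeight (e : ℝ) (β : ℝ → ℝ) (ε a b : ℝ) (r : ℝ × ℝ × ℝ × ℝ × ℝ) : ℝ :=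
  b - smoothAbs ε (r.2.2.2.2 - b) - (b - a) * shiftTime r.1 -
    tiltTime r.1 * β r.2.2.2.2 ^ 2 * foldRho e β r

variable {e : ℝ} {β : ℝ → ℝ} {ε a b : ℝ}

theorem contDiff_foldRho (hβ : ContDiff ℝ ∞ β) : ContDiff ℝ ∞ (foldRho e β) := by
  have h1 : ContDiff ℝ ∞ fun r : ℝ × ℝ × ℝ × ℝ × ℝ ↦ tiltTime r.1 :=
    contDiff_tiltTime.comp contDiff_fst
  have h2 : ContDiff ℝ ∞ fun r : ℝ × ℝ × ℝ × ℝ × ℝ ↦ β r.2.2.2.2 := hβ.comp (by fun_prop)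
  exact contDiff_squash.comp (f := fun r : ℝ × ℝ × ℝ × ℝ × ℝ ↦
    (tiltTime r.1 * r.2.1 * β r.2.2.2.2, e * r.2.2.2.1 - r.2.2.1)) (by fun_prop)

theorem contDiff_foldHeight (hβ : ContDiff ℝ ∞ β) : ContDiff ℝ ∞ (foldHeight e β ε a b) := by
  have h1 : ContDiff ℝ ∞ fun r : ℝ × ℝ × ℝ × ℝ × ℝ ↦ tiltTime r.1 :=
    contDiff_tiltTime.comp contDiff_fst
  have h2 : ContDiff ℝ ∞ fun r : ℝ × ℝ × ℝ × ℝ × ℝ ↦ β r.2.2.2.2 := hβ.comp (by fun_prop)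
  have h3 : ContDiff ℝ ∞ fun r : ℝ × ℝ × ℝ × ℝ × ℝ ↦ shiftTime r.1 :=
    contDiff_shiftTime.comp contDiff_fst
  have h4 : ContDiff ℝ ∞ fun r : ℝ × ℝ × ℝ × ℝ × ℝ ↦ smoothAbs ε (r.2.2.2.2 - b) :=
    (contDiff_smoothAbs ε).comp (by fun_prop)
  exact ((contDiff_const.sub h4).sub (contDiff_const.mul h3)).sub
    ((h1.mul (h2.pow 2)).mul (contDiff_foldRho hβ))

theorem differentiableAt_foldRho (hβ : ContDiff ℝ ∞ β) (θ : ℝ) (v : ℝ × ℝ × ℝ × ℝ) :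
    DifferentiableAt ℝ (fun v ↦ foldRho e β (θ, v)) v :=
  (((contDiff_foldRho hβ).comp (f := fun v ↦ (θ, v)) (by fun_prop)).differentiable (by simp)) v

theorem fderiv_foldRho_ne_zero (hβ : ContDiff ℝ ∞ β) (he : e ≠ 0) (θ : ℝ)
    (v : ℝ × ℝ × ℝ × ℝ) : fderiv ℝ (fun v ↦ foldRho e β (θ, v)) v (0, 0, 1, 0) ≠ 0 := by
  obtain ⟨m, w, u, s⟩ := v
  have h1 : HasDerivAt (fun u : ℝ ↦ ((m, w, u, s) : ℝ × ℝ × ℝ × ℝ)) (0, 0, 1, 0) u :=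
    (hasDerivAt_const u m).prodMk ((hasDerivAt_const u w).prodMk
      ((hasDerivAt_id u).prodMk (hasDerivAt_const u s)))
  have h2 := (differentiableAt_foldRho (e := e) hβ θ (m, w, u, s)).hasFDerivAt.comp_hasDerivAt u h1
  obtain ⟨d, hd, h3⟩ := exists_hasDerivAt_squash (tiltTime θ * m * β s) (e * u - w)
  have h4 : HasDerivAt (fun u : ℝ ↦ e * u - w) e u := by
    simpa using ((hasDerivAt_id u).const_mul e).sub_const w
  rw [h2.unique (h3.comp u h4)]
  exact mul_ne_zero hd he

theorem fderiv_foldHeight (hβ : ContDiff ℝ ∞ β) (θ : ℝ) (v y : ℝ × ℝ × ℝ × ℝ) :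
    fderiv ℝ (fun v ↦ foldHeight e β ε a b (θ, v)) v y =
      (-deriv (smoothAbs ε) (v.2.2.2 - b) -
          2 * tiltTime θ * β v.2.2.2 * deriv β v.2.2.2 * foldRho e β (θ, v)) * y.2.2.2 -
        tiltTime θ * β v.2.2.2 ^ 2 * fderiv ℝ (fun v ↦ foldRho e β (θ, v)) v y := by
  let π : ℝ × ℝ × ℝ × ℝ →L[ℝ] ℝ := (ContinuousLinearMap.snd ℝ ℝ ℝ).comp
    ((ContinuousLinearMap.snd ℝ ℝ (ℝ × ℝ)).comp (ContinuousLinearMap.snd ℝ ℝ (ℝ × ℝ × ℝ)))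
  have h1 : HasFDerivAt (fun v : ℝ × ℝ × ℝ × ℝ ↦ v.2.2.2) π v := π.hasFDerivAt
  have h2 := ((hβ.differentiable (by simp)) v.2.2.2).hasDerivAt.comp_hasFDerivAt v h1
  have h3 := (((contDiff_smoothAbs ε).differentiable (by simp))
    (v.2.2.2 - b)).hasDerivAt.comp_hasFDerivAt v (h1.sub_const b)
  have h4 := (differentiableAt_foldRho (e := e) hβ θ v).hasFDerivAt
  have h5 := (((h3.const_sub b).sub_const ((b - a) * shiftTime θ)).fun_sub
    (((h2.pow 2).const_mul (tiltTime θ)).fun_mul h4))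
  have h6 : HasFDerivAt (fun v ↦ foldHeight e β ε a b (θ, v)) _ v := h5
  rw [h6.fderiv]
  simp [π]
  ring

variable {F : Type*} [NormedAddCommGroup F] [NormedSpace ℝ F] [FiniteDimensional ℝ F]
  {HN : Type*} [TopologicalSpace HN] {J : ModelWithCorners ℝ F HN}
  {N : Type*} [TopologicalSpace N] [ChartedSpace HN N] {m w : N → ℝ}

/-- The values `(m, w, u, s)` at a point of `(N × ℝ) × ℝ`. -/
def foldArg (m w : N → ℝ) (p : (N × ℝ) × ℝ) : ℝ × ℝ × ℝ × ℝ := (m p.1.1, w p.1.1, p.1.2, p.2)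

variable (e β ε a b m w) in
/-- A family of maps folding `(N × ℝ) × ℝ` along the hyperplane `s = b`. At `θ = 0` it is
`s ↦ b - |s - b|` up to a smoothing near `s = b`, and at `θ = 1` it is followed by the translation
by `a - b`. In between the fold is made along the graph of the function `b - (e u - w)` instead,
with `u` squashed beforehand so that this graph stays close to the hyperplane `s = b`. -/
def foldMap (r : ℝ × ((N × ℝ) × ℝ)) : (N × ℝ) × ℝ :=
  ((r.2.1.1, (w r.2.1.1 + foldRho e β (r.1, foldArg m w r.2)) / e),
    foldHeight e β ε a b (r.1, foldArg m w r.2))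

theorem contMDiff_foldArg (hm : ContMDiff J 𝓘(ℝ, ℝ) ∞ m) (hw : ContMDiff J 𝓘(ℝ, ℝ) ∞ w) :
    ContMDiff ((J.prod 𝓘(ℝ, ℝ)).prod 𝓘(ℝ, ℝ)) 𝓘(ℝ, ℝ × ℝ × ℝ × ℝ) ∞ (foldArg m w) :=
  (hm.comp (contMDiff_fst.comp contMDiff_fst)).prodMk_space
    ((hw.comp (contMDiff_fst.comp contMDiff_fst)).prodMk_space
      ((contMDiff_snd.comp contMDiff_fst).prodMk_space contMDiff_snd))

theorem contMDiff_foldMap (hβ : ContDiff ℝ ∞ β) (hm : ContMDiff J 𝓘(ℝ, ℝ) ∞ m)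
    (hw : ContMDiff J 𝓘(ℝ, ℝ) ∞ w) :
    ContMDiff (𝓘(ℝ, ℝ).prod ((J.prod 𝓘(ℝ, ℝ)).prod 𝓘(ℝ, ℝ))) ((J.prod 𝓘(ℝ, ℝ)).prod 𝓘(ℝ, ℝ)) ∞
      (foldMap e β ε a b m w) := by
  have hQ : ContMDiff (𝓘(ℝ, ℝ).prod ((J.prod 𝓘(ℝ, ℝ)).prod 𝓘(ℝ, ℝ))) 𝓘(ℝ, ℝ × ℝ × ℝ × ℝ × ℝ) ∞
      fun r : ℝ × ((N × ℝ) × ℝ) ↦ (r.1, foldArg m w r.2) :=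
    contMDiff_fst.prodMk_space ((contMDiff_foldArg hm hw).comp contMDiff_snd)
  have hx : ContMDiff (𝓘(ℝ, ℝ).prod ((J.prod 𝓘(ℝ, ℝ)).prod 𝓘(ℝ, ℝ))) J ∞
      fun r : ℝ × ((N × ℝ) × ℝ) ↦ r.2.1.1 :=
    contMDiff_fst.comp (contMDiff_fst.comp contMDiff_snd)
  have hu : ContMDiff (𝓘(ℝ, ℝ).prod ((J.prod 𝓘(ℝ, ℝ)).prod 𝓘(ℝ, ℝ))) 𝓘(ℝ, ℝ) ∞
      fun r : ℝ × ((N × ℝ) × ℝ) ↦ (w r.2.1.1 + foldRho e β (r.1, foldArg m w r.2)) / e :=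
    ((hw.comp hx).add ((contDiff_foldRho hβ).contMDiff.comp hQ)).div_const e
  exact (hx.prodMk hu).prodMk ((contDiff_foldHeight hβ).contMDiff.comp hQ)

/-- The image of the differential of the folding map: it contains vectors with arbitrary `x`- and
`u`-components, and if `A ≠ 0` also with arbitrary `s`-component. -/
theorem exists_mfderiv_foldMap_eq (hβ : ContDiff ℝ ∞ β) (he : e ≠ 0)
    (hm : ContMDiff J 𝓘(ℝ, ℝ) ∞ m) (hw : ContMDiff J 𝓘(ℝ, ℝ) ∞ w) (θ : ℝ) (p : (N × ℝ) × ℝ)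
    (z : F × ℝ) (σ : ℝ) :
    ∃ ξ : (F × ℝ) × ℝ, mfderiv ((J.prod 𝓘(ℝ, ℝ)).prod 𝓘(ℝ, ℝ)) ((J.prod 𝓘(ℝ, ℝ)).prod 𝓘(ℝ, ℝ))
        (fun p ↦ foldMap e β ε a b m w (θ, p)) p ξ =
      ((z, (-deriv (smoothAbs ε) (p.2 - b) - 2 * tiltTime θ * β p.2 * deriv β p.2 *
          foldRho e β (θ, foldArg m w p)) * σ -
        tiltTime θ * β p.2 ^ 2 * (e * z.2 - dAt J w p.1.1 z.1)) : (F × ℝ) × ℝ) := by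
  obtain ⟨zx, zu⟩ := z
  set v := foldArg m w p with hv
  set D := fderiv ℝ (fun v ↦ foldRho e β (θ, v)) v with hD
  have hne := fderiv_foldRho_ne_zero (e := e) hβ he θ v
  have hmd := (hm.mdifferentiable (by simp)) p.1.1
  have hwd := (hw.mdifferentiable (by simp)) p.1.1
  have hQ := ((contMDiff_foldArg hm hw).mdifferentiable (by simp)) p
  set η : ℝ × ℝ × ℝ × ℝ := (dAt J m p.1.1 zx, dAt J w p.1.1 zx, 0, σ) with hη
  set ξu : ℝ := (e * zu - dAt J w p.1.1 zx - D η) / D (0, 0, 1, 0) with hξu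
  set ξ : (F × ℝ) × ℝ := ((zx, ξu), σ) with hξ
  have hcomp : ∀ {Φ : ℝ × ℝ × ℝ × ℝ → ℝ}, DifferentiableAt ℝ Φ v →
      dAt ((J.prod 𝓘(ℝ, ℝ)).prod 𝓘(ℝ, ℝ)) (fun p ↦ Φ (foldArg m w p)) p ξ =
        fderiv ℝ Φ v (dAt ((J.prod 𝓘(ℝ, ℝ)).prod 𝓘(ℝ, ℝ)) (foldArg m w) p ξ) := fun hΦ ↦
    DFunLike.congr_fun (hΦ.hasFDerivAt.hasMFDerivAt.comp p hQ.hasMFDerivAt).mfderiv ξ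
  have hπ : ∀ π : ℝ × ℝ × ℝ × ℝ →L[ℝ] ℝ,
      π (dAt ((J.prod 𝓘(ℝ, ℝ)).prod 𝓘(ℝ, ℝ)) (foldArg m w) p ξ) =
        dAt ((J.prod 𝓘(ℝ, ℝ)).prod 𝓘(ℝ, ℝ)) (fun p ↦ π (foldArg m w p)) p ξ := fun π ↦ by
    rw [hcomp π.differentiableAt, π.fderiv]
  have hQξ : dAt ((J.prod 𝓘(ℝ, ℝ)).prod 𝓘(ℝ, ℝ)) (foldArg m w) p ξ =
      (dAt J m p.1.1 zx, dAt J w p.1.1 zx, ξu, σ) := by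
    let π₁ := ContinuousLinearMap.snd ℝ ℝ (ℝ × ℝ × ℝ)
    let π₂ := (ContinuousLinearMap.snd ℝ ℝ (ℝ × ℝ)).comp π₁
    refine Prod.ext ?_ (Prod.ext ?_ (Prod.ext ?_ ?_))
    · exact (hπ (ContinuousLinearMap.fst ℝ ℝ (ℝ × ℝ × ℝ))).trans (dAt_comp_fst_fst hmd ξ)
    · exact (hπ ((ContinuousLinearMap.fst ℝ ℝ (ℝ × ℝ)).comp π₁)).trans (dAt_comp_fst_fst hwd ξ)
    · exact (hπ ((ContinuousLinearMap.fst ℝ ℝ ℝ).comp π₂)).trans (dAt_fst_snd p ξ)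
    · exact (hπ ((ContinuousLinearMap.snd ℝ ℝ ℝ).comp π₂)).trans (dAt_snd p ξ)
  have hDξ : D (dAt ((J.prod 𝓘(ℝ, ℝ)).prod 𝓘(ℝ, ℝ)) (foldArg m w) p ξ) =
      e * zu - dAt J w p.1.1 zx := by
    have h1 : ((dAt J m p.1.1 zx, dAt J w p.1.1 zx, ξu, σ) : ℝ × ℝ × ℝ × ℝ) =
        η + ξu • (0, 0, 1, 0) := by simp [hη]
    rw [hQξ, h1, map_add, map_smul, smul_eq_mul, hξu, div_mul_cancel₀ _ hne]
    ring
  have hf : MDifferentiableAt ((J.prod 𝓘(ℝ, ℝ)).prod 𝓘(ℝ, ℝ)) ((J.prod 𝓘(ℝ, ℝ)).prod 𝓘(ℝ, ℝ))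
      (fun p ↦ foldMap e β ε a b m w (θ, p)) p :=
    (((contMDiff_foldMap hβ hm hw).comp (contMDiff_const.prodMk contMDiff_id)).mdifferentiable
      (by simp)) p
  set f := fun p ↦ foldMap e β ε a b m w (θ, p) with hfdef
  set df : (F × ℝ) × ℝ := mfderiv ((J.prod 𝓘(ℝ, ℝ)).prod 𝓘(ℝ, ℝ))
    ((J.prod 𝓘(ℝ, ℝ)).prod 𝓘(ℝ, ℝ)) f p ξ with hdf
  have hs : df.2 = dAt ((J.prod 𝓘(ℝ, ℝ)).prod 𝓘(ℝ, ℝ)) (fun p ↦ (f p).2) p ξ := by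
    have h1 : HasMFDerivAt ((J.prod 𝓘(ℝ, ℝ)).prod 𝓘(ℝ, ℝ)) 𝓘(ℝ, ℝ)
      (fun q : (N × ℝ) × ℝ ↦ q.2) (f p) _ := hasMFDerivAt_snd (f p)
    exact (DFunLike.congr_fun (h1.comp p hf.hasMFDerivAt).mfderiv ξ).symm
  have hu : df.1.2 = dAt ((J.prod 𝓘(ℝ, ℝ)).prod 𝓘(ℝ, ℝ)) (fun p ↦ (f p).1.2) p ξ := by
    have h1 : HasMFDerivAt ((J.prod 𝓘(ℝ, ℝ)).prod 𝓘(ℝ, ℝ)) 𝓘(ℝ, ℝ)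
      (fun q : (N × ℝ) × ℝ ↦ q.1.2) (f p) _ :=
      (hasMFDerivAt_snd (f p).1).comp (f p) (hasMFDerivAt_fst (f p))
    exact (DFunLike.congr_fun (h1.comp p hf.hasMFDerivAt).mfderiv ξ).symm
  have hx : df.1.1 = zx := by
    have h1 : HasMFDerivAt ((J.prod 𝓘(ℝ, ℝ)).prod 𝓘(ℝ, ℝ)) J
      (fun q : (N × ℝ) × ℝ ↦ q.1.1) (f p) _ :=
      (hasMFDerivAt_fst (f p).1).comp (f p) (hasMFDerivAt_fst (f p))
    have h2 : HasMFDerivAt ((J.prod 𝓘(ℝ, ℝ)).prod 𝓘(ℝ, ℝ)) J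
      (fun q : (N × ℝ) × ℝ ↦ q.1.1) p _ :=
      (hasMFDerivAt_fst p.1).comp p (hasMFDerivAt_fst p)
    have h3 := h1.comp p hf.hasMFDerivAt
    exact DFunLike.congr_fun (hasMFDerivAt_unique h3 h2) ξ
  refine ⟨ξ, Prod.ext (Prod.ext hx ?_) ?_⟩
  · refine hu.trans ?_
    let π : ℝ × ℝ × ℝ × ℝ →L[ℝ] ℝ := (ContinuousLinearMap.fst ℝ ℝ (ℝ × ℝ)).comp
      (ContinuousLinearMap.snd ℝ ℝ (ℝ × ℝ × ℝ))
    have h1 : HasFDerivAt (fun v : ℝ × ℝ × ℝ × ℝ ↦ e⁻¹ * (v.2.1 + foldRho e β (θ, v)))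
        (e⁻¹ • (π + D)) v :=
      ((π.hasFDerivAt (x := v)).add (differentiableAt_foldRho hβ θ v).hasFDerivAt).const_mul e⁻¹
    have h2 : (fun p ↦ (f p).1.2) = fun p ↦ e⁻¹ * ((foldArg m w p).2.1 +
        foldRho e β (θ, foldArg m w p)) := by
      funext p
      simp only [hfdef, foldMap, foldArg]
      rw [div_eq_inv_mul]
    rw [h2, hcomp h1.differentiableAt, h1.fderiv, smul_apply, add_apply, hDξ, hQξ]
    simp only [π, ContinuousLinearMap.comp_apply, ContinuousLinearMap.coe_fst',
      ContinuousLinearMap.coe_snd', smul_eq_mul]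
    field_simp
    ring
  · refine hs.trans ?_
    have h1 := hcomp (((contDiff_foldHeight (e := e) (ε := ε) (a := a) (b := b) hβ).comp
      (f := fun v ↦ (θ, v)) (by fun_prop)).differentiable (by simp) v)
    refine h1.trans ?_
    refine (fderiv_foldHeight hβ θ v _).trans ?_
    rw [← hD, hDξ, hQξ]
    rfl

end Fold

/-! ### Transversality of the folding map -/

section FoldFamily

variable {F : Type*} [NormedAddCommGroup F] [NormedSpace ℝ F] [FiniteDimensional ℝ F]
  {HN : Type*} [TopologicalSpace HN] {J : ModelWithCorners ℝ F HN}
  {N : Type*} [TopologicalSpace N] [ChartedSpace HN N] {k : ℕ}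

theorem dAt_level {e : ℝ} {w : N → ℝ} (hw : ContMDiff J 𝓘(ℝ, ℝ) ∞ w) (q : (N × ℝ) × ℝ)
    (η : (F × ℝ) × ℝ) : dAt ((J.prod 𝓘(ℝ, ℝ)).prod 𝓘(ℝ, ℝ)) (level e w) q η =
      η.2 + (e * η.1.2 - dAt J w q.1.1 η.1.1) := by
  have h1 : MDifferentiableAt ((J.prod 𝓘(ℝ, ℝ)).prod 𝓘(ℝ, ℝ)) 𝓘(ℝ, ℝ)
      (fun p : (N × ℝ) × ℝ ↦ w p.1.1) q :=
    ((hw.comp (contMDiff_fst.comp contMDiff_fst)).mdifferentiable (by simp)) q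
  have h2 : MDifferentiableAt ((J.prod 𝓘(ℝ, ℝ)).prod 𝓘(ℝ, ℝ)) 𝓘(ℝ, ℝ)
      (fun p : (N × ℝ) × ℝ ↦ p.1.2) q :=
    ((contMDiff_snd.comp contMDiff_fst : ContMDiff _ _ ∞ _).mdifferentiable (by simp)) q
  have h3 : MDifferentiableAt ((J.prod 𝓘(ℝ, ℝ)).prod 𝓘(ℝ, ℝ)) 𝓘(ℝ, ℝ)
      (fun p : (N × ℝ) × ℝ ↦ p.2) q := mdifferentiableAt_snd
  have h4 := h3.hasMFDerivAt.add ((h2.hasMFDerivAt.const_smul e).sub h1.hasMFDerivAt)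
  have h5 : dAt ((J.prod 𝓘(ℝ, ℝ)).prod 𝓘(ℝ, ℝ)) (level e w) q η =
      dAt ((J.prod 𝓘(ℝ, ℝ)).prod 𝓘(ℝ, ℝ)) (fun p : (N × ℝ) × ℝ ↦ p.2) q η +
      (e * dAt ((J.prod 𝓘(ℝ, ℝ)).prod 𝓘(ℝ, ℝ)) (fun p : (N × ℝ) × ℝ ↦ p.1.2) q η -
        dAt ((J.prod 𝓘(ℝ, ℝ)).prod 𝓘(ℝ, ℝ)) (fun p : (N × ℝ) × ℝ ↦ w p.1.1) q η) :=
    DFunLike.congr_fun h4.mfderiv η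
  rw [h5, dAt_snd, dAt_fst_snd, dAt_comp_fst_fst ((hw.mdifferentiable (by simp)) _)]

variable [J.Boundaryless] [IsManifold J ∞ N] {e : ℝ} {w m : N → ℝ} {β : ℝ → ℝ} {ε a b : ℝ}

/-- The folding map is transverse to `G`. Its differential is onto unless `A = 0`, which only
happens close to `s = b`. There the image of the differential is the kernel of the form
`τ = ds + t d(e u - w)`. If the image point lies where `G` is of product form, then `∂/∂s` is
tangent to `G`, and `τ` does not vanish on it; else the tilt is complete, so that `τ` is the
differential of the level function, and this function is regular at the image point.

As `t β m` times the squashed value of `e u - w` is less than `1`, the bound `2 |β'| ≤ m` excludes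
`A = 0` where `smoothAbs` has slope `±1`, and the bound `ε⁻¹ ≤ m` keeps the image of the crease
within `2 ε` of its place without tilt. -/
theorem isSmoothFamily_foldMap (G : PsiCyl (N × ℝ) (J.prod 𝓘(ℝ, ℝ)) k) {ε₀ : ℝ} (hε : 0 < ε)
    (hεε₀ : 2 * ε ≤ ε₀)
    (hA : ∀ z, ∀ s < a + ε₀, ∀ s' < a + ε₀, (z, s) ∈ G.carrier → (z, s') ∈ G.carrier)
    (hB : ∀ z, ∀ s > b - ε₀, ∀ s' > b - ε₀, (z, s) ∈ G.carrier → (z, s') ∈ G.carrier)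
    (he : e ≠ 0) (hw : ContMDiff J 𝓘(ℝ, ℝ) ∞ w) (hm : ContMDiff J 𝓘(ℝ, ℝ) ∞ m)
    (hβ : ContDiff ℝ ∞ β) (hβ1 : ∀ s, |s - b| ≤ ε → β s = 1)
    (hm1 : ∀ x, 1 ≤ m x) (hmε : ∀ x, ε⁻¹ ≤ m x) (hmβ : ∀ x s, 2 * |deriv β s| ≤ m x)
    (hreg : ∀ q ∈ G.carrier, q.2 ∈ Set.Icc a b → |e * q.1.2 - w q.1.1| * m q.1.1 < 1 →
      IsRegularAt J k G.carrier (level e w) q) :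
    IsSmoothFamily ((J.prod 𝓘(ℝ, ℝ)).prod 𝓘(ℝ, ℝ)) k
      (foldMap e β ε a b m w ⁻¹' G.carrier) := by
  refine isSmoothFamily_preimage (contMDiff_foldMap hβ hm hw) fun θ p hq ↦ ?_
  have hf : MDifferentiableAt ((J.prod 𝓘(ℝ, ℝ)).prod 𝓘(ℝ, ℝ)) ((J.prod 𝓘(ℝ, ℝ)).prod 𝓘(ℝ, ℝ))
      (fun p ↦ foldMap e β ε a b m w (θ, p)) p :=
    (((contMDiff_foldMap hβ hm hw).comp (contMDiff_const.prodMk contMDiff_id)).mdifferentiable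
      (by simp)) p
  have himage := exists_mfderiv_foldMap_eq (ε := ε) (a := a) (b := b) hβ he hm hw θ p
  set q := foldMap e β ε a b m w (θ, p) with hqdef
  set κ := foldRho e β (θ, foldArg m w p) with hκ
  set t := tiltTime θ with ht
  set A := -deriv (smoothAbs ε) (p.2 - b) - 2 * t * β p.2 * deriv β p.2 * κ with hAdef
  set τ : (F × ℝ) × ℝ → ℝ := fun z ↦ z.2 + t * β p.2 ^ 2 * (e * z.1.2 - dAt J w p.1.1 z.1.1)
    with hτ
  have hτ_sub : ∀ z ν c, τ (z - c • ν) = τ z - c * τ ν := by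
    intro z ν c
    simp only [hτ, Prod.fst_sub, Prod.snd_sub, Prod.smul_fst, Prod.smul_snd, map_sub, map_smul,
      smul_eq_mul]
    ring
  -- a chart in which the differential of the folding map is onto modulo `L`
  have hkey : ∃ (c : OpenPartialHomeomorph ((N × ℝ) × ℝ) (ModelProd (ModelProd HN ℝ) ℝ))
      (L : Submodule ℝ ((F × ℝ) × ℝ)), q ∈ c.source ∧
      IsSliceChart ((J.prod 𝓘(ℝ, ℝ)).prod 𝓘(ℝ, ℝ)) G.carrier c L ∧ Module.finrank ℝ L = k ∧
      (A ≠ 0 ∨ ∃ ν, dAt ((J.prod 𝓘(ℝ, ℝ)).prod 𝓘(ℝ, ℝ))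
        (c.extend ((J.prod 𝓘(ℝ, ℝ)).prod 𝓘(ℝ, ℝ))) q ν ∈ L ∧ τ ν ≠ 0) := by
    obtain ⟨c, L, hqc, hcL, hLk⟩ := G.isSubmanifold q hq
    by_cases hA0 : A = 0
    swap
    · exact ⟨c, L, hqc, hcL, hLk, .inl hA0⟩
    have hm0 : 0 < m p.1.1 := one_pos.trans_le (hm1 _)
    have hκ1 : |t * β p.2 * κ| * m p.1.1 < 1 := by
      have := abs_mul_squash_lt_one (t * m p.1.1 * β p.2) (e * p.1.2 - w p.1.1)
      have h2 : κ = squash (t * m p.1.1 * β p.2) (e * p.1.2 - w p.1.1) := rfl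
      rw [← h2, show t * m p.1.1 * β p.2 * κ = t * β p.2 * κ * m p.1.1 by ring, abs_mul,
        abs_of_pos hm0] at this
      exact this
    have hy : |p.2 - b| ≤ ε / 2 := by
      by_contra! hlt
      have h1 := abs_deriv_smoothAbs hε hlt
      have h2 : deriv (smoothAbs ε) (p.2 - b) = -(2 * deriv β p.2 * (t * β p.2 * κ)) := by
        rw [hAdef] at hA0; linarith
      rw [h2, abs_neg, abs_mul, abs_mul, abs_two] at h1
      have h3 := mul_le_mul_of_nonneg_right (hmβ p.1.1 p.2) (abs_nonneg (t * β p.2 * κ))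
      linarith
    have hβp : β p.2 = 1 := hβ1 _ (by linarith)
    have hQ : |smoothAbs ε (p.2 - b)| ≤ ε / 2 := (abs_smoothAbs_le _ _).trans hy
    rw [hβp, mul_one] at hκ1
    have hκε : |t * κ| < ε := by
      have h1 := mul_le_mul_of_nonneg_left (hmε p.1.1) (abs_nonneg (t * κ))
      have h2 : |t * κ| * ε⁻¹ < 1 := h1.trans_lt hκ1
      rwa [← div_eq_mul_inv, div_lt_one hε] at h2
    have hF : q.2 = b - smoothAbs ε (p.2 - b) - (b - a) * shiftTime θ - t * κ := by
      have : q.2 = b - smoothAbs ε (p.2 - b) - (b - a) * shiftTime θ - t * β p.2 ^ 2 * κ := rfl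
      rw [this, hβp]; ring
    rw [abs_le] at hQ
    rw [abs_lt] at hκε
    -- where `G` is of product form
    have hprod : (∀ᶠ s' in 𝓝 q.2, (q.1, s') ∈ G.carrier) → ∃ ν,
        dAt ((J.prod 𝓘(ℝ, ℝ)).prod 𝓘(ℝ, ℝ)) (c.extend ((J.prod 𝓘(ℝ, ℝ)).prod 𝓘(ℝ, ℝ))) q ν ∈ L ∧
          τ ν ≠ 0 := fun hev ↦
      ⟨(0, 1), dAt_extend_mem_of_eventually hcL (z := q.1) (s := q.2) hqc hev, by simp [hτ]⟩
    have hAev : q.2 < a + ε₀ → ∀ᶠ s' in 𝓝 q.2, (q.1, s') ∈ G.carrier := fun h ↦ by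
      filter_upwards [gt_mem_nhds h] with s' hs' using hA q.1 q.2 h s' hs' hq
    have hBev : q.2 > b - ε₀ → ∀ᶠ s' in 𝓝 q.2, (q.1, s') ∈ G.carrier := fun h ↦ by
      filter_upwards [lt_mem_nhds h] with s' hs' using hB q.1 q.2 h s' hs' hq
    by_cases h1 : q.2 < a + ε₀
    · exact ⟨c, L, hqc, hcL, hLk, .inr (hprod (hAev h1))⟩
    by_cases h2 : q.2 > b - ε₀
    · exact ⟨c, L, hqc, hcL, hLk, .inr (hprod (hBev h2))⟩
    have ht1 : t = 1 := by
      rcases shiftTime_or_tiltTime θ with h | h | h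
      · rw [h] at hF; exact absurd (show q.2 > b - ε₀ by linarith) h2
      · rw [h] at hF; exact absurd (show q.2 < a + ε₀ by linarith) h1
      · exact h
    have hρ : e * q.1.2 - w q.1.1 = κ := by
      have : q.1.2 = (w q.1.1 + κ) / e := rfl
      rw [this]; field_simp; ring
    obtain ⟨c, L, hqc, hcL, hLk, ν, hνL, hν⟩ := hreg q hq
      ⟨by linarith, by linarith⟩ (by rw [hρ]; rwa [ht1, one_mul] at hκ1)
    refine ⟨c, L, hqc, hcL, hLk, .inr ⟨ν, hνL, ?_⟩⟩
    rw [dAt_level hw] at hν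
    have hν' : ν.2 + (e * ν.1.2 - dAt J w p.1.1 ν.1.1) ≠ 0 := hν
    simpa [hτ, ht1, hβp] using hν'
  obtain ⟨c, L, hqc, hcL, hLk, hcase⟩ := hkey
  refine ⟨c, L, hqc, hcL, hLk, fun y ↦ ?_⟩
  have hφ := isSmoothChart_chartE hcL.1
  set D := dAt ((J.prod 𝓘(ℝ, ℝ)).prod 𝓘(ℝ, ℝ)) (c.extend ((J.prod 𝓘(ℝ, ℝ)).prod 𝓘(ℝ, ℝ))) q
    with hD
  have hchain : ∀ ξ, dAt ((J.prod 𝓘(ℝ, ℝ)).prod 𝓘(ℝ, ℝ))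
      (fun p ↦ c.extend ((J.prod 𝓘(ℝ, ℝ)).prod 𝓘(ℝ, ℝ)) (foldMap e β ε a b m w (θ, p))) p ξ =
      D (mfderiv ((J.prod 𝓘(ℝ, ℝ)).prod 𝓘(ℝ, ℝ)) ((J.prod 𝓘(ℝ, ℝ)).prod 𝓘(ℝ, ℝ))
        (fun p ↦ foldMap e β ε a b m w (θ, p)) p ξ) := fun ξ ↦
    DFunLike.congr_fun (((hφ.contMDiffAt (p := q) hqc).mdifferentiableAt
      (by simp)).hasMFDerivAt.comp p hf.hasMFDerivAt).mfderiv ξ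
  obtain ⟨z, hz⟩ : ∃ z, D z = y := hφ.dAt_surjective (p := q) hqc y
  rcases hcase with hA0 | ⟨ν, hνL, hν⟩
  · obtain ⟨ξ, hξ⟩ := himage z.1 (τ z / A)
    refine ⟨ξ, ?_⟩
    rw [hchain, hξ, mul_div_cancel₀ _ hA0]
    have : ((z.1, τ z - t * β p.2 ^ 2 * (e * z.1.2 - dAt J w p.1.1 z.1.1)) : (F × ℝ) × ℝ) = z :=
      Prod.ext rfl (by simp [hτ])
    rw [this, hz, sub_self]
    exact L.zero_mem
  · set z' := z - (τ z / τ ν) • ν with hz'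
    have hτz' : τ z' = 0 := by rw [hz', hτ_sub, div_mul_cancel₀ _ hν, sub_self]
    obtain ⟨ξ, hξ⟩ := himage z'.1 0
    refine ⟨ξ, ?_⟩
    rw [hchain, hξ, mul_zero, zero_sub]
    have : ((z'.1, -(t * β p.2 ^ 2 * (e * z'.1.2 - dAt J w p.1.1 z'.1.1))) : (F × ℝ) × ℝ) = z' :=
      Prod.ext rfl (neg_eq_of_add_eq_zero_left hτz')
    rw [this, hz', map_sub, map_smul, hz, sub_sub_cancel_left]
    exact L.neg_mem (L.smul_mem _ hνL)

/-- The folding family: from the double of `G` at `0` to a submanifold of product form at `1`,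
constant for `s < a + ε` and for `s > 2 b - a - ε`. -/
theorem exists_isSmoothFamily_fold [T2Space N] [SecondCountableTopology N] [SigmaCompactSpace N]
    [LocallyCompactSpace N] (G : PsiCyl (N × ℝ) (J.prod 𝓘(ℝ, ℝ)) k) (hab : a ≤ b)
    (hG : IsBordism a b G) :
    ∃ ε > 0, IsOrthogonalOn G.carrier (Set.Iio (a + ε)) ∧
      IsOrthogonalOn G.carrier (Set.Ioi (b - ε)) ∧
      ∃ 𝒢, IsSmoothFamily ((J.prod 𝓘(ℝ, ℝ)).prod 𝓘(ℝ, ℝ)) k 𝒢 ∧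
        (∀ z s, ((0 : ℝ), (z, s)) ∈ 𝒢 ↔ (z, b - |s - b|) ∈ G.carrier) ∧
        (∀ z s, ((1 : ℝ), (z, s)) ∈ 𝒢 ↔ (z, a) ∈ G.carrier) ∧
        (∀ θ z, ∀ s < a + ε, (θ, (z, s)) ∈ 𝒢 ↔ (z, s) ∈ G.carrier) ∧
        ∀ θ z, ∀ s > 2 * b - a - ε, (θ, (z, s)) ∈ 𝒢 ↔ (z, 2 * b - s) ∈ G.carrier := by
  obtain ⟨ε₁, hε₁, hA₁, hB₁⟩ := hG
  rw [isOrthogonalOn_iff isOpen_Iio] at hA₁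
  rw [isOrthogonalOn_iff isOpen_Ioi] at hB₁
  simp only [Set.mem_Iio, Set.mem_Ioi] at hA₁ hB₁
  rcases hab.eq_or_lt with rfl | hab
  · -- in this case `G` is of product form
    have hall : ∀ z s s', (z, s) ∈ G.carrier → (z, s') ∈ G.carrier := by
      have h1 : ∀ z s, (z, s) ∈ G.carrier → (z, a) ∈ G.carrier := fun z s h ↦ by
        rcases lt_or_ge s (a + ε₁) with h' | h'
        · exact hA₁ z s h' a (by linarith) h
        · exact hB₁ z s (by linarith) a (by linarith) h
      intro z s s' h
      rcases lt_or_ge s' (a + ε₁) with h' | h'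
      · exact hA₁ z a (by linarith) s' h' (h1 z s h)
      · exact hB₁ z a (by linarith) s' (by linarith) (h1 z s h)
    refine ⟨ε₁, hε₁, (isOrthogonalOn_iff isOpen_Iio).2 fun z s _ s' _ ↦ hall z s s',
      (isOrthogonalOn_iff isOpen_Ioi).2 fun z s _ s' _ ↦ hall z s s', Prod.snd ⁻¹' G.carrier,
      isSmoothFamily_const G, fun z s ↦ ⟨hall _ _ _, hall _ _ _⟩,
      fun z s ↦ ⟨hall _ _ _, hall _ _ _⟩, fun _ z s _ ↦ Iff.rfl,
      fun _ z s _ ↦ ⟨hall _ _ _, hall _ _ _⟩⟩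
  set ε₀ := min ε₁ (b - a) with hε₀def
  have hε₀ : 0 < ε₀ := lt_min hε₁ (sub_pos.2 hab)
  have hε₀1 : ε₀ ≤ ε₁ := min_le_left _ _
  have hε₀2 : ε₀ ≤ b - a := min_le_right _ _
  have hA : ∀ z, ∀ s < a + ε₀, ∀ s' < a + ε₀, (z, s) ∈ G.carrier → (z, s') ∈ G.carrier :=
    fun z s hs s' hs' ↦ hA₁ z s (by linarith) s' (by linarith)
  have hB : ∀ z, ∀ s > b - ε₀, ∀ s' > b - ε₀, (z, s) ∈ G.carrier → (z, s') ∈ G.carrier :=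
    fun z s hs s' hs' ↦ hB₁ z s (by linarith) s' (by linarith)
  obtain ⟨ε, hε, hεε₀⟩ : ∃ ε > 0, ε₀ = 10 * ε := ⟨ε₀ / 10, by positivity, by ring⟩
  obtain ⟨e, w, he, hw, hreg⟩ := exists_isRegularAt_of_mem G
  obtain ⟨β, C, hβ, hβ1, hβ0, hβC⟩ := exists_cutoff b hε
  obtain ⟨m, hm, hmc, hmreg⟩ := exists_isRegularAt_of_abs_mul_lt_one G he hw hreg a b
    (max 1 (max ε⁻¹ (2 * C)))
  -- where the tilt or the cut-off function vanishes, only the last coordinate changes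
  have hval : ∀ θ z s, tiltTime θ * β s = 0 → foldMap e β ε a b m w (θ, (z, s)) =
      (z, b - smoothAbs ε (s - b) - (b - a) * shiftTime θ) := by
    intro θ z s h
    have h1 : foldRho e β (θ, foldArg m w (z, s)) = e * z.2 - w z.1 := by
      have : tiltTime θ * m z.1 * β s = 0 := by rw [mul_right_comm, h, zero_mul]
      simp only [foldRho, foldArg]
      rw [this, squash_zero]
    refine Prod.ext (Prod.ext rfl ?_) ?_
    · simp only [foldMap]
      rw [h1, add_sub_cancel, mul_div_cancel_left₀ _ he]
    · have h2 : tiltTime θ * β s ^ 2 = 0 := by rw [pow_two, ← mul_assoc, h, zero_mul]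
      simp only [foldMap, foldHeight, foldArg]
      rw [h2, zero_mul, sub_zero]
  refine ⟨ε, hε, (isOrthogonalOn_iff isOpen_Iio).2 fun z s hs s' hs' ↦ ?_,
    (isOrthogonalOn_iff isOpen_Ioi).2 fun z s hs s' hs' ↦ ?_, _,
    isSmoothFamily_foldMap G hε (by linarith) hA hB he hw hm hβ hβ1
      (fun x ↦ (le_max_left _ _).trans (hmc x))
      (fun x ↦ ((le_max_left _ _).trans (le_max_right _ _)).trans (hmc x))
      (fun x s ↦ (mul_le_mul_of_nonneg_left (hβC s) zero_le_two).trans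
        (((le_max_right _ _).trans (le_max_right _ _)).trans (hmc x))) hmreg, ?_, ?_, ?_, ?_⟩
  · rw [Set.mem_Iio] at hs hs'
    exact hA z s (by linarith) s' (by linarith)
  · rw [Set.mem_Ioi] at hs hs'
    exact hB z s (by linarith) s' (by linarith)
  · intro z s
    rw [Set.mem_preimage, hval _ _ _ (by rw [tiltTime_zero, zero_mul]), shiftTime_zero, mul_zero,
      sub_zero]
    rcases le_or_gt (ε / 2) |s - b| with h | h
    · have : smoothAbs ε (s - b) = |s - b| := by
        rcases le_abs.1 h with h | h
        · rw [smoothAbs_of_le hε h, abs_of_nonneg (by linarith)]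
        · rw [smoothAbs_of_le_neg hε (by linarith), abs_of_nonpos (by linarith)]
      rw [this]
    · have h1 := abs_le.1 (abs_smoothAbs_le ε (s - b))
      exact ⟨hB _ _ (by linarith) _ (by linarith), hB _ _ (by linarith) _ (by linarith)⟩
  · intro z s
    rw [Set.mem_preimage, hval _ _ _ (by rw [tiltTime_one, zero_mul]), shiftTime_one, mul_one]
    have h1 : -(ε / 2) ≤ smoothAbs ε (s - b) := by
      rcases le_or_gt (ε / 2) |s - b| with h | h
      · rcases le_abs.1 h with h | h
        · rw [smoothAbs_of_le hε h]; linarith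
        · rw [smoothAbs_of_le_neg hε (by linarith)]; linarith
      · linarith [(abs_le.1 (abs_smoothAbs_le ε (s - b))).1]
    exact ⟨hA _ _ (by linarith) _ (by linarith), hA _ _ (by linarith) _ (by linarith)⟩
  · intro θ z s hs
    have h1 : s - b ≤ -(2 * ε) := by linarith
    have h2 := mul_nonneg (sub_nonneg.2 hab.le) (shiftTime_nonneg θ)
    rw [Set.mem_preimage, hval _ _ _ (by
      rw [hβ0 s (by rw [abs_of_nonpos (by linarith)]; linarith), mul_zero]),
      smoothAbs_of_le_neg hε (by linarith)]
    exact ⟨hA _ _ (by linarith) _ (by linarith), hA _ _ (by linarith) _ (by linarith)⟩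
  · intro θ z s hs
    have h1 : 2 * ε ≤ s - b := by linarith
    have h2 := mul_nonneg (sub_nonneg.2 hab.le) (shiftTime_nonneg θ)
    rw [Set.mem_preimage, hval _ _ _ (by
      rw [hβ0 s (by rw [abs_of_nonneg (by linarith)]; linarith), mul_zero]),
      smoothAbs_of_le hε (by linarith)]
    exact ⟨hA _ _ (by linarith) _ (by linarith), hA _ _ (by linarith) _ (by linarith)⟩

end FoldFamily

/-! ### Inverses of bordisms -/

section Flip

variable {E : Type*} [NormedAddCommGroup E] [NormedSpace ℝ E] [FiniteDimensional ℝ E]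
  {H : Type*} [TopologicalSpace H] (I : ModelWithCorners ℝ E H)
  (B : Type*) [TopologicalSpace B] [ChartedSpace H B] {k : ℕ}

/-- The reflection `(z, s) ↦ (z, c - s)` of `B × ℝ`. -/
def reflection (c : ℝ) : Diffeomorph (I.prod 𝓘(ℝ, ℝ)) (I.prod 𝓘(ℝ, ℝ)) (B × ℝ) (B × ℝ) ∞ where
  toFun p := (p.1, c - p.2)
  invFun p := (p.1, c - p.2)
  left_inv p := by simp
  right_inv p := by simp
  contMDiff_toFun := contMDiff_fst.prodMk (contMDiff_const.sub contMDiff_snd)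
  contMDiff_invFun := contMDiff_fst.prodMk (contMDiff_const.sub contMDiff_snd)

variable {I B} [T2Space B] [IsManifold I ∞ B] [I.Boundaryless]

/-- The flipped submanifold `(c - id)^* G`. -/
def PsiCyl.flip (G : PsiCyl B I k) (c : ℝ) : PsiCyl B I k := G.comap (reflection I B c)

theorem PsiCyl.mem_flip (G : PsiCyl B I k) (c : ℝ) (z : B) (s : ℝ) :
    (z, s) ∈ (G.flip c).carrier ↔ (z, c - s) ∈ G.carrier := Iff.rfl

theorem IsBordism.flip_zero {G : PsiCyl B I k} {a b : ℝ} (hG : IsBordism a b G) :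
    IsBordism (-b) (-a) (G.flip 0) := by
  obtain ⟨ε, hε, h1, h2⟩ := hG
  rw [isOrthogonalOn_iff isOpen_Iio] at h1
  rw [isOrthogonalOn_iff isOpen_Ioi] at h2
  simp only [Set.mem_Iio, Set.mem_Ioi] at h1 h2
  refine ⟨ε, hε, (isOrthogonalOn_iff isOpen_Iio).2 fun z s hs s' hs' ↦ ?_,
    (isOrthogonalOn_iff isOpen_Ioi).2 fun z s hs s' hs' ↦ ?_⟩
  · rw [Set.mem_Iio] at hs hs'
    simp only [PsiCyl.mem_flip]
    exact h2 z _ (by linarith) _ (by linarith)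
  · rw [Set.mem_Ioi] at hs hs'
    simp only [PsiCyl.mem_flip]
    exact h1 z _ (by linarith) _ (by linarith)

end Flip

section Inverses

variable {F : Type*} [NormedAddCommGroup F] [NormedSpace ℝ F] [FiniteDimensional ℝ F]
  {HN : Type*} [TopologicalSpace HN] {J : ModelWithCorners ℝ F HN} [J.Boundaryless]
  {N : Type*} [TopologicalSpace N] [ChartedSpace HN N] [IsManifold J ∞ N]
  [T2Space N] [SecondCountableTopology N] [SigmaCompactSpace N] [LocallyCompactSpace N]
  {k : ℕ} {a b : ℝ}

theorem isRightInverse_flip (G : PsiCyl (N × ℝ) (J.prod 𝓘(ℝ, ℝ)) k) (hab : a ≤ b)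
    (hG : IsBordism a b G) : IsRightInverse a b G (G.flip (2 * b)) := by
  obtain ⟨ε, hε, hA, hB, 𝒢, h𝒢, h0, h1, hl, hr⟩ := exists_isSmoothFamily_fold G hab hG
  rw [isOrthogonalOn_iff isOpen_Iio] at hA
  rw [isOrthogonalOn_iff isOpen_Ioi] at hB
  simp only [Set.mem_Iio, Set.mem_Ioi] at hA hB
  refine ⟨ε, hε, ?_, ?_, h𝒢.path, ?_, ?_, fun t ↦ ⟨?_, ?_⟩⟩
  · ext ⟨z, s⟩
    refine and_congr_left fun hs ↦ ?_
    simp only [Set.mem_Ioo] at hs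
    rw [PsiCyl.mem_flip]
    exact ⟨hB z _ (by linarith) _ (by linarith), hB z _ (by linarith) _ (by linarith)⟩
  · ext ⟨z, s⟩
    refine and_congr_left fun hs ↦ ?_
    simp only [Set.mem_Ioo] at hs
    change (z, 2 * b - (s + 2 * (b - a))) ∈ G.carrier ↔ _
    exact ⟨hA z _ (by linarith) _ (by linarith), hA z _ (by linarith) _ (by linarith)⟩
  · ext ⟨z, s⟩
    refine (h0 z s).trans ⟨fun h ↦ ?_, ?_⟩
    · rcases le_total s b with hs | hs
      · rw [abs_of_nonpos (by linarith), show b - -(s - b) = s by ring] at h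
        exact .inl ⟨h, show s < b + ε by linarith⟩
      · rw [abs_of_nonneg (by linarith), show b - (s - b) = 2 * b - s by ring] at h
        exact .inr ⟨h, show s > b - ε by linarith⟩
    · rintro (⟨h, hs⟩ | ⟨h, hs⟩)
      · simp only [Set.mem_Iio] at hs
        rcases le_total s b with hs' | hs'
        · rwa [abs_of_nonpos (by linarith), show b - -(s - b) = s by ring]
        · rw [abs_of_nonneg (by linarith)]
          exact hB z s (by linarith) _ (by linarith) h
      · simp only [Set.mem_Ioi] at hs
        rw [PsiCyl.mem_flip] at h
        rcases le_total s b with hs' | hs'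
        · rw [abs_of_nonpos (by linarith)]
          exact hB z _ (by linarith) _ (by linarith) h
        · rwa [abs_of_nonneg (by linarith), show b - (s - b) = 2 * b - s by ring]
  · exact (isOrthogonalOn_iff isOpen_Ioo).2 fun z s _ s' _ h ↦ (h1 z s').2 ((h1 z s).1 h)
  · ext ⟨z, s⟩
    exact and_congr_left fun hs ↦ hl _ z s hs
  · ext ⟨z, s⟩
    exact and_congr_left fun hs ↦ hr _ z s hs

/-- The path is the mirror image of the folding family of the flip of `G`. -/
theorem isLeftInverse_flip (G : PsiCyl (N × ℝ) (J.prod 𝓘(ℝ, ℝ)) k) (hab : a ≤ b)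
    (hG : IsBordism a b G) : IsLeftInverse a b G (G.flip (2 * a)) := by
  obtain ⟨ε, hε, hA', hB', 𝒢, h𝒢, h0', h1', hl', hr'⟩ :=
    exists_isSmoothFamily_fold (G.flip 0) (neg_le_neg hab) hG.flip_zero
  rw [isOrthogonalOn_iff isOpen_Iio] at hA'
  rw [isOrthogonalOn_iff isOpen_Ioi] at hB'
  simp only [Set.mem_Iio, Set.mem_Ioi, PsiCyl.mem_flip] at hA' hB' h0' h1' hl' hr'
  have hA : ∀ z, ∀ s < a + ε, ∀ s' < a + ε, (z, s) ∈ G.carrier → (z, s') ∈ G.carrier :=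
    fun z s hs s' hs' ↦ by
      simpa using hB' z (-s) (by linarith) (-s') (by linarith)
  have hB : ∀ z, ∀ s > b - ε, ∀ s' > b - ε, (z, s) ∈ G.carrier → (z, s') ∈ G.carrier :=
    fun z s hs s' hs' ↦ by
      simpa using hA' z (-s) (by linarith) (-s') (by linarith)
  have h0 : ∀ z s, ((0 : ℝ), (z, 0 - s)) ∈ 𝒢 ↔ (z, a + |s - a|) ∈ G.carrier := fun z s ↦ by
    rw [h0', show 0 - s - -a = -(s - a) by ring, abs_neg,
      show 0 - (-a - |s - a|) = a + |s - a| by ring]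
  refine ⟨ε, hε, ?_, ?_, (h𝒢.comap (reflection _ _ 0)).path, ?_, ?_, fun t ↦ ⟨?_, ?_⟩⟩
  · ext ⟨z, s⟩
    refine and_congr_left fun hs ↦ ?_
    simp only [Set.mem_Ioo] at hs
    rw [PsiCyl.mem_flip]
    exact ⟨hA z _ (by linarith) _ (by linarith), hA z _ (by linarith) _ (by linarith)⟩
  · ext ⟨z, s⟩
    refine and_congr_left fun hs ↦ ?_
    simp only [Set.mem_Ioo] at hs
    change (z, 2 * a - (s - 2 * (b - a))) ∈ G.carrier ↔ _
    exact ⟨hB z _ (by linarith) _ (by linarith), hB z _ (by linarith) _ (by linarith)⟩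
  · ext ⟨z, s⟩
    refine (h0 z s).trans ⟨fun h ↦ ?_, ?_⟩
    · rcases le_total s a with hs | hs
      · rw [abs_of_nonpos (by linarith), show a + -(s - a) = 2 * a - s by ring] at h
        exact .inl ⟨h, show s < a + ε by linarith⟩
      · rw [abs_of_nonneg (by linarith), show a + (s - a) = s by ring] at h
        exact .inr ⟨h, show s > a - ε by linarith⟩
    · rintro (⟨h, hs⟩ | ⟨h, hs⟩)
      · simp only [Set.mem_Iio] at hs
        rw [PsiCyl.mem_flip] at h
        rcases le_total s a with hs' | hs'
        · rwa [abs_of_nonpos (by linarith), show a + -(s - a) = 2 * a - s by ring]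
        · rw [abs_of_nonneg (by linarith)]
          exact hA z _ (by linarith) _ (by linarith) h
      · simp only [Set.mem_Ioi] at hs
        rcases le_total s a with hs' | hs'
        · rw [abs_of_nonpos (by linarith)]
          exact hA z s (by linarith) _ (by linarith) h
        · rwa [abs_of_nonneg (by linarith), show a + (s - a) = s by ring]
  · exact (isOrthogonalOn_iff isOpen_Ioo).2 fun z s _ s' _ h ↦
      (h1' z (0 - s')).2 ((h1' z (0 - s)).1 h)
  · ext ⟨z, s⟩
    refine and_congr_left fun hs ↦ ?_
    simp only [Set.mem_Iio] at hs
    refine (hr' _ z (0 - s) (by linarith)).trans ?_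
    rw [PsiCyl.mem_flip, show 0 - (2 * -a - (0 - s)) = 2 * a - s by ring]
  · ext ⟨z, s⟩
    refine and_congr_left fun hs ↦ ?_
    simp only [Set.mem_Ioi] at hs
    refine (hl' _ z (0 - s) (by linarith)).trans ?_
    rw [sub_sub_cancel]

end Inverses

end SubmanifoldSheaf

end

theorem proposition3p7 (n k : ℕ)
    (N : Type*) [TopologicalSpace N] [T2Space N] [SecondCountableTopology N]
    [ChartedSpace (EuclideanSpace ℝ (Fin n)) N] [IsManifold (𝓡 n) ∞ N]
    (M : Type*) [TopologicalSpace M] [T2Space M] [SecondCountableTopology M]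
    [ChartedSpace (EuclideanHalfSpace (n + 2)) M] [IsManifold (𝓡∂ (n + 2)) ∞ M]
    (bM : SubmanifoldSheaf.BoundaryIdentification ((𝓡 n).prod 𝓘(ℝ, ℝ)) (N × ℝ)
      (𝓡∂ (n + 2)) M) :
    SubmanifoldSheaf.IsGroupLikeAt k bM ∧
    ∀ (a b : ℝ), a ≤ b →
      ∀ G : SubmanifoldSheaf.PsiCyl (N × ℝ) ((𝓡 n).prod 𝓘(ℝ, ℝ)) k,
        SubmanifoldSheaf.IsBordism a b G →
        (∃ R : SubmanifoldSheaf.PsiCyl (N × ℝ) ((𝓡 n).prod 𝓘(ℝ, ℝ)) k,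
          R.carrier = SubmanifoldSheaf.pull (fun s ↦ 2 * b - s) G.carrier ∧
          SubmanifoldSheaf.IsRightInverse a b G R) ∧
        (∃ L : SubmanifoldSheaf.PsiCyl (N × ℝ) ((𝓡 n).prod 𝓘(ℝ, ℝ)) k,
          L.carrier = SubmanifoldSheaf.pull (fun s ↦ 2 * a - s) G.carrier ∧
          SubmanifoldSheaf.IsLeftInverse a b G L) := by
  have : LocallyCompactSpace N := ChartedSpace.locallyCompactSpace (EuclideanSpace ℝ (Fin n)) N
  refine ⟨fun G hG ↦ ⟨⟨_, SubmanifoldSheaf.isRightInverse_flip G zero_le_one hG⟩,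
    ⟨_, SubmanifoldSheaf.isLeftInverse_flip G zero_le_one hG⟩⟩, fun a b hab G hG ↦
    ⟨⟨G.flip (2 * b), rfl, SubmanifoldSheaf.isRightInverse_flip G hab hG⟩,
      ⟨G.flip (2 * a), rfl, SubmanifoldSheaf.isLeftInverse_flip G hab hG⟩⟩⟩
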